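/- Let $K$ be a finite simplicial complex triangulating a closed oriented PL 3-manifold, with vertex set $K_0$, edge set $E$ and set of tetrahedra $K_3$. A map $x\colon K_0\to\mathbb R^3$ is called nondegenerate if it sends the vertices of every tetrahedron of $K$ to affinely independent points (the tetrahedra may intersect each other arbitrarily). It determines the permitted length configuration $l(x)=(|x_a-x_b|)_{ab\in E}$; the variety of permitted length configurations is the image of $x\mapsto l(x)$, and its tangent space $T_x\subset\mathbb R^E$ at $l(x)$ (for the branch through $x$) is the image of the differential of this map at $x$. For edge lengths $l$ near $l(x)$ put $$\omega_e(l)=-\sum_{T\ni e}\varepsilon_T\,\varphi_{T,e}(l),$$ where $\varphi_{T,e}$ is the interior dihedral angle at the edge $e$ of the Euclidean tetrahedron $T$ with the given edge lengths, and $\varepsilon_T=\pm1$ according to whether $x$ preserves or reverses the orientation of $T$. Let $A=A(x)=(\partial\omega_j/\partial l_k)_{j,k\in E}$ at $l=l(x)$, and let $F_x=\ker A(x)\subset\mathbb R^E$ be the space of length differentials with zero infinitesimal defect angles. Call $\mathcal C\subset E$ basic at $x$ if $|\mathcal C|=\operatorname{rank}A$ and $f=\det(A|_{\mathcal C})\ne0$,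 where $A|_{\mathcal C}$ consists of the rows and columns of $A$ indexed by $\mathcal C$; put $\overline{\mathcal C}=E\setminus\mathcal C$, and let $V_T$ be the volume of the tetrahedron $T$ placed in $\mathbb R^3$ by $x$. Consider the form $$\Omega_{\mathcal C}=\left|\frac{\prod_{e\in E}l_e\;\bigwedge_{e\in\overline{\mathcal C}}dl_e}{\sqrt{|f|\prod_{T\in K_3}6V_T}}\right| .$$ Then: 1. There is a set $\mathcal C\subset E$ which is basic at all $x$ in an open dense set of nondegenerate maps. 2. For every nondegenerate $x$ one has $T_x\subseteq F_x$, with equality if the first Betti number of $K$ is zero. For $\mathcal C$ basic at $x$, the degree $|\overline{\mathcal C}|$ of $\Omega_{\mathcal C}$ equals $\dim F_x$ and $\Omega_{\mathcal C}$ is nonzero on $F_x$. In particular, if the first Betti number of $K$ is zero, then the degree of $\Omega_{\mathcal C}$ equals the dimension of the variety of permitted length configurations at $l(x)$, and $\Omega_{\mathcal C}$ is a nonzero form of top degree on $T_x$. 3. If $\mathcal C$ and $\mathcal C'$ are both basic at a nondegenerate $x$, then $\Omega_{\mathcal C}=\Omega_{\mathcal C'}$ on $F_x$, and in particular on $T_x$.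 4. Let the complex $K'$ (a triangulation of the same type, with any orientation) be obtained from $K$ by a $2\to3$ Pachner move, i.e. two tetrahedra $abcd$, $abce$ are replaced with $abde$, $bcde$, $acde$, where $de$ was not an edge of $K$; equivalently, $K$ is obtained from $K'$ by a $3\to2$ move. Let $x$ be nondegenerate for both $K$ and $K'$. Then forgetting the length of the edge $de$ gives bijections $F'_x\to F_x$ and $T'_x\to T_x$ between the respective spaces for $K'$ and $K$, and under them $\Omega_{\mathcal C}=\Omega_{\mathcal C'}$ for every $\mathcal C$ basic at $x$ for $K$ and every $\mathcal C'$ basic at $x$ for $K'$. -/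

import Mathlib

open Real

noncomputable section

/-- The Euclidean space `ℝ³`. -/
abbrev E3 : Type := EuclideanSpace ℝ (Fin 3)

/-! ### Combinatorics: closed oriented triangulated 3-manifolds -/

section Combinatorics

variable {V : Type*} [DecidableEq V]

/-- The link of the vertex `v` in a pure complex; a pure complex is given by its facets. -/
def facetLink (L : Finset (Finset V)) (v : V) : Finset (Finset V) :=
  (L.filter (fun t => v ∈ t)).image (fun t => t.erase v)

/-- Any two facets are joined by a chain of facets in which consecutive ones share a face of
codimension one. -/
def FacetConnected (L : Finset (Finset V)) : Prop :=
  ∀ s ∈ L, ∀ t ∈ L,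
    Relation.ReflTransGen (fun p q => q ∈ L ∧ (p ∩ q).card + 1 = p.card) s t

/-- A finite set of triangles which triangulates the 2-sphere: a connected closed surface (each
edge lies in exactly two triangles, each vertex link is a single cycle) of Euler
characteristic 2. -/
structure IsTriangulatedSphere (L : Finset (Finset V)) : Prop where
  card_eq : ∀ t ∈ L, t.card = 3
  edge_two : ∀ t ∈ L, ∀ e ⊆ t, e.card = 2 → (L.filter (fun s => e ⊆ s)).card = 2
  link_connected : ∀ v, FacetConnected (facetLink L v)
  nonempty : L.Nonempty
  connected : FacetConnected L
  euler : ((L.biUnion id).card : ℤ) - ((L.biUnion (Finset.powersetCard 2)).card : ℤ)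
    + (L.card : ℤ) = 2

variable (V) in
/-- A finite simplicial complex, made of tetrahedra and their faces, which triangulates a closed
PL 3-manifold: the link of every vertex is a triangulated 2-sphere. (In particular every triangle
lies in exactly two tetrahedra.) The complex is given by the vertex sets of its tetrahedra; its
vertices are the elements of `V` that lie in a tetrahedron. -/
structure ClosedTriangulation where
  /-- the vertex sets of the tetrahedra -/
  tets : Finset (Finset V)
  card_tet : ∀ T ∈ tets, T.card = 4
  link_sphere : ∀ v, (∃ T ∈ tets, v ∈ T) → IsTriangulatedSphere (facetLink tets v)

namespace ClosedTriangulation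

/-- The edges of the complex. -/
def edges (K : ClosedTriangulation V) : Finset (Sym2 V) :=
  K.tets.biUnion (fun T => T.sym2.filter (fun e => ¬ e.IsDiag))

/-- The type of edges of the complex. -/
abbrev Edge (K : ClosedTriangulation V) : Type _ := {e : Sym2 V // e ∈ K.edges}

/-- A consistent orientation of all the tetrahedra: a sign for every ordering of the vertices of a
tetrahedron, alternating under permutations of the vertices, such that any two tetrahedra with a
common triangle induce opposite orientations on it. -/
structure Orientation (K : ClosedTriangulation V) where
  /-- the sign of an ordered tetrahedron -/
  sign : (Fin 4 → V) → ℤˣ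
  sign_perm : ∀ (v : Fin 4 → V) (σ : Equiv.Perm (Fin 4)), Finset.univ.image v ∈ K.tets →
    sign (v ∘ σ) = Equiv.Perm.sign σ * sign v
  consistent : ∀ a b c d e : V, d ≠ e → ({a, b, c, d} : Finset V) ∈ K.tets →
    ({a, b, c, e} : Finset V) ∈ K.tets → sign ![a, b, c, e] = - sign ![a, b, c, d]

/-- The first simplicial cohomology with real coefficients vanishes, i.e. the first Betti number
is zero: every 1-cocycle is a coboundary. (Any three vertices of a tetrahedron span a face of the
complex; the cases with equal vertices say that the cochain is alternating.) -/
def FirstBettiZero (K : ClosedTriangulation V) : Prop :=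
  ∀ z : V → V → ℝ,
    (∀ T ∈ K.tets, ∀ a ∈ T, ∀ b ∈ T, ∀ c ∈ T, z a b + z b c = z a c) →
    ∃ g : V → ℝ, ∀ T ∈ K.tets, ∀ a ∈ T, ∀ b ∈ T, z a b = g b - g a

/-- `K'` is obtained from `K` by a `2 → 3` Pachner move (and `K` from `K'` by a `3 → 2` move): two
tetrahedra `abcd`, `abce` with the common triangle `abc` are replaced with the three tetrahedra
`abde`, `bcde`, `acde` around the new edge `de`. -/
def PachnerMove (K K' : ClosedTriangulation V) : Prop :=
  ∃ a b c d e : V, d ≠ e ∧ ({a, b, c, d} : Finset V) ∈ K.tets ∧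
    ({a, b, c, e} : Finset V) ∈ K.tets ∧ s(d, e) ∉ K.edges ∧
    K'.tets = (K.tets \ {{a, b, c, d}, {a, b, c, e}}) ∪
      {{a, b, d, e}, {b, c, d, e}, {a, c, d, e}}

/-- Two functions on the edges of two complexes (with vertices in the same set) agree on the
common edges. -/
def Agree (K K' : ClosedTriangulation V) (w : K.Edge → ℝ) (w' : K'.Edge → ℝ) : Prop :=
  ∀ (e : Sym2 V) (h : e ∈ K.edges) (h' : e ∈ K'.edges), w ⟨e, h⟩ = w' ⟨e, h'⟩

end ClosedTriangulation

end Combinatorics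

/-! ### Geometry of a Euclidean tetrahedron -/

/-- Inner product of two vectors of lengths `p`, `q` whose difference has length `r`. -/
def innerOfLengths (p q r : ℝ) : ℝ := (p ^ 2 + q ^ 2 - r ^ 2) / 2

/-- The (interior) dihedral angle at the edge `ab` of a Euclidean tetrahedron `abcd`, as a function
of the six edge lengths: the angle between the components of `ac` and `ad` orthogonal to `ab`. -/
def dihedral (ab ac ad bc bd cd : ℝ) : ℝ :=
  arccos ((ab ^ 2 * innerOfLengths ac ad cd - innerOfLengths ab ac bc * innerOfLengths ab ad bd) /
    (√(ab ^ 2 * ac ^ 2 - innerOfLengths ab ac bc ^ 2) *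
      √(ab ^ 2 * ad ^ 2 - innerOfLengths ab ad bd ^ 2)))

/-- `dihedral` is the geometric dihedral angle. -/
theorem dihedral_dist (a b c d : E3) (h : a ≠ b) :
    dihedral (dist a b) (dist a c) (dist a d) (dist b c) (dist b d) (dist c d) =
      InnerProductGeometry.angle
        ((c - a) - (inner ℝ (b - a) (c - a) / ‖b - a‖ ^ 2) • (b - a))
        ((d - a) - (inner ℝ (b - a) (d - a) / ‖b - a‖ ^ 2) • (b - a)) := by
  have key : ∀ p q : E3, innerOfLengths (dist a p) (dist a q) (dist p q) =
      inner ℝ (p - a) (q - a) := by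
    intro p q
    have := norm_sub_sq_real (p - a) (q - a)
    rw [sub_sub_sub_cancel_right] at this
    rw [innerOfLengths, dist_comm a p, dist_comm a q, dist_eq_norm, dist_eq_norm, dist_eq_norm,
      this]
    ring
  rw [dihedral, key, key, key, dist_comm a b, dist_comm a c, dist_comm a d, dist_eq_norm,
    dist_eq_norm, dist_eq_norm, InnerProductGeometry.angle]
  generalize hu : b - a = u
  generalize c - a = v
  generalize d - a = w
  have hn : ‖u‖ ≠ 0 := by rw [← hu]; simpa [sub_eq_zero] using h.symm
  have hpos : 0 < ‖u‖ := by positivity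
  have n : ∀ v : E3, √(‖u‖ ^ 2 * ‖v‖ ^ 2 - inner ℝ u v ^ 2) =
      ‖u‖ * ‖v - (inner ℝ u v / ‖u‖ ^ 2) • u‖ := by
    intro v
    rw [← Real.sqrt_sq (by positivity : 0 ≤ ‖u‖ * ‖v - (inner ℝ u v / ‖u‖ ^ 2) • u‖), mul_pow,
      norm_sub_sq_real, inner_smul_right, norm_smul, real_inner_comm, Real.norm_eq_abs, mul_pow,
      sq_abs]
    congr 1
    field_simp
    ring
  rw [n, n]
  congr 1
  simp only [inner_sub_left, inner_sub_right, inner_smul_left, inner_smul_right,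
    real_inner_self_eq_norm_sq, RCLike.conj_to_real, real_inner_comm u v]
  rw [mul_mul_mul_comm, ← pow_two, ← div_div]
  congr 1
  field_simp
  ring

/-- Six times the signed volume of the tetrahedron with the given ordered vertices. -/
def signedSixVol (p : Fin 4 → E3) : ℝ :=
  Matrix.det (Matrix.of fun i j : Fin 3 => p i.succ j - p 0 j)

/-! ### Metrized complexes -/

namespace ClosedTriangulation

variable {V : Type*} [Fintype V] [DecidableEq V] (K : ClosedTriangulation V)

/-- The edge lengths of the complex when its vertices are put into `ℝ³` by `x`. The values of
`lengthMap` are the permitted length configurations. -/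
def lengthMap (x : V → E3) (e : K.Edge) : ℝ :=
  Sym2.lift ⟨fun a b => dist (x a) (x b), fun a b => dist_comm (x a) (x b)⟩ e.1

/-- All tetrahedra are nondegenerate in `ℝ³`. (They may intersect each other in any way.) -/
def Nondegenerate (x : V → E3) : Prop :=
  ∀ T ∈ K.tets, AffineIndependent ℝ (fun i : T => x i)

/-- The tangent space, at the point `lengthMap x`, to (the branch through `x` of) the variety of
permitted length configurations, which is the image of `lengthMap`. -/
def tangent (x : V → E3) : Submodule ℝ (K.Edge → ℝ) :=
  LinearMap.range (fderiv ℝ K.lengthMap x).toLinearMap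

/-- Six times the volume of a tetrahedron of the complex. -/
def sixVol (x : V → E3) (T : {T // T ∈ K.tets}) : ℝ :=
  |signedSixVol fun i => x ((T.1.equivFinOfCardEq (K.card_tet T.1 T.2)).symm i).1|

/-- The length of the edge `ab`, if it belongs to the complex. -/
def len (l : K.Edge → ℝ) (a b : V) : ℝ :=
  if h : s(a, b) ∈ K.edges then l ⟨s(a, b), h⟩ else 0

variable {K}

/-- `1` if the map `x` preserves the orientation of the tetrahedron with the ordered vertices `v`,
and `-1` if `x` reverses it. -/
def Orientation.placement (o : K.Orientation) (x : V → E3) (v : Fin 4 → V) : ℝ :=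
  ((o.sign v : ℤ) : ℝ) * (SignType.sign (signedSixVol fun i => x (v i)) : ℝ)

/-- The defect angle around the edge `e` for the edge lengths `l`, in the vicinity of a permitted
configuration coming from `x`: the algebraic sum of the dihedral angles at `e`, with the sign `-`
for the tetrahedra whose orientation `x` preserves and `+` for the other ones. The tetrahedra
around `e = ab` correspond to their edges `f = cd` opposite to `e`. -/
def Orientation.defect (o : K.Orientation) (x : V → E3) (l : K.Edge → ℝ) (e : K.Edge) : ℝ :=
  - ∑ f : Sym2 V with
      ({e.1.out.1, e.1.out.2, f.out.1, f.out.2} : Finset V) ∈ K.tets,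
    o.placement x ![e.1.out.1, e.1.out.2, f.out.1, f.out.2] *
      dihedral (K.len l e.1.out.1 e.1.out.2)
        (K.len l e.1.out.1 f.out.1) (K.len l e.1.out.1 f.out.2)
        (K.len l e.1.out.2 f.out.1) (K.len l e.1.out.2 f.out.2)
        (K.len l f.out.1 f.out.2)

/-- The matrix `A = (∂ω_j / ∂l_k)` of partial derivatives of all the defect angles in all the edge
lengths, at the permitted configuration coming from `x`. -/
def Orientation.curvMatrix (o : K.Orientation) (x : V → E3) : Matrix K.Edge K.Edge ℝ :=
  Matrix.of fun j k =>
    deriv (fun t => o.defect x (Function.update (K.lengthMap x) k t) j) (K.lengthMap x k)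

/-- The length differentials for which all infinitesimal defect angles vanish. -/
def Orientation.flat (o : K.Orientation) (x : V → E3) : Submodule ℝ (K.Edge → ℝ) :=
  LinearMap.ker (Matrix.toLin' (o.curvMatrix x))

/-- `f = det (A|_C)`. -/
def Orientation.minor (o : K.Orientation) (x : V → E3) (C : Finset K.Edge) : ℝ :=
  ((o.curvMatrix x).submatrix (fun i : C => i.1) (fun i : C => i.1)).det

/-- `A|_C` is a nondegenerate submatrix of `A` of size `rank A × rank A`. -/
def Orientation.IsBasic (o : K.Orientation) (x : V → E3) (C : Finset K.Edge) : Prop :=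
  C.card = (o.curvMatrix x).rank ∧ o.minor x C ≠ 0

/-- The alternating form `dl_{s 0} ∧ ⋯ ∧ dl_{s (d-1)}` on the space of length differentials. -/
def lengthWedge {d : ℕ} (s : Fin d → K.Edge) : (K.Edge → ℝ) [⋀^Fin d]→ₗ[ℝ] ℝ :=
  Matrix.detRowAlternating.compLinearMap (LinearMap.funLeft ℝ ℝ s)

/-- The form `∏ l · ⋀_{C̄} dl / √(|f| ∏ 6V)`, where `C̄` is the complement of `C`, written in the
order given by `s`. -/
def Orientation.form (o : K.Orientation) (x : V → E3) (C : Finset K.Edge) {d : ℕ}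
    (s : Fin d ≃ {e : K.Edge // e ∉ C}) : (K.Edge → ℝ) [⋀^Fin d]→ₗ[ℝ] ℝ :=
  ((∏ e : K.Edge, K.lengthMap x e) /
      √(|o.minor x C| * ∏ T : {T // T ∈ K.tets}, K.sixVol x T)) •
    lengthWedge (fun i => (s i).1)

end ClosedTriangulation

end

/-! Everything is written in the halved rates m_ab = l_ab dl_ab of the squared edge lengths. If the
vertices of a tetrahedron move in space, its dihedral angle at ab changes by the difference of the
rotation rates of its two faces about ab (`posRate_stretch`). In terms of the m's this variation is,
up to a factor, a linear form in which the opposite edge cd has coefficient 1 and the coefficient of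
the adjacent edge ac is symmetric in b and c (`posRate_eq`). The sign of a tetrahedron and its
absolute volume combine into the value of the orientation chain divided by the signed volume. So A
depends linearly on an alternating 3-chain; it is symmetric for every such chain
(`chainMatrix_isSymm`), and if the chain is a cycle, the face rotations cancel in pairs, so motions
of the vertices lie in the kernel (`IsCycle.curv_stretch`). This gives T ⊆ F.

For F ⊆ T (`flat_le_tangent`), realize given length rates in each tetrahedron separately by
velocities of its vertices. Across a triangle the two choices differ by an infinitesimal rigid
motion. Around an edge these jumps add up to a rotation about that edge by the infinitesimal defect
angle, hence to zero. So the jumps form a dual 1-cocycle with values in the six-dimensional space of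
infinitesimal rigid motions; when the first Betti number is zero it is a coboundary
(`IsDualCocycle.exists_potential`), and correcting each tetrahedron by its potential glues the
velocities.

For independence of C, let the columns of W be a basis of ker A and let L be a left inverse of W.
Then the principal minor on C equals det(W on the complement of C)² · det(A + LᵀL)
(`det_principal_eq`). The square root of |f| therefore cancels the value of the wedge product on W,
and |Ω| becomes an expression without C (`Orientation.abs_form`). A basic set exists because a
symmetric matrix has a nonzero principal minor of the size of its rank; it stays basic generically
because, apart from a nonzero product of lengths, this minor is a rational function of the vertex
coordinates.

A 2 → 3 move changes the orientation chain by ± the boundary of the 4-simplex abcde. All edge rates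
of this simplex except that of de are induced by a motion, so the matrix of the boundary has rank at
most one (`IsCycle.exists_curv_eq_mul`); since its entries at opposite edges are known, so is its
diagonal entry at de (`IsCycle.curv_pairInd_self`). The new A is the old one bordered by zeros plus
this rank-one matrix, and a Schur complement multiplies the determinant by the entry at de, whose
absolute value is l_de² times the old volumes over the new ones. This is exactly compensated by the
factor l_de in the numerator and by the change of the volume product. -/

set_option linter.unusedSectionVars false

/-! ### Linear algebra of symmetric matrices -/

section LinearAlgebra

open Matrix

variable {E : Type*} [Fintype E] [DecidableEq E]

/-- For a symmetric matrix `A` and vectors `W` in its kernel, the principal minors of `A` are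
proportional to the squares of the complementary minors of `W`. -/
theorem det_principal_eq (A : Matrix E E ℝ) (hA : A.IsSymm) {d : ℕ} (W : Matrix E (Fin d) ℝ)
    (L : Matrix (Fin d) E ℝ) (hAW : A * W = 0) (hLW : L * W = 1) (C : Finset E)
    (s : Fin d ≃ {e : E // e ∉ C}) :
    (A.submatrix (fun i : C => i.1) (fun i : C => i.1)).det =
      (W.submatrix (fun i => (s i).1) id).det ^ 2 * (A + Lᵀ * L).det := by
  let eq : C ⊕ Fin d ≃ E :=
    (Equiv.sumCongr (Equiv.refl _) s).trans (Equiv.sumCompl (fun e : E => e ∈ C))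
  -- `Z` completes `W` to a square matrix by the coordinate vectors of `C`. The determinant of `Zᵀ *
  -- M * Z` is then evaluated both as a product and by blocks.
  let Z : Matrix E (C ⊕ Fin d) ℝ := fun e => Sum.elim (fun c => if e = c.1 then 1 else 0) (W e)
  set M := A + Lᵀ * L with hM
  have hMW : M * W = Lᵀ := by
    rw [hM, Matrix.add_mul, hAW, Matrix.mul_assoc, hLW, zero_add, Matrix.mul_one]
  have hMs : Mᵀ = M := by
    rw [hM, transpose_add, hA.eq, transpose_mul, transpose_transpose]
  have hWM : Wᵀ * M = L := by
    rw [← transpose_transpose (Wᵀ * M), transpose_mul, transpose_transpose, hMs, hMW,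
      transpose_transpose]
  have hZ : (Z.submatrix eq id).det = (W.submatrix (fun i => (s i).1) id).det := by
    have : Z.submatrix eq id = fromBlocks 1 (W.submatrix (fun i : C => i.1) id) 0
        (W.submatrix (fun i => (s i).1) id) := by
      ext i j
      rcases i with i | i <;> rcases j with j | j
      · change (if i.1 = j.1 then (1 : ℝ) else 0) = (1 : Matrix C C ℝ) i j
        simp only [Matrix.one_apply, Subtype.ext_iff]
      · rfl
      · have : (s i).1 ≠ j.1 := fun h => (s i).2 (h ▸ j.2)
        change (if (s i).1 = j.1 then (1 : ℝ) else 0) = 0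
        rw [if_neg this]
      · rfl
    rw [this, det_fromBlocks_zero₂₁, det_one, one_mul]
  have hZZ : Zᵀ * M * Z = fromBlocks (M.submatrix (fun i : C => i.1) (fun i : C => i.1))
      (Lᵀ.submatrix (fun i : C => i.1) id) (L.submatrix id (fun i : C => i.1)) 1 := by
    have h1 : ∀ (B : Matrix E E ℝ) (i j), (Zᵀ * B * Z) i j = ∑ a, ∑ b, Z b i * B b a * Z a j := by
      intro B i j
      simp [Matrix.mul_apply, Finset.sum_mul]
    ext i j
    rcases i with i | i <;> rcases j with j | j
    · rw [h1]; simp [Z]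
    · have := congrFun (congrFun hMW i.1) j
      simp only [Matrix.mul_apply, Matrix.transpose_apply] at this
      rw [h1]; simp [Z, this]
    · have := congrFun (congrFun hWM i) j.1
      simp only [Matrix.mul_apply, Matrix.transpose_apply] at this
      rw [h1]; simp [Z, this]
    · have h2 : Wᵀ * M * W = 1 := by rw [hWM, hLW]
      have := congrFun (congrFun h2 i) j
      simp only [Matrix.mul_apply, Matrix.transpose_apply, Finset.sum_mul] at this
      rw [h1]; simp [Z, this]
  have hdet : (Zᵀ * M * Z).det = (Z.submatrix eq id).det ^ 2 * M.det := by
    have : Zᵀ * M * Z = (Z.submatrix eq id)ᵀ * M.submatrix eq eq * Z.submatrix eq id := by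
      have e1 : (Z.submatrix eq id)ᵀ = Zᵀ.submatrix id eq := rfl
      rw [e1, Matrix.submatrix_mul_equiv, Matrix.submatrix_mul_equiv, Matrix.submatrix_id_id]
    rw [this, det_mul, det_mul, det_transpose, Matrix.det_submatrix_equiv_self]
    ring
  -- The Schur complement of the identity block subtracts `Lᵀ * L` on `C` and leaves the principal
  -- block of `A`.
  rw [← hZ, ← hdet, hZZ, det_fromBlocks_one₂₂]
  congr 1
  ext i j
  simp [hM, Matrix.mul_apply]

/-- A symmetric matrix has a nonzero principal minor of the size of its rank. -/
theorem exists_principal_minor_ne_zero (A : Matrix E E ℝ) (hA : A.IsSymm) :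
    ∃ C : Finset E, C.card = A.rank ∧
      (A.submatrix (fun i : C => i.1) (fun i : C => i.1)).det ≠ 0 := by
  classical
  obtain ⟨b, -, -, hspan, hli⟩ := exists_linearIndepOn_extension (K := ℝ) (v := A.row)
    (linearIndepOn_empty ℝ _) (Set.empty_subset Set.univ)
  rw [Set.image_univ] at hspan
  have hspan' : Submodule.span ℝ (Set.range A.row) = Submodule.span ℝ (A.row '' b) :=
    le_antisymm (Submodule.span_le.2 hspan) (Submodule.span_mono (Set.image_subset_range _ _))
  refine ⟨b.toFinset, ?_, ?_⟩
  · rw [Matrix.rank_eq_finrank_span_row, hspan', Set.image_eq_range,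
      finrank_span_eq_card (hli : LinearIndependent ℝ _), Set.toFinset_card]
  -- A null vector of the principal block, extended by zero, is orthogonal to the rows in `b` and
  -- hence to all rows. By symmetry this is a linear relation among the independent rows in `b`.
  · intro hdet
    obtain ⟨v, hv0, hv⟩ := Matrix.exists_mulVec_eq_zero_iff.2 hdet
    apply hv0
    let w : E → ℝ := fun e => if h : e ∈ b.toFinset then v ⟨e, h⟩ else 0
    have hsum : ∀ e, A.row e ⬝ᵥ w = ∑ i : b.toFinset, A e i * v i := by
      intro e
      rw [dotProduct, ← Finset.sum_subset (Finset.subset_univ b.toFinset)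
        (fun i _ hi => by simp only [w, dif_neg hi, mul_zero]),
        ← Finset.sum_coe_sort b.toFinset]
      exact Finset.sum_congr rfl fun i _ => by simp only [w, dif_pos i.2, Subtype.coe_eta]; rfl
    have hz : ∀ u ∈ Submodule.span ℝ (A.row '' b), u ⬝ᵥ w = 0 := by
      intro u hu
      induction hu using Submodule.span_induction with
      | mem u hu =>
        obtain ⟨e, he, rfl⟩ := hu
        rw [hsum]
        exact congrFun hv ⟨e, Set.mem_toFinset.2 he⟩
      | zero => simp
      | add u u' _ _ h h' => rw [add_dotProduct, h, h', add_zero]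
      | smul c u _ h => rw [smul_dotProduct, h, smul_zero]
    have hli' : LinearIndependent ℝ (fun i : b.toFinset => A.row i.1) :=
      LinearIndependent.comp hli (fun i : b.toFinset => (⟨i.1, Set.mem_toFinset.1 i.2⟩ : b))
        (fun i j h => Subtype.ext (by simpa using h))
    refine funext (Fintype.linearIndependent_iff.1 hli' v ?_)
    ext e
    have := hz (A.row e) (hspan ⟨e, rfl⟩)
    rw [hsum] at this
    rw [Finset.sum_apply, Pi.zero_apply, ← this]
    refine Finset.sum_congr rfl fun i _ => ?_
    rw [Pi.smul_apply, smul_eq_mul, mul_comm]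
    congr 1
    exact hA.apply e i.1

/-- If the rank of `A` is the size of its nondegenerate principal submatrix on `C`, then the
kernel projects isomorphically to the coordinates outside `C`. -/
theorem kernel_of_principal_minor (A : Matrix E E ℝ) (C : Finset E) (hC : C.card = A.rank)
    (hdet : (A.submatrix (fun i : C => i.1) (fun i : C => i.1)).det ≠ 0) {d : ℕ}
    (s : Fin d ≃ {e : E // e ∉ C}) :
    d = Module.finrank ℝ (LinearMap.ker (Matrix.toLin' A)) ∧
    ∃ w : Fin d → E → ℝ, (∀ i, w i ∈ LinearMap.ker (Matrix.toLin' A)) ∧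
      ∀ i j, w i (s j).1 = if i = j then 1 else 0 := by
  have h1 : d = Module.finrank ℝ (LinearMap.ker (Matrix.toLin' A)) := by
    have hr := LinearMap.finrank_range_add_finrank_ker (Matrix.toLin' A)
    have hd : Fintype.card {e : E // e ∉ C} = d := by
      rw [← Fintype.card_congr s, Fintype.card_fin]
    rw [Fintype.card_subtype_compl, Fintype.card_coe] at hd
    have hle : C.card ≤ Fintype.card E := Finset.card_le_univ C
    rw [Matrix.rank, ← Matrix.toLin'_apply'] at hC
    rw [Module.finrank_fintype_fun_eq_card] at hr
    omega
  refine ⟨h1, ?_⟩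
  let F : LinearMap.ker (Matrix.toLin' A) →ₗ[ℝ] (Fin d → ℝ) :=
    (LinearMap.funLeft ℝ ℝ (fun i => (s i).1)).comp (Submodule.subtype _)
  -- A kernel vector that vanishes outside `C` is killed by the invertible principal block.
  -- Surjectivity then follows from equality of dimensions.
  have hinj : Function.Injective F := by
    rw [← LinearMap.ker_eq_bot, LinearMap.ker_eq_bot']
    rintro ⟨w, hw⟩ h0
    have hz : ∀ e ∉ C, w e = 0 := by
      intro e he
      have := congrFun h0 (s.symm ⟨e, he⟩)
      simpa [F, LinearMap.funLeft_apply] using this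
    have hw' : A *ᵥ w = 0 := by simpa using hw
    have h2 : (A.submatrix (fun i : C => i.1) (fun i : C => i.1)) *ᵥ (fun i : C => w i.1) = 0 := by
      ext i
      have := congrFun hw' i.1
      simp only [Matrix.mulVec, dotProduct, Pi.zero_apply] at this
      simp only [Matrix.mulVec, dotProduct, Pi.zero_apply, Matrix.submatrix_apply]
      rw [← this, ← Finset.sum_subset (Finset.subset_univ C) (fun e _ he => by simp [hz e he])]
      exact Finset.sum_coe_sort C (fun e => A i e * w e)
    have h3 := Matrix.eq_zero_of_mulVec_eq_zero hdet h2
    ext e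
    by_cases he : e ∈ C
    · exact congrFun h3 ⟨e, he⟩
    · exact hz e he
  have hsurj : Function.Surjective F := by
    rw [← LinearMap.injective_iff_surjective_of_finrank_eq_finrank]
    · exact hinj
    · rw [← h1]; simp
  choose g hg using fun i : Fin d => hsurj (Pi.single i 1)
  refine ⟨fun i => (g i).1, fun i => (g i).2, fun i j => ?_⟩
  have := congrFun (hg i) j
  simp only [F, LinearMap.comp_apply, LinearMap.funLeft_apply, Submodule.subtype_apply] at this
  change (g i).1 (s j).1 = _
  rw [this, Pi.single_apply]
  simp only [eq_comm]

end LinearAlgebra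

noncomputable section

/-! ### Variation of the dihedral angles of a tetrahedron -/

/-- Minus the derivative of `X / √(Y Z)` times `√(Y Z)`, where `X`, `Y`, `Z` are the entries of
the Gram matrix of two vectors. -/
def gramRate (X Y Z X' Y' Z' : ℝ) : ℝ := -(X' - X * (Y' / Y + Z' / Z) / 2)

theorem hasDerivAt_arccos_gram {X Y Z : ℝ → ℝ} {X' Y' Z' t : ℝ} (hX : HasDerivAt X X' t)
    (hY : HasDerivAt Y Y' t) (hZ : HasDerivAt Z Z' t) (hY0 : 0 < Y t) (hZ0 : 0 < Z t)
    (h : 0 < Y t * Z t - X t ^ 2) :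
    HasDerivAt (fun s => arccos (X s / (√(Y s) * √(Z s))))
      (gramRate (X t) (Y t) (Z t) X' Y' Z' / √(Y t * Z t - X t ^ 2)) t := by
  have hYs := Real.sqrt_pos.2 hY0
  have hZs := Real.sqrt_pos.2 hZ0
  have hYq := Real.sq_sqrt hY0.le
  have hZq := Real.sq_sqrt hZ0.le
  have hlt : (X t / (√(Y t) * √(Z t))) ^ 2 < 1 := by
    rw [div_pow, mul_pow, hYq, hZq, div_lt_one (by positivity)]
    linarith
  have habs := abs_lt.1 ((sq_lt_one_iff_abs_lt_one _).1 hlt)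
  have hd := (Real.hasDerivAt_arccos habs.1.ne' habs.2.ne).comp t
    (hX.div ((hY.sqrt hY0.ne').mul (hZ.sqrt hZ0.ne')) (mul_pos hYs hZs).ne')
  refine hd.congr_deriv ?_
  have hs : √(1 - (X t / (√(Y t) * √(Z t))) ^ 2) =
      √(Y t * Z t - X t ^ 2) / (√(Y t) * √(Z t)) := by
    rw [div_pow, mul_pow, hYq, hZq, ← Real.sqrt_mul hY0.le, ← Real.sqrt_div' _ (by positivity)]
    congr 1
    field_simp
  have hR := Real.sqrt_pos.2 h
  simp only [Pi.mul_apply]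
  rw [hs, gramRate]
  generalize √(Y t * Z t - X t ^ 2) = R at *
  generalize √(Y t) = y at *
  generalize √(Z t) = z at *
  rw [← hYq, ← hZq]
  field_simp

/-- The rate of change of the dihedral angle at `ab` of a tetrahedron `abcd`, up to the factor
`|ab| |6 V|`, in terms of the Gram matrix of the edges `ab`, `ac`, `ad` and the halved rates of
change of the squared edge lengths. -/
def angleRate (guu gcc gdd guc gud gcd mab mac mad mbc mbd mcd : ℝ) : ℝ :=
  gramRate (guu * gcd - guc * gud) (guu * gcc - guc ^ 2) (guu * gdd - gud ^ 2)
    (2 * mab * gcd + guu * (mac + mad - mcd) - (mab + mac - mbc) * gud - guc * (mab + mad - mbd))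
    (2 * mab * gcc + guu * (2 * mac) - 2 * guc * (mab + mac - mbc))
    (2 * mab * gdd + guu * (2 * mad) - 2 * gud * (mab + mad - mbd))

theorem hasDerivAt_dihedral {ab ac ad bc bd cd : ℝ → ℝ} {ab' ac' ad' bc' bd' cd' t : ℝ}
    (hab : HasDerivAt ab ab' t) (hac : HasDerivAt ac ac' t) (had : HasDerivAt ad ad' t)
    (hbc : HasDerivAt bc bc' t) (hbd : HasDerivAt bd bd' t) (hcd : HasDerivAt cd cd' t)
    {guu gcc gdd guc gud gcd : ℝ} (huu : guu = ab t ^ 2) (hcc : gcc = ac t ^ 2)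
    (hdd : gdd = ad t ^ 2) (huc : guc = innerOfLengths (ab t) (ac t) (bc t))
    (hud : gud = innerOfLengths (ab t) (ad t) (bd t))
    (hgcd : gcd = innerOfLengths (ac t) (ad t) (cd t))
    (hY : 0 < guu * gcc - guc ^ 2) (hZ : 0 < guu * gdd - gud ^ 2)
    (h : 0 < (guu * gcc - guc ^ 2) * (guu * gdd - gud ^ 2) - (guu * gcd - guc * gud) ^ 2) :
    HasDerivAt (fun s => dihedral (ab s) (ac s) (ad s) (bc s) (bd s) (cd s))
      (angleRate guu gcc gdd guc gud gcd (ab t * ab') (ac t * ac') (ad t * ad') (bc t * bc')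
        (bd t * bd') (cd t * cd') /
        √((guu * gcc - guc ^ 2) * (guu * gdd - gud ^ 2) - (guu * gcd - guc * gud) ^ 2)) t := by
  have hin : ∀ {p q r : ℝ → ℝ} {p' q' r' : ℝ}, HasDerivAt p p' t → HasDerivAt q q' t →
      HasDerivAt r r' t → HasDerivAt (fun s => innerOfLengths (p s) (q s) (r s))
        (p t * p' + q t * q' - r t * r') t := by
    intro p q r p' q' r' hp hq hr
    refine ((((hp.pow 2).add (hq.pow 2)).sub (hr.pow 2)).div_const 2).congr_deriv ?_
    simp; ring
  have hG := hin hab hac hbc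
  have hH := hin hab had hbd
  have hK := hin hac had hcd
  have hsq : ∀ {p : ℝ → ℝ} {p' : ℝ}, HasDerivAt p p' t →
      HasDerivAt (fun s => p s ^ 2) (2 * (p t * p')) t := by
    intro p p' hp
    refine (hp.pow 2).congr_deriv ?_
    simp; ring
  subst huu hcc hdd huc hud hgcd
  have hd := hasDerivAt_arccos_gram
    (((hsq hab).mul hK).sub (hG.mul hH))
    (((hsq hab).mul (hsq hac)).sub (hsq hG)) (((hsq hab).mul (hsq had)).sub (hsq hH))
    hY hZ h
  refine hd.congr_deriv ?_
  simp only [angleRate, Pi.sub_apply, Pi.mul_apply]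
  congr 2 <;> ring

/-! ### Coordinates -/

theorem inner_E3 (p q : E3) : inner ℝ p q = p 0 * q 0 + p 1 * q 1 + p 2 * q 2 := by
  simp [PiLp.inner_apply, Fin.sum_univ_three, mul_comm]

/-- The Gram matrix entries of the edges which issue from `a`. -/
def gram (a b c : E3) : ℝ := inner ℝ (b - a) (c - a)

theorem gram_eq (a b c : E3) : gram a b c = (b 0 - a 0) * (c 0 - a 0) + (b 1 - a 1) * (c 1 - a 1)
    + (b 2 - a 2) * (c 2 - a 2) := by
  simp [gram, inner_E3]

theorem signedSixVol_eq (a b c d : E3) : signedSixVol ![a, b, c, d] =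
    (b 0 - a 0) * ((c 1 - a 1) * (d 2 - a 2) - (c 2 - a 2) * (d 1 - a 1))
    - (b 1 - a 1) * ((c 0 - a 0) * (d 2 - a 2) - (c 2 - a 2) * (d 0 - a 0))
    + (b 2 - a 2) * ((c 0 - a 0) * (d 1 - a 1) - (c 1 - a 1) * (d 0 - a 0)) := by
  simp [signedSixVol, Matrix.det_fin_three, Fin.succ]
  ring

/-- The squared doubled area of a triangle. -/
def areaSq (a b c : E3) : ℝ := gram a b b * gram a c c - gram a b c ^ 2

theorem areaSq_eq (a b c : E3) : areaSq a b c =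
    ((b 1 - a 1) * (c 2 - a 2) - (b 2 - a 2) * (c 1 - a 1)) ^ 2 +
    ((b 0 - a 0) * (c 2 - a 2) - (b 2 - a 2) * (c 0 - a 0)) ^ 2 +
    ((b 0 - a 0) * (c 1 - a 1) - (b 1 - a 1) * (c 0 - a 0)) ^ 2 := by
  simp only [areaSq, gram_eq]; ring

theorem areaSq_nonneg (a b c : E3) : 0 ≤ areaSq a b c := by
  rw [areaSq_eq]; positivity

theorem gram_det (a b c d : E3) :
    gram a b b * gram a c c * gram a d d + 2 * gram a b c * gram a b d * gram a c d
      - gram a b b * gram a c d ^ 2 - gram a c c * gram a b d ^ 2 - gram a d d * gram a b c ^ 2 =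
      signedSixVol ![a, b, c, d] ^ 2 := by
  simp only [gram_eq, signedSixVol_eq]
  generalize b 0 - a 0 = u0
  generalize b 1 - a 1 = u1
  generalize b 2 - a 2 = u2
  generalize c 0 - a 0 = v0
  generalize c 1 - a 1 = v1
  generalize c 2 - a 2 = v2
  generalize d 0 - a 0 = w0
  generalize d 1 - a 1 = w1
  generalize d 2 - a 2 = w2
  ring

/-- The Gram determinant identity for two faces of a tetrahedron. -/
theorem gram_faces (a b c d : E3) :
    areaSq a b c * areaSq a b d - (gram a b b * gram a c d - gram a b c * gram a b d) ^ 2 =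
      gram a b b * signedSixVol ![a, b, c, d] ^ 2 := by
  rw [← gram_det, areaSq, areaSq]; ring

theorem areaSq_pos {a b c d : E3} (h : signedSixVol ![a, b, c, d] ≠ 0) : 0 < areaSq a b c := by
  refine lt_of_le_of_ne (areaSq_nonneg a b c) fun h0 => h ?_
  rw [areaSq_eq] at h0
  obtain ⟨h12, h3⟩ := (add_eq_zero_iff_of_nonneg (by positivity) (by positivity)).1 h0.symm
  obtain ⟨h1, h2⟩ := (add_eq_zero_iff_of_nonneg (by positivity) (by positivity)).1 h12
  rw [sq_eq_zero_iff] at h1 h2 h3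
  rw [signedSixVol_eq]
  linear_combination (d 0 - a 0) * h1 - (d 1 - a 1) * h2 + (d 2 - a 2) * h3

theorem signedSixVol_swap01 (a b c d : E3) :
    signedSixVol ![b, a, c, d] = -signedSixVol ![a, b, c, d] := by
  simp only [signedSixVol_eq]; ring

theorem signedSixVol_swap12 (a b c d : E3) :
    signedSixVol ![a, c, b, d] = -signedSixVol ![a, b, c, d] := by
  simp only [signedSixVol_eq]; ring

theorem signedSixVol_swap23 (a b c d : E3) :
    signedSixVol ![a, b, d, c] = -signedSixVol ![a, b, c, d] := by
  simp only [signedSixVol_eq]; ring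

theorem gram_self_eq_dist (a b : E3) : gram a b b = dist a b ^ 2 := by
  rw [gram, real_inner_self_eq_norm_sq, dist_comm, dist_eq_norm]

theorem gram_eq_innerOfLengths (a b c : E3) :
    gram a b c = innerOfLengths (dist a b) (dist a c) (dist b c) := by
  rw [innerOfLengths, ← gram_self_eq_dist, ← gram_self_eq_dist, ← gram_self_eq_dist]
  simp only [gram_eq]; ring

theorem gram_self_pos {a b c d : E3} (h : signedSixVol ![a, b, c, d] ≠ 0) :
    0 < gram a b b := by
  rw [gram_self_eq_dist]
  have : a ≠ b := by
    rintro rfl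
    apply h; simp [signedSixVol_eq]
  have := dist_pos.2 this
  positivity

/-- The rate of change of the angle at `ab` in terms of positions. -/
def posRate (a b c d : E3) (mab mac mad mbc mbd mcd : ℝ) : ℝ :=
  angleRate (gram a b b) (gram a c c) (gram a d d) (gram a b c) (gram a b d) (gram a c d)
    mab mac mad mbc mbd mcd

/-- The rate of rotation of the half-plane `abc` around `ab`, up to the factor `|ab|`, when the
points move with the velocities `a'`, `b'`, `c'`. -/
def spin (a b c a' b' c' : E3) : ℝ :=
  let u := b - a
  let v := c - a
  let u' := b' - a'
  let v' := c' - a'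
  let N : Fin 3 → ℝ := ![u 1 * v 2 - u 2 * v 1, u 2 * v 0 - u 0 * v 2, u 0 * v 1 - u 1 * v 0]
  let N' : Fin 3 → ℝ := ![u' 1 * v 2 - u' 2 * v 1 + (u 1 * v' 2 - u 2 * v' 1),
    u' 2 * v 0 - u' 0 * v 2 + (u 2 * v' 0 - u 0 * v' 2),
    u' 0 * v 1 - u' 1 * v 0 + (u 0 * v' 1 - u 1 * v' 0)]
  (N' 0 * (u 1 * N 2 - u 2 * N 1) + N' 1 * (u 2 * N 0 - u 0 * N 2)
    + N' 2 * (u 0 * N 1 - u 1 * N 0)) / areaSq a b c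

/-- The halved rate of change of the squared distance of two moving points. -/
def stretch (a b a' b' : E3) : ℝ := inner ℝ (a - b) (a' - b')

theorem stretch_eq (a b a' b' : E3) : stretch a b a' b' =
    (a 0 - b 0) * (a' 0 - b' 0) + (a 1 - b 1) * (a' 1 - b' 1) + (a 2 - b 2) * (a' 2 - b' 2) := by
  simp [stretch, inner_E3]

/-- Here `X`, `Y`, `Z` are the inner products N·M, N·N, M·M of the face normals N = u × v and M = u
× w, and `δ` is the signed volume. Since N × M = δu, one has δ(u × N) = YM - XN and δ(u × M) = XM -
ZN; pairing these with N' and M' gives `h1` and `h2`. -/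
theorem gramRate_of_faces {X Y Z δ Pc Pd Sc Sd Y' Z' : ℝ} (hY : Y ≠ 0) (hZ : Z ≠ 0)
    (h1 : δ * Sc = Y * Pc - X * Y') (h2 : δ * Sd = X * Z' - Z * Pd) :
    gramRate X Y Z (Pc + Pd) (2 * Y') (2 * Z') = δ * (Sd / Z - Sc / Y) := by
  rw [gramRate, mul_sub, ← mul_div_assoc, ← mul_div_assoc, h1, h2]
  field_simp
  ring

/-- The angle at `ab` is the angle between two half-planes, so it changes by the difference of their
rotations about `ab`. This holds for any velocities and is what makes contributions of adjacent
tetrahedra telescope. -/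
theorem posRate_stretch (a b c d a' b' c' d' : E3) (h : signedSixVol ![a, b, c, d] ≠ 0) :
    posRate a b c d (stretch a b a' b') (stretch a c a' c') (stretch a d a' d')
      (stretch b c b' c') (stretch b d b' d') (stretch c d c' d') =
    signedSixVol ![a, b, c, d] * (spin a b d a' b' d' - spin a b c a' b' c') := by
  have hY := (areaSq_pos h).ne'
  have hZ : areaSq a b d ≠ 0 := by
    have : signedSixVol ![a, b, d, c] ≠ 0 := by rw [signedSixVol_swap23]; exact neg_ne_zero.2 h
    exact (areaSq_pos this).ne'
  have e1 := areaSq_eq a b c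
  have e2 := areaSq_eq a b d
  rw [posRate, angleRate, spin, spin]
  change gramRate _ (areaSq a b c) (areaSq a b d) _ _ _ = _
  have key := @gramRate_of_faces (gram a b b * gram a c d - gram a b c * gram a b d)
    (areaSq a b c) (areaSq a b d) (signedSixVol ![a, b, c, d])
  simp only [stretch_eq, gram_eq, signedSixVol_eq, PiLp.sub_apply, Matrix.cons_val] at key ⊢
  generalize areaSq a b c = Y at *
  generalize areaSq a b d = Z at *
  obtain ⟨u0, hu0⟩ : ∃ u, u = b 0 - a 0 := ⟨_, rfl⟩
  obtain ⟨u1, hu1⟩ : ∃ u, u = b 1 - a 1 := ⟨_, rfl⟩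
  obtain ⟨u2, hu2⟩ : ∃ u, u = b 2 - a 2 := ⟨_, rfl⟩
  obtain ⟨v0, hv0⟩ : ∃ u, u = c 0 - a 0 := ⟨_, rfl⟩
  obtain ⟨v1, hv1⟩ : ∃ u, u = c 1 - a 1 := ⟨_, rfl⟩
  obtain ⟨v2, hv2⟩ : ∃ u, u = c 2 - a 2 := ⟨_, rfl⟩
  obtain ⟨w0, hw0⟩ : ∃ u, u = d 0 - a 0 := ⟨_, rfl⟩
  obtain ⟨w1, hw1⟩ : ∃ u, u = d 1 - a 1 := ⟨_, rfl⟩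
  obtain ⟨w2, hw2⟩ : ∃ u, u = d 2 - a 2 := ⟨_, rfl⟩
  obtain ⟨p0, hp0⟩ : ∃ u, u = b' 0 - a' 0 := ⟨_, rfl⟩
  obtain ⟨p1, hp1⟩ : ∃ u, u = b' 1 - a' 1 := ⟨_, rfl⟩
  obtain ⟨p2, hp2⟩ : ∃ u, u = b' 2 - a' 2 := ⟨_, rfl⟩
  obtain ⟨q0, hq0⟩ : ∃ u, u = c' 0 - a' 0 := ⟨_, rfl⟩
  obtain ⟨q1, hq1⟩ : ∃ u, u = c' 1 - a' 1 := ⟨_, rfl⟩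
  obtain ⟨q2, hq2⟩ : ∃ u, u = c' 2 - a' 2 := ⟨_, rfl⟩
  obtain ⟨r0, hr0⟩ : ∃ u, u = d' 0 - a' 0 := ⟨_, rfl⟩
  obtain ⟨r1, hr1⟩ : ∃ u, u = d' 1 - a' 1 := ⟨_, rfl⟩
  obtain ⟨r2, hr2⟩ : ∃ u, u = d' 2 - a' 2 := ⟨_, rfl⟩
  have hb : ∀ {x y z : ℝ}, z = x - y → x = y + z := fun h => by rw [h]; ring
  simp only [← hu0, ← hu1, ← hu2, ← hv0, ← hv1, ← hv2, ← hw0, ← hw1, ← hw2, ← hp0, ← hp1, ← hp2,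
    ← hq0, ← hq1, ← hq2, ← hr0, ← hr1, ← hr2] at e1 e2 key ⊢
  -- Every point and velocity becomes that of `a` plus a difference, so that the edges `bc`, `bd`,
  -- `cd` are also expressed by the vectors issuing from `a`.
  rw [hb hu0, hb hu1, hb hu2, hb hv0, hb hv1, hb hv2, hb hw0, hb hw1, hb hw2, hb hp0, hb hp1,
    hb hp2, hb hq0, hb hq1, hb hq2, hb hr0, hb hr1, hb hr2]
  -- The four quantities are N'·N, N'·M, M'·M and M'·N for the two face normals N, M and their
  -- derivatives.
  rw [← key (Y' := (p1 * v2 - p2 * v1 + (u1 * q2 - u2 * q1)) * (u1 * v2 - u2 * v1)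
      + (p2 * v0 - p0 * v2 + (u2 * q0 - u0 * q2)) * (u2 * v0 - u0 * v2)
      + (p0 * v1 - p1 * v0 + (u0 * q1 - u1 * q0)) * (u0 * v1 - u1 * v0))
    (Pc := (p1 * v2 - p2 * v1 + (u1 * q2 - u2 * q1)) * (u1 * w2 - u2 * w1)
      + (p2 * v0 - p0 * v2 + (u2 * q0 - u0 * q2)) * (u2 * w0 - u0 * w2)
      + (p0 * v1 - p1 * v0 + (u0 * q1 - u1 * q0)) * (u0 * w1 - u1 * w0))
    (Z' := (p1 * w2 - p2 * w1 + (u1 * r2 - u2 * r1)) * (u1 * w2 - u2 * w1)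
      + (p2 * w0 - p0 * w2 + (u2 * r0 - u0 * r2)) * (u2 * w0 - u0 * w2)
      + (p0 * w1 - p1 * w0 + (u0 * r1 - u1 * r0)) * (u0 * w1 - u1 * w0))
    (Pd := (p1 * w2 - p2 * w1 + (u1 * r2 - u2 * r1)) * (u1 * v2 - u2 * v1)
      + (p2 * w0 - p0 * w2 + (u2 * r0 - u0 * r2)) * (u2 * v0 - u0 * v2)
      + (p0 * w1 - p1 * w0 + (u0 * r1 - u1 * r0)) * (u0 * v1 - u1 * v0)) hY hZ
    (by rw [e1]; ring) (by rw [e2]; ring)]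
  congr 1 <;> ring

end

/-! ### Explicit coefficients of the angle variation -/

noncomputable section

/-- The coefficient in the variation of the angle at `ab` of the tetrahedron `abcd` which belongs
to the adjacent edge `ac`. -/
def adjCoeff (a b c d : E3) : ℝ :=
  -(gram a b b * gram a c c - gram a b c ^ 2 - gram a b d * gram a c c - gram a b b * gram a c d
    + gram a c d * gram a b c + gram a b c * gram a b d) / areaSq a b c

/-- The coefficient in the variation of the angle at `ab` of the tetrahedron `abcd` which belongs
to `ab` itself. -/
def selfCoeff (a b c d : E3) : ℝ :=
  -(2 * gram a c d - gram a b d - gram a b c - (gram a b b * gram a c d - gram a b c * gram a b d)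
    * ((gram a c c - gram a b c) / areaSq a b c + (gram a d d - gram a b d) / areaSq a b d))
    / gram a b b

theorem gram_comm (a b c : E3) : gram a b c = gram a c b := real_inner_comm _ _

theorem areaSq_swap12 (a b c : E3) : areaSq a c b = areaSq a b c := by
  rw [areaSq, areaSq, gram_comm a c b]; ring

theorem gram_base (a b c d : E3) : gram b c d = gram a c d - gram a b c - gram a b d
    + gram a b b := by
  simp only [gram_eq]; ring

theorem gram_self_right (a b : E3) : gram a b a = 0 := by
  simp [gram]

theorem gram_base_self (a b c : E3) : gram b a c = gram a b b - gram a b c := by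
  simp only [gram_eq]; ring

theorem areaSq_swap01 (a b c : E3) : areaSq b a c = areaSq a b c := by
  simp only [areaSq_eq]; ring

theorem adjCoeff_swap12 (a b c d : E3) : adjCoeff a c b d = adjCoeff a b c d := by
  rw [adjCoeff, adjCoeff, areaSq_swap12, gram_comm a c b]; ring

/-- Once `gram a b b` is extracted, the opposite edge has coefficient 1, and by `adjCoeff_swap12`
the influence of `ac` on the angle at `ab` has the same coefficient as that of `ab` on the angle at
`ac`. This reciprocity is the source of the symmetry of A. -/
theorem posRate_eq {a b c d : E3} (h : signedSixVol ![a, b, c, d] ≠ 0)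
    (mab mac mad mbc mbd mcd : ℝ) :
    posRate a b c d mab mac mad mbc mbd mcd = gram a b b * (mcd + adjCoeff a b c d * mac
      + adjCoeff a b d c * mad + adjCoeff b a c d * mbc + adjCoeff b a d c * mbd
      + selfCoeff a b c d * mab) := by
  have hu := (gram_self_pos h).ne'
  have hY := (areaSq_pos h).ne'
  have hZ : areaSq a b d ≠ 0 := by
    have : signedSixVol ![a, b, d, c] ≠ 0 := by rw [signedSixVol_swap23]; exact neg_ne_zero.2 h
    exact (areaSq_pos this).ne'
  simp only [posRate, angleRate, gramRate, adjCoeff, selfCoeff, areaSq_swap01 a b,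
    gram_base_self a b, gram_base a b, gram_comm a d c, gram_self_right,
    sub_zero]
  change -(_ - _ * (_ / areaSq a b c + _ / areaSq a b d) / 2) = _
  have e1 : areaSq a b c = gram a b b * gram a c c - gram a b c ^ 2 := rfl
  have e2 : areaSq a b d = gram a b b * gram a d d - gram a b d ^ 2 := rfl
  generalize areaSq a b c = Y at *
  generalize areaSq a b d = Z at *
  generalize gram a b b = guu at *
  generalize gram a c c = gcc at *
  generalize gram a d d = gdd at *
  generalize gram a b c = guc at *
  generalize gram a b d = gud at *
  generalize gram a c d = gcd at *
  field_simp
  rw [e1, e2]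
  ring

/-! ### Velocities of points -/

/-- Cramer's rule: the solution is (t₁ q × r + t₂ r × p + t₃ p × q) / D. -/
theorem exists_inner_eq {p q r : E3} (h : p 0 * (q 1 * r 2 - q 2 * r 1)
    - p 1 * (q 0 * r 2 - q 2 * r 0) + p 2 * (q 0 * r 1 - q 1 * r 0) ≠ 0) (t₁ t₂ t₃ : ℝ) :
    ∃ z : E3, inner ℝ p z = t₁ ∧ inner ℝ q z = t₂ ∧ inner ℝ r z = t₃ := by
  set D := p 0 * (q 1 * r 2 - q 2 * r 1)
    - p 1 * (q 0 * r 2 - q 2 * r 0) + p 2 * (q 0 * r 1 - q 1 * r 0) with hD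
  refine ⟨!₂[(t₁ * (q 1 * r 2 - q 2 * r 1) + t₂ * (r 1 * p 2 - r 2 * p 1)
      + t₃ * (p 1 * q 2 - p 2 * q 1)) / D,
    (t₁ * (q 2 * r 0 - q 0 * r 2) + t₂ * (r 2 * p 0 - r 0 * p 2)
      + t₃ * (p 2 * q 0 - p 0 * q 2)) / D,
    (t₁ * (q 0 * r 1 - q 1 * r 0) + t₂ * (r 0 * p 1 - r 1 * p 0)
      + t₃ * (p 0 * q 1 - p 1 * q 0)) / D], ?_, ?_, ?_⟩ <;>
  · simp only [inner_E3, Matrix.cons_val]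
    field_simp
    rw [hD]
    ring

/-- Velocities of three vertices of a nondegenerate tetrahedron extend to the fourth one with
given rates of change of the edge lengths. -/
theorem exists_velocity_fourth {a b c d : E3} (h : signedSixVol ![a, b, c, d] ≠ 0)
    (a' b' c' : E3) (mad mbd mcd : ℝ) :
    ∃ d' : E3, stretch a d a' d' = mad ∧ stretch b d b' d' = mbd ∧ stretch c d c' d' = mcd := by
  obtain ⟨z, h1, h2, h3⟩ := exists_inner_eq (p := a - d) (q := b - d) (r := c - d)
    (by
      rw [signedSixVol_eq] at h
      contrapose! h
      simp only [PiLp.sub_apply] at h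
      linear_combination -h)
    (inner ℝ (a - d) a' - mad) (inner ℝ (b - d) b' - mbd) (inner ℝ (c - d) c' - mcd)
  refine ⟨z, ?_, ?_, ?_⟩ <;> rw [stretch, inner_sub_right] <;> linarith

/-- With `a` at rest, the other vertices get their velocities one by one, subject to one, two and
three independent linear conditions. -/
theorem exists_velocities {a b c d : E3} (h : signedSixVol ![a, b, c, d] ≠ 0)
    (mab mac mad mbc mbd mcd : ℝ) :
    ∃ a' b' c' d' : E3, stretch a b a' b' = mab ∧ stretch a c a' c' = mac ∧
      stretch a d a' d' = mad ∧ stretch b c b' c' = mbc ∧ stretch b d b' d' = mbd ∧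
      stretch c d c' d' = mcd := by
  -- The third vector `s - p` only completes two edges to a basis. Surplus conditions in the uses of
  -- `exists_inner_eq` below are given the arbitrary value 0.
  have hdet : ∀ {p q r s : E3}, signedSixVol ![p, q, r, s] ≠ 0 →
      (p - r) 0 * ((q - r) 1 * (s - p) 2 - (q - r) 2 * (s - p) 1)
      - (p - r) 1 * ((q - r) 0 * (s - p) 2 - (q - r) 2 * (s - p) 0)
      + (p - r) 2 * ((q - r) 0 * (s - p) 1 - (q - r) 1 * (s - p) 0) ≠ 0 := by
    intro p q r s h
    rw [signedSixVol_eq] at h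
    contrapose! h
    simp only [PiLp.sub_apply] at h
    linear_combination h
  have hb : ∃ b' : E3, stretch a b 0 b' = mab := by
    have h' : signedSixVol ![a, d, b, c] ≠ 0 := by
      rw [signedSixVol_swap12, signedSixVol_swap23, neg_neg]
      exact h
    obtain ⟨z, h1, -, -⟩ := exists_inner_eq (hdet h') (-mab) 0 0
    exact ⟨z, by rw [stretch, inner_sub_right, h1]; simp⟩
  obtain ⟨b', hb⟩ := hb
  obtain ⟨c', h1, h2, -⟩ := exists_inner_eq (hdet h) (-mac) (inner ℝ (b - c) b' - mbc) 0
  obtain ⟨d', h3, h4, h5⟩ := exists_velocity_fourth h 0 b' c' mad mbd mcd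
  refine ⟨0, b', c', d', hb, ?_, h3, ?_, h4, h5⟩
  · rw [stretch, inner_sub_right, h1]; simp
  · rw [stretch, inner_sub_right, h2]; ring

/-- The velocity of the point `p` under the infinitesimal rigid motion with the rotation vector
`g.1` and the translation `g.2`. -/
def rigid (p : E3) : (E3 × E3) →ₗ[ℝ] E3 where
  toFun g := !₂[g.1 1 * p 2 - g.1 2 * p 1 + g.2 0, g.1 2 * p 0 - g.1 0 * p 2 + g.2 1,
    g.1 0 * p 1 - g.1 1 * p 0 + g.2 2]
  map_add' g h := by
    ext i; fin_cases i <;> simp <;> ring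
  map_smul' r g := by
    ext i; fin_cases i <;> simp <;> ring

theorem rigid_zero (p : E3) (g : E3 × E3) : rigid p g 0 = g.1 1 * p 2 - g.1 2 * p 1 + g.2 0 := rfl
theorem rigid_one (p : E3) (g : E3 × E3) : rigid p g 1 = g.1 2 * p 0 - g.1 0 * p 2 + g.2 1 := rfl
theorem rigid_two (p : E3) (g : E3 × E3) : rigid p g 2 = g.1 0 * p 1 - g.1 1 * p 0 + g.2 2 := rfl

theorem stretch_rigid (a b : E3) (g : E3 × E3) : stretch a b (rigid a g) (rigid b g) = 0 := by
  simp only [stretch_eq, rigid_zero, rigid_one, rigid_two]; ring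

/-- A rigid motion turns all half-planes at `ab` alike, by the component of the rotation vector
along `ab`. Hence spin detects the rotation about an edge in a jump of velocities. -/
theorem spin_rigid {a b c : E3} (h : areaSq a b c ≠ 0) (g : E3 × E3) :
    spin a b c (rigid a g) (rigid b g) (rigid c g) = inner ℝ g.1 (b - a) := by
  rw [spin, div_eq_iff h]
  simp only [areaSq_eq, rigid_zero, rigid_one, rigid_two, inner_E3, PiLp.sub_apply,
    Matrix.cons_val]
  generalize g.1 0 = x
  generalize g.1 1 = y
  generalize g.1 2 = z
  ring

theorem stretch_sub (a b a' b' a'' b'' : E3) :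
    stretch a b (a' - a'') (b' - b'') = stretch a b a' b' - stretch a b a'' b'' := by
  simp only [stretch, inner_sub_right]; ring

/-- An infinitesimal motion of a nondegenerate triangle which preserves the lengths is rigid. -/
theorem exists_rigid {a b c a' b' c' : E3} (h : areaSq a b c ≠ 0) (hab : stretch a b a' b' = 0)
    (hac : stretch a c a' c' = 0) (hbc : stretch b c b' c' = 0) :
    ∃ g : E3 × E3, rigid a g = a' ∧ rigid b g = b' ∧ rigid c g = c' := by
  have hA := areaSq_eq a b c
  simp only [stretch_eq] at hab hac hbc
  obtain ⟨u0, hu0⟩ : ∃ u, u = b 0 - a 0 := ⟨_, rfl⟩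
  obtain ⟨u1, hu1⟩ : ∃ u, u = b 1 - a 1 := ⟨_, rfl⟩
  obtain ⟨u2, hu2⟩ : ∃ u, u = b 2 - a 2 := ⟨_, rfl⟩
  obtain ⟨v0, hv0⟩ : ∃ u, u = c 0 - a 0 := ⟨_, rfl⟩
  obtain ⟨v1, hv1⟩ : ∃ u, u = c 1 - a 1 := ⟨_, rfl⟩
  obtain ⟨v2, hv2⟩ : ∃ u, u = c 2 - a 2 := ⟨_, rfl⟩
  obtain ⟨p0, hp0⟩ : ∃ u, u = b' 0 - a' 0 := ⟨_, rfl⟩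
  obtain ⟨p1, hp1⟩ : ∃ u, u = b' 1 - a' 1 := ⟨_, rfl⟩
  obtain ⟨p2, hp2⟩ : ∃ u, u = b' 2 - a' 2 := ⟨_, rfl⟩
  obtain ⟨q0, hq0⟩ : ∃ u, u = c' 0 - a' 0 := ⟨_, rfl⟩
  obtain ⟨q1, hq1⟩ : ∃ u, u = c' 1 - a' 1 := ⟨_, rfl⟩
  obtain ⟨q2, hq2⟩ : ∃ u, u = c' 2 - a' 2 := ⟨_, rfl⟩
  simp only [← hu0, ← hu1, ← hu2, ← hv0, ← hv1, ← hv2] at hA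
  have k1 : u0 * p0 + u1 * p1 + u2 * p2 = 0 := by
    rw [hu0, hu1, hu2, hp0, hp1, hp2]; linear_combination hab
  have k2 : v0 * q0 + v1 * q1 + v2 * q2 = 0 := by
    rw [hv0, hv1, hv2, hq0, hq1, hq2]; linear_combination hac
  have k3 : u0 * q0 + u1 * q1 + u2 * q2 + (v0 * p0 + v1 * p1 + v2 * p2) = 0 := by
    rw [hu0, hu1, hu2, hp0, hp1, hp2, hv0, hv1, hv2, hq0, hq1, hq2]
    linear_combination hab + hac - hbc
  generalize areaSq a b c = Y at *
  obtain ⟨n0, hn0⟩ : ∃ n, n = u1 * v2 - u2 * v1 := ⟨_, rfl⟩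
  obtain ⟨n1, hn1⟩ : ∃ n, n = u2 * v0 - u0 * v2 := ⟨_, rfl⟩
  obtain ⟨n2, hn2⟩ : ∃ n, n = u0 * v1 - u1 * v0 := ⟨_, rfl⟩
  -- The rotation vector ω, sought in the basis u, v, n = u × v, must satisfy ω × u = p and ω × v =
  -- q. Pairing these equations with n and the first one with v gives the coefficients α/Y, β/Y,
  -- γ/Y.
  obtain ⟨α, hα⟩ : ∃ α, α = (q0 * n0 + q1 * n1 + q2 * n2) := ⟨_, rfl⟩
  obtain ⟨β, hβ⟩ : ∃ β, β = -(p0 * n0 + p1 * n1 + p2 * n2) := ⟨_, rfl⟩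
  obtain ⟨γ, hγ⟩ : ∃ γ, γ = (p0 * v0 + p1 * v1 + p2 * v2) := ⟨_, rfl⟩
  have hY : Y = n0 ^ 2 + n1 ^ 2 + n2 ^ 2 := by rw [hA, hn0, hn1, hn2]; ring
  obtain ⟨x, hx⟩ : ∃ x, x = (α * u0 + β * v0 + γ * n0) / Y := ⟨_, rfl⟩
  obtain ⟨y, hy⟩ : ∃ x, x = (α * u1 + β * v1 + γ * n1) / Y := ⟨_, rfl⟩
  obtain ⟨z, hz⟩ : ∃ x, x = (α * u2 + β * v2 + γ * n2) / Y := ⟨_, rfl⟩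
  rw [eq_div_iff h] at hx hy hz
  have r1 : y * u2 - z * u1 = p0 := by
    apply mul_right_cancel₀ h
    have e : (α * u1 + β * v1 + γ * n1) * u2 - (α * u2 + β * v2 + γ * n2) * u1
        = p0 * Y := by
      rw [hY, hα, hβ, hγ, hn0, hn1, hn2]
      linear_combination ((u2 * v0 - u0 * v2) * v2 - (u0 * v1 - u1 * v0) * v1) * k1
    linear_combination e + u2 * hy - u1 * hz
  have r2 : z * u0 - x * u2 = p1 := by
    apply mul_right_cancel₀ h
    have e : (α * u2 + β * v2 + γ * n2) * u0 - (α * u0 + β * v0 + γ * n0) * u2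
        = p1 * Y := by
      rw [hY, hα, hβ, hγ, hn0, hn1, hn2]
      linear_combination ((u0 * v1 - u1 * v0) * v0 - (u1 * v2 - u2 * v1) * v2) * k1
    linear_combination e + u0 * hz - u2 * hx
  have r3 : x * u1 - y * u0 = p2 := by
    apply mul_right_cancel₀ h
    have e : (α * u0 + β * v0 + γ * n0) * u1 - (α * u1 + β * v1 + γ * n1) * u0
        = p2 * Y := by
      rw [hY, hα, hβ, hγ, hn0, hn1, hn2]
      linear_combination ((u1 * v2 - u2 * v1) * v1 - (u2 * v0 - u0 * v2) * v0) * k1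
    linear_combination e + u1 * hx - u0 * hy
  have t1 : y * v2 - z * v1 = q0 := by
    apply mul_right_cancel₀ h
    have e : (α * u1 + β * v1 + γ * n1) * v2 - (α * u2 + β * v2 + γ * n2) * v1
        = q0 * Y := by
      rw [hY, hα, hβ, hγ, hn0, hn1, hn2]
      linear_combination ((u2 * v0 - u0 * v2) * v2 - (u0 * v1 - u1 * v0) * v1) * k3 - ((u2 * v0 - u0 * v2) * u2 - (u0 * v1 - u1 * v0) * u1) * k2
    linear_combination e + v2 * hy - v1 * hz
  have t2 : z * v0 - x * v2 = q1 := by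
    apply mul_right_cancel₀ h
    have e : (α * u2 + β * v2 + γ * n2) * v0 - (α * u0 + β * v0 + γ * n0) * v2
        = q1 * Y := by
      rw [hY, hα, hβ, hγ, hn0, hn1, hn2]
      linear_combination ((u0 * v1 - u1 * v0) * v0 - (u1 * v2 - u2 * v1) * v2) * k3 - ((u0 * v1 - u1 * v0) * u0 - (u1 * v2 - u2 * v1) * u2) * k2
    linear_combination e + v0 * hz - v2 * hx
  have t3 : x * v1 - y * v0 = q2 := by
    apply mul_right_cancel₀ h
    have e : (α * u0 + β * v0 + γ * n0) * v1 - (α * u1 + β * v1 + γ * n1) * v0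
        = q2 * Y := by
      rw [hY, hα, hβ, hγ, hn0, hn1, hn2]
      linear_combination ((u1 * v2 - u2 * v1) * v1 - (u2 * v0 - u0 * v2) * v0) * k3 - ((u1 * v2 - u2 * v1) * u1 - (u2 * v0 - u0 * v2) * u0) * k2
    linear_combination e + v1 * hx - v0 * hy
  refine ⟨(!₂[x, y, z], !₂[a' 0 - (y * a 2 - z * a 1), a' 1 - (z * a 0 - x * a 2),
    a' 2 - (x * a 1 - y * a 0)]), ?_, ?_, ?_⟩
  · ext i; fin_cases i <;> simp [rigid]
  · ext i
    fin_cases i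
    · simp [rigid]; linear_combination r1 + hp0 - y * hu2 + z * hu1
    · simp [rigid]; linear_combination r2 + hp1 - z * hu0 + x * hu2
    · simp [rigid]; linear_combination r3 + hp2 - x * hu1 + y * hu0
  · ext i
    fin_cases i
    · simp [rigid]; linear_combination t1 + hq0 - y * hv2 + z * hv1
    · simp [rigid]; linear_combination t2 + hq1 - z * hv0 + x * hv2
    · simp [rigid]; linear_combination t3 + hq2 - x * hv1 + y * hv0

/-- A motion that fixes two points is a rotation about their line, so the component of its rotation
vector along this line determines it. -/
theorem eq_zero_of_rigid_eq_zero {a b : E3} (h : a ≠ b) {g : E3 × E3} (ha : rigid a g = 0)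
    (hb : rigid b g = 0) (hab : inner ℝ g.1 (b - a) = 0) : g = 0 := by
  have h0 := rigid_zero a g
  have h1 := rigid_one a g
  have h2 := rigid_two a g
  have k0 := rigid_zero b g
  have k1 := rigid_one b g
  have k2 := rigid_two b g
  rw [ha] at h0 h1 h2
  rw [hb] at k0 k1 k2
  simp only [PiLp.zero_apply] at h0 h1 h2 k0 k1 k2
  simp only [inner_E3, PiLp.sub_apply] at hab
  have hne : gram a b b ≠ 0 := by
    rw [gram_self_eq_dist]; exact pow_ne_zero _ (dist_ne_zero.2 h)
  have hg := gram_eq a b b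
  have e0 : g.1 0 = 0 := by
    apply mul_left_cancel₀ hne
    rw [hg]
    linear_combination (b 0 - a 0) * hab + (b 1 - a 1) * (h2 - k2) - (b 2 - a 2) * (h1 - k1)
  have e1 : g.1 1 = 0 := by
    apply mul_left_cancel₀ hne
    rw [hg]
    linear_combination (b 1 - a 1) * hab + (b 2 - a 2) * (h0 - k0) - (b 0 - a 0) * (h2 - k2)
  have e2 : g.1 2 = 0 := by
    apply mul_left_cancel₀ hne
    rw [hg]
    linear_combination (b 2 - a 2) * hab + (b 0 - a 0) * (h1 - k1) - (b 1 - a 1) * (h0 - k0)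
  simp only [e0, e1, e2] at h0 h1 h2
  refine Prod.ext ?_ ?_
  · ext i; fin_cases i <;> simp [e0, e1, e2]
  · ext i; fin_cases i <;> simp <;> linarith

end

/-! ### Nondegeneracy through volumes; sums over unordered pairs -/

noncomputable section

theorem affineIndependent_iff_signedSixVol_ne_zero (p : Fin 4 → E3) :
    AffineIndependent ℝ p ↔ signedSixVol p ≠ 0 := by
  rw [affineIndependent_iff_linearIndependent_vsub ℝ p 0,
    ← linearIndependent_equiv (finSuccAboveEquiv (0 : Fin 4)),
    ← LinearMap.linearIndependent_iff (WithLp.linearEquiv 2 ℝ (Fin 3 → ℝ)).toLinearMap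
      (LinearEquiv.ker _), signedSixVol, ← isUnit_iff_ne_zero, ← Matrix.isUnit_iff_isUnit_det,
    ← Matrix.linearIndependent_rows_iff_isUnit]
  rfl

/-- Removes the arbitrary representatives `Quot.out` from sums over edges. Diagonal terms must
vanish, since a diagonal pair has one ordering instead of two. -/
theorem sum_sym2_out {V : Type*} [Fintype V] [DecidableEq V] {F : V → V → ℝ}
    (hF : ∀ a b, F a b = F b a) (h0 : ∀ a, F a a = 0) :
    ∑ f : Sym2 V, F f.out.1 f.out.2 = (∑ a, ∑ b, F a b) / 2 := by
  rw [eq_div_iff two_ne_zero, ← Fintype.sum_prod_type',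
    ← Finset.sum_fiberwise (s := Finset.univ) (g := fun p : V × V => s(p.1, p.2)), Finset.sum_mul]
  refine Finset.sum_congr rfl fun f _ => ?_
  have hf : f = s(f.out.1, f.out.2) := f.out_eq.symm
  generalize f.out.1 = a at *
  generalize f.out.2 = b at *
  subst hf
  have : Finset.univ.filter (fun p : V × V => s(p.1, p.2) = s(a, b)) = {(a, b), (b, a)} := by
    ext ⟨p, q⟩
    simp
  rw [this]
  by_cases hab : a = b
  · subst hab; simp [h0]
  · rw [Finset.sum_pair (by simp [hab]), hF b a]; ring

/-! ### Alternating chains of tetrahedra -/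

/-- An alternating function of four vertices. -/
structure IsAltChain {V : Type*} (σ : V → V → V → V → ℝ) : Prop where
  swap01 : ∀ a b c d, σ b a c d = -σ a b c d
  swap12 : ∀ a b c d, σ a c b d = -σ a b c d
  swap23 : ∀ a b c d, σ a b d c = -σ a b c d

section Chains

variable {V : Type*}

theorem IsAltChain.add {σ τ : V → V → V → V → ℝ} (hσ : IsAltChain σ) (hτ : IsAltChain τ) :
    IsAltChain (fun a b c d => σ a b c d + τ a b c d) where
  swap01 a b c d := by rw [hσ.swap01, hτ.swap01]; ring
  swap12 a b c d := by rw [hσ.swap12, hτ.swap12]; ring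
  swap23 a b c d := by rw [hσ.swap23, hτ.swap23]; ring

theorem IsAltChain.smul {σ : V → V → V → V → ℝ} (hσ : IsAltChain σ) (r : ℝ) :
    IsAltChain (fun a b c d => r * σ a b c d) where
  swap01 a b c d := by rw [hσ.swap01]; ring
  swap12 a b c d := by rw [hσ.swap12]; ring
  swap23 a b c d := by rw [hσ.swap23]; ring

/-- Six times the signed volume of the tetrahedron with the given vertices. -/
abbrev vol4 (x : V → E3) (a b c d : V) : ℝ := signedSixVol ![x a, x b, x c, x d]

/-- The coefficients of the chain divided by signed volumes. -/
def density (σ : V → V → V → V → ℝ) (x : V → E3) (a b c d : V) : ℝ := σ a b c d / vol4 x a b c d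

variable {σ : V → V → V → V → ℝ} {x : V → E3}

/-- The chain and the signed volume change sign together, so the density depends only on the
unordered tetrahedron. -/
theorem IsAltChain.density_swap01 (hσ : IsAltChain σ) (a b c d : V) :
    density σ x b a c d = density σ x a b c d := by
  rw [density, density, vol4, signedSixVol_swap01, hσ.swap01, neg_div_neg_eq]

theorem IsAltChain.density_swap12 (hσ : IsAltChain σ) (a b c d : V) :
    density σ x a c b d = density σ x a b c d := by
  rw [density, density, vol4, signedSixVol_swap12, hσ.swap12, neg_div_neg_eq]

theorem IsAltChain.density_swap23 (hσ : IsAltChain σ) (a b c d : V) :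
    density σ x a b d c = density σ x a b c d := by
  rw [density, density, vol4, signedSixVol_swap23, hσ.swap23, neg_div_neg_eq]

theorem IsAltChain.density_swap_pairs (hσ : IsAltChain σ) (a b c d : V) :
    density σ x c d a b = density σ x a b c d := by
  rw [hσ.density_swap12, hσ.density_swap01, hσ.density_swap23, hσ.density_swap12]

/-- The variation of the angle at `ab` of the tetrahedron `abcd`, up to a factor, as a linear form
in the halved rates of change `m` of the squared edge lengths. -/
def tetForm (x : V → E3) (m : V → V → ℝ) (a b c d : V) : ℝ :=
  m c d + adjCoeff (x a) (x b) (x c) (x d) * m a c + adjCoeff (x a) (x b) (x d) (x c) * m a d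
    + adjCoeff (x b) (x a) (x c) (x d) * m b c + adjCoeff (x b) (x a) (x d) (x c) * m b d
    + selfCoeff (x a) (x b) (x c) (x d) * m a b

theorem selfCoeff_swap01 (a b c d : E3) : selfCoeff b a c d = selfCoeff a b c d := by
  have h : gram b a a = gram a b b := by rw [gram_base_self, gram_self_right, sub_zero]
  simp only [selfCoeff, areaSq_swap01 a b, h, gram_base_self a b c, gram_base_self a b d,
    gram_base a b c d, gram_base a b c c, gram_base a b d d]
  ring

theorem tetForm_swap01 {m : V → V → ℝ} (hm : ∀ a b, m a b = m b a) (a b c d : V) :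
    tetForm x m b a c d = tetForm x m a b c d := by
  rw [tetForm, tetForm, selfCoeff_swap01, hm b a]; ring

variable [Fintype V]

/-- The variation of the defect angle at `ab`, up to a factor. -/
def curv (σ : V → V → V → V → ℝ) (x : V → E3) (m : V → V → ℝ) (a b : V) : ℝ :=
  ∑ c, ∑ d, density σ x a b c d * tetForm x m a b c d

theorem IsAltChain.curv_comm (hσ : IsAltChain σ) {m : V → V → ℝ} (hm : ∀ a b, m a b = m b a)
    (a b : V) : curv σ x m a b = curv σ x m b a := by
  simp only [curv]
  refine Finset.sum_congr rfl fun c _ => Finset.sum_congr rfl fun d _ => ?_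
  rw [hσ.density_swap01 b a, tetForm_swap01 hm b a]

/-- The symmetric bilinear form of variations of defect angles. -/
def curvForm (σ : V → V → V → V → ℝ) (x : V → E3) (n m : V → V → ℝ) : ℝ :=
  ∑ a, ∑ b, n a b * curv σ x m a b

/-- The four edges adjacent to `ab` contribute equally after relabelling the summation vertices,
because the density is symmetric. This leaves opposite, adjacent and equal pairs of edges. -/
theorem IsAltChain.curvForm_eq (hσ : IsAltChain σ) {n m : V → V → ℝ}
    (hn : ∀ a b, n a b = n b a) :
    curvForm σ x n m = (∑ a, ∑ b, ∑ c, ∑ d, density σ x a b c d * (n a b * m c d))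
      + 4 * (∑ a, ∑ b, ∑ c, ∑ d, density σ x a b c d *
        (n a b * (adjCoeff (x a) (x b) (x c) (x d) * m a c)))
      + ∑ a, ∑ b, ∑ c, ∑ d, density σ x a b c d *
        (n a b * (selfCoeff (x a) (x b) (x c) (x d) * m a b)) := by
  have h1 : (∑ a, ∑ b, ∑ c, ∑ d, density σ x a b c d *
        (n a b * (adjCoeff (x a) (x b) (x d) (x c) * m a d))) =
      ∑ a, ∑ b, ∑ c, ∑ d, density σ x a b c d *
        (n a b * (adjCoeff (x a) (x b) (x c) (x d) * m a c)) := by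
    refine Finset.sum_congr rfl fun a _ => Finset.sum_congr rfl fun b _ => ?_
    rw [Finset.sum_comm]
    simp only [hσ.density_swap23]
  have h2 : (∑ a, ∑ b, ∑ c, ∑ d, density σ x a b c d *
        (n a b * (adjCoeff (x b) (x a) (x c) (x d) * m b c))) =
      ∑ a, ∑ b, ∑ c, ∑ d, density σ x a b c d *
        (n a b * (adjCoeff (x a) (x b) (x c) (x d) * m a c)) := by
    rw [Finset.sum_comm]
    refine Finset.sum_congr rfl fun a _ => Finset.sum_congr rfl fun b _ =>
      Finset.sum_congr rfl fun c _ => Finset.sum_congr rfl fun d _ => ?_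
    rw [hσ.density_swap01, hn b a]
  have h3 : (∑ a, ∑ b, ∑ c, ∑ d, density σ x a b c d *
        (n a b * (adjCoeff (x b) (x a) (x d) (x c) * m b d))) =
      ∑ a, ∑ b, ∑ c, ∑ d, density σ x a b c d *
        (n a b * (adjCoeff (x a) (x b) (x c) (x d) * m a c)) := by
    rw [← h1, Finset.sum_comm]
    refine Finset.sum_congr rfl fun a _ => Finset.sum_congr rfl fun b _ =>
      Finset.sum_congr rfl fun c _ => Finset.sum_congr rfl fun d _ => ?_
    rw [hσ.density_swap01, hn b a]
  have h4 : (4 : ℝ) = 1 + 1 + 1 + 1 := by norm_num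
  rw [h4, add_mul, add_mul, add_mul, one_mul]
  nth_rw 2 [← h1]
  nth_rw 2 [← h2]
  nth_rw 2 [← h3]
  simp only [curvForm, curv, tetForm, Finset.mul_sum, ← Finset.sum_add_distrib]
  refine Finset.sum_congr rfl fun a _ => Finset.sum_congr rfl fun b _ =>
      Finset.sum_congr rfl fun c _ => Finset.sum_congr rfl fun d _ => ?_
  ring

/-- Each of the three kinds of terms is symmetric by itself: opposite edges by exchanging the pairs
`ab` and `cd`, adjacent ones by `adjCoeff_swap12`, equal ones trivially. The cycle condition is not
involved. -/
theorem IsAltChain.curvForm_comm (hσ : IsAltChain σ) {n m : V → V → ℝ}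
    (hn : ∀ a b, n a b = n b a) (hm : ∀ a b, m a b = m b a) :
    curvForm σ x n m = curvForm σ x m n := by
  rw [hσ.curvForm_eq hn, hσ.curvForm_eq hm]
  congr 1
  · congr 1
    · have e : ∀ F : V → V → V → V → ℝ, ∑ a, ∑ b, ∑ c, ∑ d, F a b c d =
          ∑ a, ∑ b, ∑ c, ∑ d, F c d a b := by
        intro F
        have h := Finset.sum_comm (s := (Finset.univ : Finset (V × V)))
          (t := (Finset.univ : Finset (V × V))) (f := fun p q => F p.1 p.2 q.1 q.2)
        simpa only [Fintype.sum_prod_type] using h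
      rw [e]
      refine Finset.sum_congr rfl fun a _ => Finset.sum_congr rfl fun b _ =>
        Finset.sum_congr rfl fun c _ => Finset.sum_congr rfl fun d _ => ?_
      rw [hσ.density_swap_pairs]
      ring
    · congr 1
      refine Finset.sum_congr rfl fun a _ => ?_
      rw [Finset.sum_comm]
      refine Finset.sum_congr rfl fun b _ =>
        Finset.sum_congr rfl fun c _ => Finset.sum_congr rfl fun d _ => ?_
      rw [hσ.density_swap12, adjCoeff_swap12]
      ring
  · refine Finset.sum_congr rfl fun a _ => Finset.sum_congr rfl fun b _ =>
      Finset.sum_congr rfl fun c _ => Finset.sum_congr rfl fun d _ => ?_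
    ring

/-- A chain is a cycle if its boundary vanishes. -/
def IsCycle (σ : V → V → V → V → ℝ) : Prop := ∀ a b c, ∑ d, σ a b c d = 0

/-- The tetrahedra of a chain are nondegenerate. -/
def IsPlaced (σ : V → V → V → V → ℝ) (x : V → E3) : Prop :=
  ∀ a b c d, σ a b c d ≠ 0 → vol4 x a b c d ≠ 0

omit [Fintype V] in
theorem tetForm_of_stretch {a b c d : V} (h : vol4 x a b c d ≠ 0) {m : V → V → ℝ}
    {a' b' c' d' : E3} (hab : m a b = stretch (x a) (x b) a' b')
    (hac : m a c = stretch (x a) (x c) a' c') (had : m a d = stretch (x a) (x d) a' d')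
    (hbc : m b c = stretch (x b) (x c) b' c') (hbd : m b d = stretch (x b) (x d) b' d')
    (hcd : m c d = stretch (x c) (x d) c' d') :
    gram (x a) (x b) (x b) * tetForm x m a b c d = vol4 x a b c d *
      (spin (x a) (x b) (x d) a' b' d' - spin (x a) (x b) (x c) a' b' c') := by
  rw [tetForm, ← posRate_eq h, hab, hac, had, hbc, hbd, hcd, posRate_stretch _ _ _ _ _ _ _ _ h]

/-- Motions of the vertices in the space do not change the defect angles. -/
theorem IsCycle.curv_stretch (hσ : IsAltChain σ) (hc : IsCycle σ) (hp : IsPlaced σ x)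
    (y : V → E3) (a b : V) (hab : x a ≠ x b) :
    curv σ x (fun p q => stretch (x p) (x q) (y p) (y q)) a b = 0 := by
  have hg : gram (x a) (x b) (x b) ≠ 0 := by
    rw [gram_self_eq_dist]; exact pow_ne_zero _ (dist_ne_zero.2 hab)
  apply mul_left_cancel₀ hg
  rw [mul_zero, curv, Finset.mul_sum]
  -- The volume in the density cancels the one in `tetForm_of_stretch`, leaving a difference of two
  -- spins.
  have h1 : ∀ c d, gram (x a) (x b) (x b) * (density σ x a b c d *
      tetForm x (fun p q => stretch (x p) (x q) (y p) (y q)) a b c d) =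
      σ a b c d * spin (x a) (x b) (x d) (y a) (y b) (y d)
        - σ a b c d * spin (x a) (x b) (x c) (y a) (y b) (y c) := by
    intro c d
    by_cases h : σ a b c d = 0
    · simp [density, h]
    · have hv := hp _ _ _ _ h
      rw [mul_left_comm, tetForm_of_stretch hv rfl rfl rfl rfl rfl rfl, density]
      field_simp
  simp only [Finset.mul_sum, h1, Finset.sum_sub_distrib]
  rw [Finset.sum_comm]
  -- Each spin depends on one face only, so its total coefficient is the boundary of the chain at
  -- that face.
  have h2 : ∀ d, ∑ c, σ a b c d = 0 := by
    intro d
    have := hc a b d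
    rw [← neg_eq_zero, ← this, ← Finset.sum_neg_distrib]
    exact Finset.sum_congr rfl fun c _ => by rw [hσ.swap23, neg_neg]
  simp only [← Finset.sum_mul, h2, hc a b]
  simp

end Chains

end

/-! ### The orientation of a closed triangulation as an alternating cycle -/

noncomputable section

section Combinatorics

variable {V : Type*} [DecidableEq V]

theorem mem_facetLink {L : Finset (Finset V)} {v : V} {t : Finset V} :
    t ∈ facetLink L v ↔ v ∉ t ∧ insert v t ∈ L := by
  simp only [facetLink, Finset.mem_image, Finset.mem_filter]
  constructor
  · rintro ⟨s, ⟨hs, hv⟩, rfl⟩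
    exact ⟨Finset.notMem_erase _ _, by rwa [Finset.insert_erase hv]⟩
  · rintro ⟨hv, ht⟩
    exact ⟨_, ⟨ht, Finset.mem_insert_self _ _⟩, Finset.erase_insert hv⟩

namespace ClosedTriangulation

variable (K : ClosedTriangulation V)

theorem mem_edges {a b : V} : s(a, b) ∈ K.edges ↔ a ≠ b ∧ ∃ T ∈ K.tets, a ∈ T ∧ b ∈ T := by
  simp only [edges, Finset.mem_biUnion, Finset.mem_filter, Finset.mk_mem_sym2_iff,
    Sym2.mk_isDiag_iff]
  tauto

variable {K}

theorem ne_of_mem_tets {a b c d : V} (h : ({a, b, c, d} : Finset V) ∈ K.tets) :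
    a ≠ b ∧ a ≠ c ∧ a ≠ d ∧ b ≠ c ∧ b ≠ d ∧ c ≠ d := by
  have hc := K.card_tet _ h
  have h3 : ∀ p q r : V, ({p, q, r} : Finset V).card ≤ 3 := fun p q r => Finset.card_le_three
  refine ⟨?_, ?_, ?_, ?_, ?_, ?_⟩ <;> rintro rfl
  · have := h3 a c d; simp at hc; omega
  · have := h3 a b d
    rw [show ({a, b, a, d} : Finset V) = {a, b, d} by ext; simp; tauto] at hc; omega
  · have := h3 a b c
    rw [show ({a, b, c, a} : Finset V) = {a, b, c} by ext; simp; tauto] at hc; omega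
  · have := h3 a b d; simp at hc; omega
  · have := h3 a b c
    rw [show ({a, b, c, b} : Finset V) = {a, b, c} by ext; simp; tauto] at hc; omega
  · have := h3 a b c; simp at hc; omega

theorem insert_swap01 (a b c d : V) : ({b, a, c, d} : Finset V) = {a, b, c, d} :=
  Finset.insert_comm _ _ _

theorem insert_swap12 (a b c d : V) : ({a, c, b, d} : Finset V) = {a, b, c, d} := by
  rw [Finset.insert_comm c b]

theorem insert_swap23 (a b c d : V) : ({a, b, d, c} : Finset V) = {a, b, c, d} := by
  rw [Finset.pair_comm d c]

theorem image_quadruple (a b c d : V) :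
    Finset.univ.image ![a, b, c, d] = ({a, b, c, d} : Finset V) := by
  ext e
  simp [Fin.exists_fin_succ, eq_comm]

/-- The alternating chain of an orientation. -/
def Orientation.chain (o : K.Orientation) (a b c d : V) : ℝ :=
  if ({a, b, c, d} : Finset V) ∈ K.tets then ((o.sign ![a, b, c, d] : ℤ) : ℝ) else 0

theorem Orientation.sign_swap (o : K.Orientation) {a b c d : V}
    (h : ({a, b, c, d} : Finset V) ∈ K.tets) :
    o.sign ![b, a, c, d] = -o.sign ![a, b, c, d] ∧ o.sign ![a, c, b, d] = -o.sign ![a, b, c, d] ∧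
      o.sign ![a, b, d, c] = -o.sign ![a, b, c, d] := by
  have h' : Finset.univ.image ![a, b, c, d] ∈ K.tets := by rwa [image_quadruple]
  have key : ∀ (i j : Fin 4), i ≠ j → o.sign (![a, b, c, d] ∘ Equiv.swap i j) =
      -o.sign ![a, b, c, d] := by
    intro i j hij
    rw [o.sign_perm _ _ h', Equiv.Perm.sign_swap hij, neg_one_mul]
  refine ⟨?_, ?_, ?_⟩
  · rw [← key 0 1 (by decide)]; congr 1; ext i; fin_cases i <;> rfl
  · rw [← key 1 2 (by decide)]; congr 1; ext i; fin_cases i <;> rfl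
  · rw [← key 2 3 (by decide)]; congr 1; ext i; fin_cases i <;> rfl

theorem Orientation.isAltChain (o : K.Orientation) : IsAltChain o.chain where
  swap01 a b c d := by
    rw [chain, chain, insert_swap01]
    split_ifs with h
    · rw [(o.sign_swap h).1]; simp
    · simp
  swap12 a b c d := by
    rw [chain, chain, insert_swap12]
    split_ifs with h
    · rw [(o.sign_swap h).2.1]; simp
    · simp
  swap23 a b c d := by
    rw [chain, chain, insert_swap23]
    split_ifs with h
    · rw [(o.sign_swap h).2.2]; simp
    · simp

theorem Orientation.chain_ne_zero_iff (o : K.Orientation) {a b c d : V} :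
    o.chain a b c d ≠ 0 ↔ ({a, b, c, d} : Finset V) ∈ K.tets := by
  rw [chain]
  split_ifs with h
  · simp [h]
  · simp [h]

theorem Orientation.chain_mul_self (o : K.Orientation) {a b c d : V}
    (h : ({a, b, c, d} : Finset V) ∈ K.tets) : o.chain a b c d * o.chain a b c d = 1 := by
  rw [chain, if_pos h, ← Int.cast_mul, ← Units.val_mul, Int.units_mul_self]
  simp

/-- The triangle `abc` is the edge `bc` of the link of `a`, and the link is a closed surface. -/
theorem card_fourth_vertex [Fintype V] {a b c d : V} (h : ({a, b, c, d} : Finset V) ∈ K.tets) :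
    (Finset.univ.filter fun e => ({a, b, c, e} : Finset V) ∈ K.tets).card = 2 := by
  obtain ⟨hab, hac, had, hbc, hbd, hcd⟩ := ne_of_mem_tets h
  have hl := (K.link_sphere a ⟨_, h, by simp⟩).edge_two {b, c, d}
    (mem_facetLink.2 ⟨by simp [hab, hac, had], h⟩) {b, c} (by intro; simp; tauto)
    (Finset.card_pair hbc)
  rw [← hl]
  refine Finset.card_bij (fun e _ => {b, c, e}) ?_ ?_ ?_
  · intro e he
    simp only [Finset.mem_filter, Finset.mem_univ, true_and] at he
    obtain ⟨-, -, hae, -⟩ := ne_of_mem_tets he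
    simp only [Finset.mem_filter]
    exact ⟨mem_facetLink.2 ⟨by simp [hab, hac, hae], he⟩, by intro; simp; tauto⟩
  · intro e he f hf hef
    simp only [Finset.mem_filter, Finset.mem_univ, true_and] at he hf
    obtain ⟨-, -, hae, -, hbe, hce⟩ := ne_of_mem_tets he
    have : e ∈ ({b, c, f} : Finset V) := by rw [← hef]; simp
    simpa [hbe.symm, hce.symm] using this
  · intro t ht
    simp only [Finset.mem_filter] at ht
    obtain ⟨ht, hs⟩ := ht
    obtain ⟨hat, hT⟩ := mem_facetLink.1 ht
    have hcard := K.card_tet _ hT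
    rw [Finset.card_insert_of_notMem hat] at hcard
    have h1 : (t \ {b, c}).card = 1 := by
      rw [Finset.card_sdiff_of_subset hs, Finset.card_pair hbc]; omega
    obtain ⟨e, he⟩ := Finset.card_eq_one.1 h1
    have ht' : t = {b, c, e} := by
      rw [← Finset.union_sdiff_of_subset hs, he]; ext; simp
    refine ⟨e, ?_, ht'.symm⟩
    simp only [Finset.mem_filter, Finset.mem_univ, true_and]
    rwa [ht'] at hT

theorem Orientation.isCycle [Fintype V] (o : K.Orientation) : IsCycle o.chain := by
  intro a b c
  by_cases h : ∃ d, ({a, b, c, d} : Finset V) ∈ K.tets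
  · obtain ⟨d, hd⟩ := h
    obtain ⟨e, f, hef, hD⟩ := Finset.card_eq_two.1 (card_fourth_vertex hd)
    have he : ({a, b, c, e} : Finset V) ∈ K.tets := by
      have : e ∈ ({e, f} : Finset V) := by simp
      rw [← hD] at this; simpa using this
    have hf : ({a, b, c, f} : Finset V) ∈ K.tets := by
      have : f ∈ ({e, f} : Finset V) := by simp
      rw [← hD] at this; simpa using this
    simp only [chain]
    rw [← Finset.sum_filter, hD, Finset.sum_pair hef, o.consistent a b c e f hef he hf]
    simp
  · push Not at h
    exact Finset.sum_eq_zero fun d _ => by rw [chain, if_neg (h d)]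

end ClosedTriangulation

end Combinatorics

/-! ### Derivatives of the defect angles -/

namespace ClosedTriangulation

variable {V : Type*} [Fintype V] [DecidableEq V] {K : ClosedTriangulation V}

theorem Nondegenerate.vol4_ne_zero {x : V → E3} (hx : K.Nondegenerate x) {a b c d : V}
    (h : ({a, b, c, d} : Finset V) ∈ K.tets) : vol4 x a b c d ≠ 0 := by
  obtain ⟨hab, hac, had, hbc, hbd, hcd⟩ := ne_of_mem_tets h
  rw [vol4, ← affineIndependent_iff_signedSixVol_ne_zero]
  let f : Fin 4 ↪ ({a, b, c, d} : Finset V) := ⟨fun i => ⟨![a, b, c, d] i, by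
      rw [← image_quadruple]; exact Finset.mem_image_of_mem _ (Finset.mem_univ _)⟩, by
    intro i j hij
    simp only [Subtype.mk.injEq] at hij
    fin_cases i <;> fin_cases j <;> simp_all⟩
  convert (hx _ h).comp_embedding f using 1
  ext i : 1
  fin_cases i <;> rfl

theorem Orientation.isPlaced (o : K.Orientation) {x : V → E3} (hx : K.Nondegenerate x) :
    IsPlaced o.chain x := fun _ _ _ _ h => hx.vol4_ne_zero (o.chain_ne_zero_iff.1 h)

theorem nondegenerate_of_vol4_ne_zero {x : V → E3}
    (h : ∀ a b c d, ({a, b, c, d} : Finset V) ∈ K.tets → vol4 x a b c d ≠ 0) :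
    K.Nondegenerate x := by
  intro T hT
  let e := (T.equivFinOfCardEq (K.card_tet T hT)).symm
  rw [← affineIndependent_equiv e, affineIndependent_iff_signedSixVol_ne_zero]
  have hT' : ({(e 0).1, (e 1).1, (e 2).1, (e 3).1} : Finset V) = T := by
    ext v
    simp only [Finset.mem_insert, Finset.mem_singleton]
    constructor
    · rintro (rfl | rfl | rfl | rfl) <;> exact Subtype.property _
    · intro hv
      obtain ⟨i, hi⟩ := e.surjective ⟨v, hv⟩
      have : v = (e i).1 := by rw [hi]
      fin_cases i
      · exact Or.inl this
      · exact Or.inr (Or.inl this)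
      · exact Or.inr (Or.inr (Or.inl this))
      · exact Or.inr (Or.inr (Or.inr this))
  have := h (e 0).1 (e 1).1 (e 2).1 (e 3).1 (by rwa [hT'])
  convert this using 2
  ext i : 1
  fin_cases i <;> rfl

theorem Nondegenerate.ne_of_edge {x : V → E3} (hx : K.Nondegenerate x) {a b : V}
    (h : s(a, b) ∈ K.edges) : x a ≠ x b := by
  obtain ⟨hab, T, hT, ha, hb⟩ := K.mem_edges.1 h
  have := (hx T hT).injective
  intro hx
  exact hab (Subtype.ext_iff.1 (@this ⟨a, ha⟩ ⟨b, hb⟩ hx))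

theorem len_comm (l : K.Edge → ℝ) (a b : V) : K.len l a b = K.len l b a := by
  simp only [len, Sym2.eq_swap (a := a) (b := b)]

theorem len_lengthMap {x : V → E3} {a b : V} (h : s(a, b) ∈ K.edges) :
    K.len (K.lengthMap x) a b = dist (x a) (x b) := by
  rw [len, dif_pos h, lengthMap, Sym2.lift_mk]

theorem len_out (l : K.Edge → ℝ) (e : K.Edge) : K.len l e.1.out.1 e.1.out.2 = l e := by
  have h : s(e.1.out.1, e.1.out.2) = e.1 := e.1.out_eq
  rw [len]
  simp only [h, e.2, dif_pos]

theorem len_eq_zero (l : K.Edge → ℝ) {a b : V} (h : s(a, b) ∉ K.edges) : K.len l a b = 0 :=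
  dif_neg h

/-- The halved rate of change of the squared distance of the vertices `a`, `b`, if the rates of
change of the edge lengths are given by `w`. -/
def sqRate (K : ClosedTriangulation V) (x : V → E3) (w : K.Edge → ℝ) (a b : V) : ℝ :=
  K.len (K.lengthMap x) a b * K.len w a b

theorem sqRate_comm (x : V → E3) (w : K.Edge → ℝ) (a b : V) :
    K.sqRate x w a b = K.sqRate x w b a := by
  rw [sqRate, sqRate, len_comm, len_comm w]

theorem mem_edges_of_tet {a b c d : V} (h : ({a, b, c, d} : Finset V) ∈ K.tets) :
    s(a, b) ∈ K.edges ∧ s(a, c) ∈ K.edges ∧ s(a, d) ∈ K.edges ∧ s(b, c) ∈ K.edges ∧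
      s(b, d) ∈ K.edges ∧ s(c, d) ∈ K.edges := by
  obtain ⟨hab, hac, had, hbc, hbd, hcd⟩ := ne_of_mem_tets h
  refine ⟨?_, ?_, ?_, ?_, ?_, ?_⟩ <;> rw [mem_edges] <;> refine ⟨by assumption, _, h, ?_, ?_⟩ <;>
    simp

theorem Orientation.placement_swap (o : K.Orientation) (x : V → E3) {a b c d : V}
    (h : ({a, b, c, d} : Finset V) ∈ K.tets) :
    o.placement x ![a, b, c, d] = o.chain a b c d * (SignType.sign (vol4 x a b c d) : ℝ) := by
  rw [placement, chain, if_pos h]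
  congr 4

/-- The defect angle as a sum over ordered pairs of vertices. -/
theorem Orientation.defect_eq (o : K.Orientation) (x : V → E3) (l : K.Edge → ℝ) (e : K.Edge) :
    o.defect x l e = -(1 / 2) * ∑ c, ∑ d, o.chain e.1.out.1 e.1.out.2 c d *
      (SignType.sign (vol4 x e.1.out.1 e.1.out.2 c d) : ℝ) *
        dihedral (K.len l e.1.out.1 e.1.out.2) (K.len l e.1.out.1 c) (K.len l e.1.out.1 d)
          (K.len l e.1.out.2 c) (K.len l e.1.out.2 d) (K.len l c d) := by
  rw [defect]
  generalize e.1.out.1 = a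
  generalize e.1.out.2 = b
  have h := sum_sym2_out (V := V) (F := fun c d => o.chain a b c d *
    (SignType.sign (vol4 x a b c d) : ℝ) * dihedral (K.len l a b) (K.len l a c) (K.len l a d)
      (K.len l b c) (K.len l b d) (K.len l c d)) ?_ ?_
  · rw [mul_comm, mul_neg, mul_one_div, ← h, Finset.sum_filter]
    congr 1
    refine Finset.sum_congr rfl fun f _ => ?_
    split_ifs with hf
    · rw [o.placement_swap x hf]
    · have : o.chain a b f.out.1 f.out.2 = 0 := by
        by_contra h0; exact hf (o.chain_ne_zero_iff.1 h0)
      rw [this]; simp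
  · intro c d
    rw [o.isAltChain.swap23 a b c d, vol4, signedSixVol_swap23 (x a) (x b) (x d) (x c), Left.sign_neg]
    have : dihedral (K.len l a b) (K.len l a c) (K.len l a d)
      (K.len l b c) (K.len l b d) (K.len l c d) = dihedral (K.len l a b) (K.len l a d)
      (K.len l a c) (K.len l b d) (K.len l b c) (K.len l d c) := by
      simp only [dihedral, innerOfLengths, len_comm l c d]
      congr 2 <;> ring
    rw [this]
    simp
  · intro c
    have : o.chain a b c c = 0 := by
      have := o.isAltChain.swap23 a b c c; linarith
    simp only [this]; simp

/-- Turns the orientation sign of the placement together with the absolute volume into one over the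
signed volume; this makes the derivatives of the defect angles linear in the orientation chain. -/
theorem sign_div_abs (r : ℝ) : (SignType.sign r : ℝ) / |r| = 1 / r := by
  rcases lt_trichotomy r 0 with h | h | h
  · rw [sign_neg h, abs_of_neg h]; simp [neg_div, div_neg]
  · simp [h]
  · rw [sign_pos h, abs_of_pos h]; simp

/-- The angle derivative has the numerator l² · `tetForm` and the denominator l · |6V|, where l is
the length of `e`; so one factor l remains. The 1/2 accounts for the two orderings of the opposite
edge in `curv`. -/
theorem Orientation.hasDerivAt_defect (o : K.Orientation) {x : V → E3} (hx : K.Nondegenerate x)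
    {l : ℝ → K.Edge → ℝ} {t : ℝ} (hl : l t = K.lengthMap x) {w : K.Edge → ℝ}
    (hw : ∀ e, HasDerivAt (fun s => l s e) (w e) t) (e : K.Edge) :
    HasDerivAt (fun s => o.defect x (l s) e)
      (-(1 / 2) * (K.lengthMap x e *
        curv o.chain x (K.sqRate x w) e.1.out.1 e.1.out.2)) t := by
  simp only [o.defect_eq]
  refine HasDerivAt.const_mul _ ?_
  have hlen := len_out (K.lengthMap x) e
  rw [← hlen]
  have hedge : s(e.1.out.1, e.1.out.2) ∈ K.edges := by
    have h : s(e.1.out.1, e.1.out.2) = e.1 := e.1.out_eq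
    rw [h]; exact e.2
  generalize e.1.out.1 = a at *
  generalize e.1.out.2 = b at *
  have hd : ∀ p q, HasDerivAt (fun s => K.len (l s) p q) (K.len w p q) t := by
    intro p q
    by_cases h : s(p, q) ∈ K.edges
    · simp only [len, dif_pos h]; exact hw _
    · simp only [len, dif_neg h]; exact hasDerivAt_const _ _
  rw [curv, Finset.mul_sum]
  simp only [Finset.mul_sum]
  refine HasDerivAt.fun_sum fun c _ => HasDerivAt.fun_sum fun d _ => ?_
  by_cases h0 : o.chain a b c d = 0
  · simp only [h0, density, zero_div, zero_mul, mul_zero]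
    exact hasDerivAt_const _ _
  have hT := o.chain_ne_zero_iff.1 h0
  have hv := hx.vol4_ne_zero hT
  have hv' : signedSixVol ![x a, x b, x d, x c] ≠ 0 := by
    rw [signedSixVol_swap23]; exact neg_ne_zero.2 hv
  obtain ⟨hab, hac, had, hbc, hbd, hcd⟩ := mem_edges_of_tet hT
  have hin : ∀ {p q r}, s(p, q) ∈ K.edges → s(p, r) ∈ K.edges → s(q, r) ∈ K.edges →
      gram (x p) (x q) (x r) = innerOfLengths (K.len (l t) p q) (K.len (l t) p r)
        (K.len (l t) q r) := by
    intro p q r h1 h2 h3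
    rw [hl, len_lengthMap h1, len_lengthMap h2, len_lengthMap h3, gram_eq_innerOfLengths]
  have hsq : ∀ {p q}, s(p, q) ∈ K.edges → gram (x p) (x q) (x q) = K.len (l t) p q ^ 2 := by
    intro p q h1
    rw [hl, len_lengthMap h1, gram_self_eq_dist]
  have hpos := gram_self_pos hv
  have hD := hasDerivAt_dihedral (hd a b) (hd a c) (hd a d) (hd b c) (hd b d) (hd c d)
    (hsq hab) (hsq hac) (hsq had) (hin hab hac hbc) (hin hab had hbd) (hin hac had hcd)
    (areaSq_pos hv) (areaSq_pos hv') (by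
      rw [← areaSq, ← areaSq, gram_faces]; exact mul_pos hpos (sq_pos_of_ne_zero hv))
  refine (hD.const_mul (o.chain a b c d * (SignType.sign (vol4 x a b c d) : ℝ))).congr_deriv ?_
  rw [← areaSq, ← areaSq, gram_faces, Real.sqrt_mul hpos.le, Real.sqrt_sq_eq_abs, ← posRate,
    posRate_eq hv, hl]
  have hs : √(gram (x a) (x b) (x b)) = K.len (K.lengthMap x) a b := by
    rw [gram_self_eq_dist, len_lengthMap hab, Real.sqrt_sq dist_nonneg]
  rw [hs, hsq hab, hl]
  have hl0 : K.len (K.lengthMap x) a b ≠ 0 := by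
    rw [len_lengthMap hab]; exact dist_ne_zero.2 (hx.ne_of_edge hab)
  have hk : density o.chain x a b c d = o.chain a b c d *
      ((SignType.sign (vol4 x a b c d) : ℝ) / |vol4 x a b c d|) := by
    rw [sign_div_abs, density, mul_one_div]
  rw [hk, tetForm]
  simp only [sqRate]
  have := abs_ne_zero.2 hv
  field_simp

/-- The entries of the curvature matrix. -/
theorem Orientation.curvMatrix_apply (o : K.Orientation) {x : V → E3} (hx : K.Nondegenerate x)
    (j k : K.Edge) : o.curvMatrix x j k = -(1 / 2) * (K.lengthMap x j *
      curv o.chain x (K.sqRate x (Pi.single k 1)) j.1.out.1 j.1.out.2) := by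
  rw [curvMatrix, Matrix.of_apply]
  refine (o.hasDerivAt_defect hx (l := fun t => Function.update (K.lengthMap x) k t)
    (Function.update_eq_self _ _) (fun e => ?_) j).deriv
  exact hasDerivAt_pi.1 (hasDerivAt_update (K.lengthMap x) k (K.lengthMap x k)) e

end ClosedTriangulation

end

/-! ### The symmetric curvature matrix of a chain -/

noncomputable section

section Chains

variable {V : Type*} [Fintype V]

theorem curv_add (σ : V → V → V → V → ℝ) (x : V → E3) (m n : V → V → ℝ) (a b : V) :
    curv σ x (fun p q => m p q + n p q) a b = curv σ x m a b + curv σ x n a b := by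
  simp only [curv, ← Finset.sum_add_distrib, tetForm]
  refine Finset.sum_congr rfl fun c _ => Finset.sum_congr rfl fun d _ => ?_
  ring

theorem curv_smul (σ : V → V → V → V → ℝ) (x : V → E3) (r : ℝ) (m : V → V → ℝ) (a b : V) :
    curv σ x (fun p q => r * m p q) a b = r * curv σ x m a b := by
  simp only [curv, Finset.mul_sum, tetForm]
  refine Finset.sum_congr rfl fun c _ => Finset.sum_congr rfl fun d _ => ?_
  ring

/-- The variation of the defect angle as a linear functional. -/
def curvLin (σ : V → V → V → V → ℝ) (x : V → E3) (a b : V) : (V → V → ℝ) →ₗ[ℝ] ℝ where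
  toFun m := curv σ x m a b
  map_add' m n := curv_add σ x m n a b
  map_smul' r m := curv_smul σ x r m a b

theorem curv_congr {σ : V → V → V → V → ℝ} {x : V → E3} {m n : V → V → ℝ} {a b : V}
    (h : ∀ c d, σ a b c d ≠ 0 → m a b = n a b ∧ m a c = n a c ∧ m a d = n a d ∧ m b c = n b c ∧
      m b d = n b d ∧ m c d = n c d) : curv σ x m a b = curv σ x n a b := by
  refine Finset.sum_congr rfl fun c _ => Finset.sum_congr rfl fun d _ => ?_
  by_cases h0 : σ a b c d = 0
  · simp [density, h0]
  · obtain ⟨h1, h2, h3, h4, h5, h6⟩ := h c d h0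
    simp only [tetForm, h1, h2, h3, h4, h5, h6]

end Chains

namespace ClosedTriangulation

variable {V : Type*} [Fintype V] [DecidableEq V] {K : ClosedTriangulation V}

theorem len_add (v w : K.Edge → ℝ) (a b : V) : K.len (v + w) a b = K.len v a b + K.len w a b := by
  simp only [len]; split_ifs <;> simp

theorem len_smul (r : ℝ) (w : K.Edge → ℝ) (a b : V) : K.len (r • w) a b = r * K.len w a b := by
  simp only [len]; split_ifs <;> simp

/-- `sqRate` as a linear map. -/
def sqRateLin (K : ClosedTriangulation V) (x : V → E3) : (K.Edge → ℝ) →ₗ[ℝ] (V → V → ℝ) where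
  toFun w := K.sqRate x w
  map_add' v w := by ext a b; simp only [sqRate, len_add, Pi.add_apply]; ring
  map_smul' r w := by
    ext a b; simp only [sqRate, len_smul, Pi.smul_apply, smul_eq_mul, RingHom.id_apply]; ring

/-- The matrix of variations of the defect angles which belongs to a chain. -/
def chainMatrix (K : ClosedTriangulation V) (σ : V → V → V → V → ℝ) (x : V → E3) :
    Matrix K.Edge K.Edge ℝ := Matrix.of fun j k => -(1 / 2) * (K.lengthMap x j *
      curv σ x (K.sqRate x (Pi.single k 1)) j.1.out.1 j.1.out.2)

theorem Orientation.curvMatrix_eq (o : K.Orientation) {x : V → E3} (hx : K.Nondegenerate x) :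
    o.curvMatrix x = K.chainMatrix o.chain x := by
  ext j k; exact o.curvMatrix_apply hx j k

open Matrix in
theorem chainMatrix_mulVec (σ : V → V → V → V → ℝ) (x : V → E3) (w : K.Edge → ℝ) (j : K.Edge) :
    (K.chainMatrix σ x *ᵥ w) j = -(1 / 2) * (K.lengthMap x j *
      curv σ x (K.sqRate x w) j.1.out.1 j.1.out.2) := by
  let F : (K.Edge → ℝ) →ₗ[ℝ] ℝ :=
    (-(1 / 2) * K.lengthMap x j) • (curvLin σ x j.1.out.1 j.1.out.2).comp (K.sqRateLin x)
  have hF : ∀ v, F v = -(1 / 2) * (K.lengthMap x j *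
      curv σ x (K.sqRate x v) j.1.out.1 j.1.out.2) := fun v => by rw [← mul_assoc]; rfl
  rw [← hF, LinearMap.pi_apply_eq_sum_univ F w]
  refine Finset.sum_congr rfl fun k _ => ?_
  have e : (fun i => if k = i then (1 : ℝ) else 0) = Pi.single k 1 := by
    ext i; simp [Pi.single_apply, eq_comm]
  rw [smul_eq_mul, mul_comm, hF, e]
  rfl

/-- The rate supported on the edge `j` already contains the factor l_j, and `curvForm` meets `j` in
both orderings, which turns 1/2 into 1/4. -/
theorem chainMatrix_apply_eq_curvForm {σ : V → V → V → V → ℝ} (hσ : IsAltChain σ) (x : V → E3)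
    (j k : K.Edge) : K.chainMatrix σ x j k =
      -(1 / 4) * curvForm σ x (K.sqRate x (Pi.single j 1)) (K.sqRate x (Pi.single k 1)) := by
  have hm := sqRate_comm x (Pi.single k 1 : K.Edge → ℝ)
  have hn := sqRate_comm x (Pi.single j 1 : K.Edge → ℝ)
  have h := sum_sym2_out (V := V) (F := fun a b => K.sqRate x (Pi.single j 1) a b *
    curv σ x (K.sqRate x (Pi.single k 1)) a b)
    (fun a b => by rw [hn, hσ.curv_comm hm]) (fun a => by
      rw [sqRate, len_eq_zero _ (fun h => (K.mem_edges.1 h).1 rfl)]; ring)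
  rw [Finset.sum_eq_single j.1] at h
  · rw [sqRate, len_out, len_out, Pi.single_eq_same, mul_one] at h
    rw [chainMatrix, Matrix.of_apply, h, curvForm]; ring
  · intro f _ hf
    have : K.len (Pi.single j 1) f.out.1 f.out.2 = 0 := by
      rw [len]
      split_ifs with he
      · rw [Pi.single_apply, if_neg]
        rintro rfl
        exact hf (f.out_eq.symm)
      · rfl
    rw [sqRate, this]; ring
  · simp

theorem chainMatrix_isSymm {σ : V → V → V → V → ℝ} (hσ : IsAltChain σ) (x : V → E3) :
    (K.chainMatrix σ x).IsSymm := by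
  ext j k
  rw [Matrix.transpose_apply, chainMatrix_apply_eq_curvForm hσ, chainMatrix_apply_eq_curvForm hσ,
    hσ.curvForm_comm (sqRate_comm x _) (sqRate_comm x _)]

theorem Nondegenerate.lengthMap_ne_zero {x : V → E3} (hx : K.Nondegenerate x) (e : K.Edge) :
    K.lengthMap x e ≠ 0 := by
  have h : s(e.1.out.1, e.1.out.2) = e.1 := e.1.out_eq
  have he : s(e.1.out.1, e.1.out.2) ∈ K.edges := by rw [h]; exact e.2
  rw [← len_out (K.lengthMap x) e, len_lengthMap he]
  exact dist_ne_zero.2 (hx.ne_of_edge he)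

theorem mem_ker_chainMatrix {σ : V → V → V → V → ℝ} (hσ : IsAltChain σ) {x : V → E3}
    (hx : K.Nondegenerate x) (w : K.Edge → ℝ) :
    w ∈ LinearMap.ker (Matrix.toLin' (K.chainMatrix σ x)) ↔
      ∀ a b, s(a, b) ∈ K.edges → curv σ x (K.sqRate x w) a b = 0 := by
  rw [LinearMap.mem_ker, Matrix.toLin'_apply]
  constructor
  · intro h a b hab
    have h1 := congrFun h ⟨s(a, b), hab⟩
    rw [chainMatrix_mulVec, Pi.zero_apply] at h1
    have h2 := hx.lengthMap_ne_zero ⟨s(a, b), hab⟩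
    have h3 : curv σ x (K.sqRate x w) s(a, b).out.1 s(a, b).out.2 = 0 := by
      rcases mul_eq_zero.1 h1 with h | h
      · norm_num at h
      · exact (mul_eq_zero.1 h).resolve_left h2
    have h4 : s(s(a, b).out.1, s(a, b).out.2) = s(a, b) := s(a, b).out_eq
    rcases Sym2.eq_iff.1 h4 with ⟨h5, h6⟩ | ⟨h5, h6⟩
    · rwa [h5, h6] at h3
    · rwa [h5, h6, hσ.curv_comm (sqRate_comm x w)] at h3
  · intro h
    ext e
    have h4 : s(e.1.out.1, e.1.out.2) = e.1 := e.1.out_eq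
    rw [chainMatrix_mulVec, h _ _ (by rw [h4]; exact e.2)]
    simp

theorem Orientation.mem_flat (o : K.Orientation) {x : V → E3} (hx : K.Nondegenerate x)
    (w : K.Edge → ℝ) : w ∈ o.flat x ↔
      ∀ a b, s(a, b) ∈ K.edges → curv o.chain x (K.sqRate x w) a b = 0 := by
  rw [flat, o.curvMatrix_eq hx, mem_ker_chainMatrix o.isAltChain hx]

/-! ### The tangent space -/

/-- The squared length is differentiated along the line x + t • y in two ways, by the chain rule and
as a squared norm. -/
theorem sqRate_fderiv {x : V → E3} (hx : K.Nondegenerate x) (y : V → E3) {a b : V}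
    (hab : s(a, b) ∈ K.edges) :
    K.sqRate x (fderiv ℝ K.lengthMap x y) a b = stretch (x a) (x b) (y a) (y b) := by
  have hdiff : DifferentiableAt ℝ K.lengthMap x := by
    rw [differentiableAt_pi]
    rintro ⟨e, he⟩
    induction e using Sym2.ind with
    | _ p q =>
      change DifferentiableAt ℝ (fun z : V → E3 => dist (z p) (z q)) x
      exact DifferentiableAt.dist ℝ (differentiableAt_apply p x) (differentiableAt_apply q x)
        (hx.ne_of_edge he)
  have hline : HasDerivAt (fun t : ℝ => x + t • y) y 0 := by
    simpa using ((hasDerivAt_id (0 : ℝ)).smul_const y).const_add x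
  have h1 : HasDerivAt (fun t : ℝ => K.lengthMap (x + t • y)) (fderiv ℝ K.lengthMap x y) 0 := by
    have := hdiff.hasFDerivAt
    refine HasFDerivAt.comp_hasDerivAt (0 : ℝ) (l := K.lengthMap) ?_ hline
    simpa using this
  have h2 := hasDerivAt_pi.1 h1 ⟨s(a, b), hab⟩
  have h3 : HasDerivAt (fun t : ℝ => (x a - x b) + t • (y a - y b)) (y a - y b) 0 := by
    simpa using ((hasDerivAt_id (0 : ℝ)).smul_const (y a - y b)).const_add (x a - x b)
  have h4 := h3.norm_sq
  have h6 : (fun t : ℝ => K.lengthMap (x + t • y) ⟨s(a, b), hab⟩ ^ 2) =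
      fun t : ℝ => ‖(x a - x b) + t • (y a - y b)‖ ^ 2 := by
    ext t
    change dist ((x + t • y) a) ((x + t • y) b) ^ 2 = _
    rw [dist_eq_norm]
    congr 2
    simp only [Pi.add_apply, Pi.smul_apply, smul_sub]
    abel
  rw [← h6] at h4
  have h7 := (h2.pow 2).unique h4
  simp only [zero_smul, add_zero] at h7
  rw [sqRate, stretch, len, len, dif_pos hab, dif_pos hab]
  simp at h7
  linarith

theorem eq_of_sqRate_eq {x : V → E3} (hx : K.Nondegenerate x) {v w : K.Edge → ℝ}
    (h : ∀ a b, s(a, b) ∈ K.edges → K.sqRate x v a b = K.sqRate x w a b) : v = w := by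
  ext e
  have h4 : s(e.1.out.1, e.1.out.2) = e.1 := e.1.out_eq
  have := h _ _ (by rw [h4]; exact e.2)
  rw [sqRate, sqRate, len_out, len_out, len_out] at this
  exact mul_left_cancel₀ (hx.lengthMap_ne_zero e) this

theorem mem_tangent {x : V → E3} (hx : K.Nondegenerate x) (w : K.Edge → ℝ) :
    w ∈ K.tangent x ↔ ∃ y : V → E3, ∀ a b, s(a, b) ∈ K.edges →
      K.sqRate x w a b = stretch (x a) (x b) (y a) (y b) := by
  rw [tangent, LinearMap.mem_range]
  constructor
  · rintro ⟨y, rfl⟩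
    exact ⟨y, fun a b hab => sqRate_fderiv hx y hab⟩
  · rintro ⟨y, hy⟩
    exact ⟨y, eq_of_sqRate_eq hx fun a b hab => (sqRate_fderiv hx y hab).trans (hy a b hab).symm⟩

theorem tangent_le_flat (o : K.Orientation) {x : V → E3} (hx : K.Nondegenerate x) :
    K.tangent x ≤ o.flat x := by
  intro w hw
  obtain ⟨y, hy⟩ := (mem_tangent hx w).1 hw
  rw [o.mem_flat hx]
  intro a b hab
  rw [← o.isCycle.curv_stretch o.isAltChain (o.isPlaced hx) y a b (hx.ne_of_edge hab)]
  refine curv_congr fun c d h => ?_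
  obtain ⟨h1, h2, h3, h4, h5, h6⟩ := mem_edges_of_tet (o.chain_ne_zero_iff.1 h)
  exact ⟨hy _ _ h1, hy _ _ h2, hy _ _ h3, hy _ _ h4, hy _ _ h5, hy _ _ h6⟩

end ClosedTriangulation

end

noncomputable section

/-! ### Generic positions -/

section Rational

variable {X : Type*} [NormedAddCommGroup X] [NormedSpace ℝ X]

/-- The identity theorem: an analytic function that vanishes near one point of the connected space
`X` vanishes everywhere. -/
theorem dense_ne_zero_of_analytic {f : X → ℝ} (hf : AnalyticOnNhd ℝ f Set.univ) {x₀ : X}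
    (h0 : f x₀ ≠ 0) : Dense {x | f x ≠ 0} := by
  intro x
  rw [mem_closure_iff_frequently]
  by_contra h
  rw [Filter.not_frequently] at h
  refine h0 (hf.eqOn_zero_of_preconnected_of_eventuallyEq_zero isPreconnected_univ
    (Set.mem_univ x) ?_ (Set.mem_univ x₀))
  filter_upwards [h] with y hy
  simpa using hy

theorem isOpen_ne_zero_of_analytic {f : X → ℝ} (hf : AnalyticOnNhd ℝ f Set.univ) :
    IsOpen {x | f x ≠ 0} := by
  have : Continuous f := continuousOn_univ.1 hf.continuousOn
  exact isOpen_ne_fun this continuous_const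

/-- A function is a quotient of entire analytic functions on the set `S`. -/
def IsRatOn (S : Set X) (f : X → ℝ) : Prop :=
  ∃ P Q : X → ℝ, AnalyticOnNhd ℝ P Set.univ ∧ AnalyticOnNhd ℝ Q Set.univ ∧
    ∀ x ∈ S, Q x ≠ 0 ∧ f x = P x / Q x

variable {S : Set X} {f g : X → ℝ}

theorem IsRatOn.of_analytic (hf : AnalyticOnNhd ℝ f Set.univ) : IsRatOn S f :=
  ⟨f, fun _ => 1, hf, analyticOnNhd_const, fun x _ => by simp⟩

theorem IsRatOn.const (r : ℝ) : IsRatOn S (fun _ => r) := .of_analytic analyticOnNhd_const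

theorem IsRatOn.add (hf : IsRatOn S f) (hg : IsRatOn S g) : IsRatOn S (fun x => f x + g x) := by
  obtain ⟨P, Q, hP, hQ, h⟩ := hf
  obtain ⟨P', Q', hP', hQ', h'⟩ := hg
  refine ⟨_, _, (hP.mul hQ').add (hQ.mul hP'), hQ.mul hQ', fun x hx => ?_⟩
  obtain ⟨h1, h2⟩ := h x hx
  obtain ⟨h3, h4⟩ := h' x hx
  exact ⟨mul_ne_zero h1 h3, (congrArg₂ (· + ·) h2 h4).trans (div_add_div _ _ h1 h3)⟩

theorem IsRatOn.mul (hf : IsRatOn S f) (hg : IsRatOn S g) : IsRatOn S (fun x => f x * g x) := by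
  obtain ⟨P, Q, hP, hQ, h⟩ := hf
  obtain ⟨P', Q', hP', hQ', h'⟩ := hg
  refine ⟨_, _, hP.mul hP', hQ.mul hQ', fun x hx => ?_⟩
  obtain ⟨h1, h2⟩ := h x hx
  obtain ⟨h3, h4⟩ := h' x hx
  exact ⟨mul_ne_zero h1 h3, (congrArg₂ (· * ·) h2 h4).trans (div_mul_div_comm _ _ _ _)⟩

theorem IsRatOn.div (hf : IsRatOn S f) (hg : AnalyticOnNhd ℝ g Set.univ)
    (h0 : ∀ x ∈ S, g x ≠ 0) : IsRatOn S (fun x => f x / g x) := by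
  obtain ⟨P, Q, hP, hQ, h⟩ := hf
  refine ⟨_, _, hP, hQ.mul hg, fun x hx => ?_⟩
  obtain ⟨h1, h2⟩ := h x hx
  exact ⟨mul_ne_zero h1 (h0 x hx), (congrArg (· / g x) h2).trans (div_div _ _ _)⟩

theorem IsRatOn.sum {ι : Type*} (s : Finset ι) {F : ι → X → ℝ} (h : ∀ i ∈ s, IsRatOn S (F i)) :
    IsRatOn S (fun x => ∑ i ∈ s, F i x) := by
  classical
  induction s using Finset.induction_on with
  | empty => simpa using IsRatOn.const (S := S) 0
  | insert i s hi ih =>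
    simp only [Finset.sum_insert hi]
    exact (h i (Finset.mem_insert_self _ _)).add
      (ih fun j hj => h j (Finset.mem_insert_of_mem hj))

theorem IsRatOn.prod {ι : Type*} (s : Finset ι) {F : ι → X → ℝ} (h : ∀ i ∈ s, IsRatOn S (F i)) :
    IsRatOn S (fun x => ∏ i ∈ s, F i x) := by
  classical
  induction s using Finset.induction_on with
  | empty => simpa using IsRatOn.const (S := S) 1
  | insert i s hi ih =>
    simp only [Finset.prod_insert hi]
    exact (h i (Finset.mem_insert_self _ _)).mul
      (ih fun j hj => h j (Finset.mem_insert_of_mem hj))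

theorem IsRatOn.det {n : Type*} [Fintype n] [DecidableEq n] {M : X → Matrix n n ℝ}
    (h : ∀ i j, IsRatOn S (fun x => M x i j)) : IsRatOn S (fun x => (M x).det) := by
  simp only [Matrix.det_apply']
  exact IsRatOn.sum _ fun σ _ => (IsRatOn.const _).mul (IsRatOn.prod _ fun i _ => h _ _)

end Rational

/-! ### Rationality of the curvature in the vertex coordinates -/

section Positions

variable {V : Type*} [Fintype V]

theorem analytic_coord (a : V) (i : Fin 3) :
    AnalyticOnNhd ℝ (fun x : V → E3 => x a i) Set.univ := by
  have := ((EuclideanSpace.proj (𝕜 := ℝ) i : E3 →L[ℝ] ℝ).comp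
    (ContinuousLinearMap.proj (R := ℝ) (φ := fun _ : V => E3) a)).analyticOnNhd Set.univ
  exact this

theorem analytic_gram (a b c : V) :
    AnalyticOnNhd ℝ (fun x : V → E3 => gram (x a) (x b) (x c)) Set.univ := by
  simp only [gram_eq]
  have h := fun (v : V) i => analytic_coord v i
  exact ((((h b 0).sub (h a 0)).mul ((h c 0).sub (h a 0))).add
    (((h b 1).sub (h a 1)).mul ((h c 1).sub (h a 1)))).add
    (((h b 2).sub (h a 2)).mul ((h c 2).sub (h a 2)))

theorem analytic_areaSq (a b c : V) :
    AnalyticOnNhd ℝ (fun x : V → E3 => areaSq (x a) (x b) (x c)) Set.univ :=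
  ((analytic_gram a b b).mul (analytic_gram a c c)).sub ((analytic_gram a b c).pow 2)

theorem analytic_vol4 (a b c d : V) :
    AnalyticOnNhd ℝ (fun x : V → E3 => vol4 x a b c d) Set.univ := by
  simp only [vol4, signedSixVol_eq]
  have h := fun (v : V) i => (analytic_coord v i).sub (analytic_coord a i)
  exact (((h b 0).mul (((h c 1).mul (h d 2)).sub ((h c 2).mul (h d 1)))).sub
    ((h b 1).mul (((h c 0).mul (h d 2)).sub ((h c 2).mul (h d 0))))).add
    ((h b 2).mul (((h c 0).mul (h d 1)).sub ((h c 1).mul (h d 0))))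

variable {S : Set (V → E3)}

theorem isRatOn_adjCoeff {a b c : V} (h : ∀ x ∈ S, areaSq (x a) (x b) (x c) ≠ 0) (d : V) :
    IsRatOn S (fun x => adjCoeff (x a) (x b) (x c) (x d)) := by
  have g := fun p q r : V => analytic_gram p q r
  refine IsRatOn.div (.of_analytic ?_) (analytic_areaSq a b c) h
  exact ((((((g a b b).mul (g a c c)).sub ((g a b c).pow 2)).sub ((g a b d).mul (g a c c))).sub
    ((g a b b).mul (g a c d))).add ((g a c d).mul (g a b c))).add
    ((g a b c).mul (g a b d)) |>.neg

theorem isRatOn_selfCoeff {a b c d : V} (h1 : ∀ x ∈ S, areaSq (x a) (x b) (x c) ≠ 0)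
    (h2 : ∀ x ∈ S, areaSq (x a) (x b) (x d) ≠ 0) (h3 : ∀ x ∈ S, gram (x a) (x b) (x b) ≠ 0) :
    IsRatOn S (fun x => selfCoeff (x a) (x b) (x c) (x d)) := by
  have g := fun p q r : V => analytic_gram p q r
  have e : ∀ x : V → E3, selfCoeff (x a) (x b) (x c) (x d) =
      ((gram (x a) (x b) (x d) + gram (x a) (x b) (x c) - 2 * gram (x a) (x c) (x d)) +
      (gram (x a) (x b) (x b) * gram (x a) (x c) (x d)
        - gram (x a) (x b) (x c) * gram (x a) (x b) (x d)) *
      ((gram (x a) (x c) (x c) - gram (x a) (x b) (x c)) / areaSq (x a) (x b) (x c) +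
        (gram (x a) (x d) (x d) - gram (x a) (x b) (x d)) / areaSq (x a) (x b) (x d))) /
        gram (x a) (x b) (x b) := fun x => by rw [selfCoeff]; ring
  simp only [e]
  refine IsRatOn.div (.add (.of_analytic ?_) (.mul (.of_analytic ?_) (.add
    (.div (.of_analytic ?_) (analytic_areaSq a b c) h1)
    (.div (.of_analytic ?_) (analytic_areaSq a b d) h2)))) (g a b b) h3
  · exact ((g a b d).add (g a b c)).sub (analyticOnNhd_const.mul (g a c d))
  · exact ((g a b b).mul (g a c d)).sub ((g a b c).mul (g a b d))
  · exact (g a c c).sub (g a b c)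
  · exact (g a d d).sub (g a b d)

theorem isRatOn_curv {σ : V → V → V → V → ℝ} (hS : ∀ x ∈ S, IsPlaced σ x) (m : V → V → ℝ)
    (a b : V) : IsRatOn S (fun x => curv σ x m a b) := by
  refine IsRatOn.sum _ fun c _ => IsRatOn.sum _ fun d _ => ?_
  by_cases h0 : σ a b c d = 0
  · simpa [density, h0] using IsRatOn.const (S := S) 0
  have hv : ∀ x ∈ S, vol4 x a b c d ≠ 0 := fun x hx => hS x hx _ _ _ _ h0
  have hv' : ∀ x ∈ S, signedSixVol ![x a, x b, x d, x c] ≠ 0 := fun x hx => by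
    rw [signedSixVol_swap23]; exact neg_ne_zero.2 (hv x hx)
  have hA : ∀ x ∈ S, areaSq (x a) (x b) (x c) ≠ 0 := fun x hx => (areaSq_pos (hv x hx)).ne'
  have hB : ∀ x ∈ S, areaSq (x a) (x b) (x d) ≠ 0 := fun x hx => (areaSq_pos (hv' x hx)).ne'
  refine IsRatOn.mul ((IsRatOn.const _).div (analytic_vol4 a b c d) hv) ?_
  refine .add (.add (.add (.add (.add (.const _) (.mul (isRatOn_adjCoeff hA d) (.const _)))
    (.mul (isRatOn_adjCoeff hB c) (.const _))) (.mul (isRatOn_adjCoeff ?_ d) (.const _)))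
    (.mul (isRatOn_adjCoeff ?_ c) (.const _)))
    (.mul (isRatOn_selfCoeff hA hB fun x hx => (gram_self_pos (hv x hx)).ne') (.const _))
  · intro x hx; rw [areaSq_swap01]; exact hA x hx
  · intro x hx; rw [areaSq_swap01]; exact hB x hx

end Positions

namespace ClosedTriangulation

variable {V : Type*} [Fintype V] [DecidableEq V] (K : ClosedTriangulation V)

/-- Points in general position, on the moment curve. -/
theorem exists_general_position (V : Type*) [Fintype V] : ∃ x : V → E3, ∀ a b c d : V, a ≠ b →
    a ≠ c → a ≠ d → b ≠ c → b ≠ d → c ≠ d → vol4 x a b c d ≠ 0 := by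
  let t : V → ℝ := fun v => (Fintype.equivFin V v : ℕ)
  have ht : ∀ {a b}, a ≠ b → t b - t a ≠ 0 := by
    intro a b hab h
    apply hab
    have : t b = t a := sub_eq_zero.1 h
    simp only [t, Nat.cast_inj] at this
    exact ((Fintype.equivFin V).injective (Fin.ext this)).symm
  refine ⟨fun v => !₂[t v, t v ^ 2, t v ^ 3], fun a b c d hab hac had hbc hbd hcd => ?_⟩
  have : vol4 (fun v => (!₂[t v, t v ^ 2, t v ^ 3] : E3)) a b c d =
      (t b - t a) * (t c - t a) * (t d - t a) * (t c - t b) * (t d - t b) * (t d - t c) := by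
    rw [vol4, signedSixVol_eq]
    simp only [Matrix.cons_val]
    ring
  rw [this]
  exact mul_ne_zero (mul_ne_zero (mul_ne_zero (mul_ne_zero (mul_ne_zero (ht hab) (ht hac))
    (ht had)) (ht hbc)) (ht hbd)) (ht hcd)

/-- The product of the signed volumes of all ordered tetrahedra. -/
def volProd (x : V → E3) : ℝ :=
  ∏ v : V × V × V × V, if ({v.1, v.2.1, v.2.2.1, v.2.2.2} : Finset V) ∈ K.tets then
    vol4 x v.1 v.2.1 v.2.2.1 v.2.2.2 else 1

theorem volProd_ne_zero_iff (x : V → E3) : K.volProd x ≠ 0 ↔ K.Nondegenerate x := by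
  rw [volProd, Finset.prod_ne_zero_iff]
  constructor
  · intro h
    refine nondegenerate_of_vol4_ne_zero fun a b c d hT => ?_
    simpa [hT] using h (a, b, c, d) (Finset.mem_univ _)
  · intro hx v _
    split_ifs with h
    · exact hx.vol4_ne_zero h
    · exact one_ne_zero

theorem analytic_volProd : AnalyticOnNhd ℝ K.volProd Set.univ := by
  refine Finset.analyticOnNhd_fun_prod _ fun v _ => ?_
  split_ifs
  · exact analytic_vol4 _ _ _ _
  · exact analyticOnNhd_const

variable {K}

/-- The lengths are square roots and not rational in the coordinates. They enter only through a row
and a column scaling, which comes out of the determinant as a nonzero square. -/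
theorem Orientation.minor_eq (o : K.Orientation) {x : V → E3} (hx : K.Nondegenerate x)
    (C : Finset K.Edge) : o.minor x C = (∏ e : C, K.lengthMap x e) ^ 2 *
      (Matrix.of fun j k : C => -(1 / 2) *
        curv o.chain x (K.len (Pi.single k.1 1)) j.1.1.out.1 j.1.1.out.2).det := by
  have key : ∀ (v : C → ℝ) (B : Matrix C C ℝ),
      (Matrix.of fun j k => v j * (Matrix.of fun j k => v k * B j k) j k).det =
        (∏ e, v e) ^ 2 * B.det := by
    intro v B
    rw [Matrix.det_mul_column, Matrix.det_mul_row]; ring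
  rw [minor, ← key]
  congr 1
  ext j k
  rw [o.curvMatrix_eq hx]
  have hm : K.sqRate x (Pi.single k.1 1) =
      fun a b => K.lengthMap x k * K.len (Pi.single k.1 1) a b := by
    ext a b
    simp only [sqRate, len]
    split_ifs with he
    · by_cases hk : (⟨s(a, b), he⟩ : K.Edge) = k.1
      · rw [hk]
      · simp [hk]
    · simp
  simp only [Matrix.submatrix_apply, Matrix.of_apply, chainMatrix, hm, curv_smul]
  ring

/-- Take a nondegenerate point where the rank is maximal and a principal minor of that size which is
nonzero there. Where the numerator of this minor and the product of all volumes do not vanish, the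
rank keeps the maximal value. -/
theorem Orientation.exists_generic_basic (o : K.Orientation) :
    ∃ C : Finset K.Edge, ∃ U : Set (V → E3), IsOpen U ∧ Dense U ∧
      ∀ x ∈ U, K.Nondegenerate x ∧ o.IsBasic x C := by
  obtain ⟨x₁, hx₁⟩ := exists_general_position V
  have hx₁' : K.Nondegenerate x₁ := nondegenerate_of_vol4_ne_zero fun a b c d hT => by
    obtain ⟨hab, hac, had, hbc, hbd, hcd⟩ := ne_of_mem_tets hT
    exact hx₁ a b c d hab hac had hbc hbd hcd
  obtain ⟨x₀, hx₀, hmax⟩ : ∃ x₀, K.Nondegenerate x₀ ∧ ∀ x, K.Nondegenerate x →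
      (o.curvMatrix x).rank ≤ (o.curvMatrix x₀).rank := by
    let R : Set ℕ := {r | ∃ x, K.Nondegenerate x ∧ (o.curvMatrix x).rank = r}
    have hb : BddAbove R := ⟨Fintype.card K.Edge, by
      rintro r ⟨x, -, rfl⟩; exact Matrix.rank_le_card_height _⟩
    obtain ⟨x₀, hx₀, h⟩ := Nat.sSup_mem (s := R) ⟨_, x₁, hx₁', rfl⟩ hb
    exact ⟨x₀, hx₀, fun x hx => h ▸ le_csSup hb ⟨x, hx, rfl⟩⟩
  have hsymm : (o.curvMatrix x₀).IsSymm := by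
    rw [o.curvMatrix_eq hx₀]; exact chainMatrix_isSymm o.isAltChain x₀
  obtain ⟨C, hC, hdet⟩ := exists_principal_minor_ne_zero _ hsymm
  have hrat : IsRatOn {x | K.Nondegenerate x} (fun x => (Matrix.of fun j k : C => -(1 / 2) *
      curv o.chain x (K.len (Pi.single k.1 1)) j.1.1.out.1 j.1.1.out.2).det) :=
    IsRatOn.det fun j k => (IsRatOn.const _).mul (isRatOn_curv (fun x hx => o.isPlaced hx) _ _ _)
  obtain ⟨P, Q, hP, -, hPQ⟩ := hrat
  have hminor : ∀ x, K.Nondegenerate x → (o.minor x C ≠ 0 ↔ P x ≠ 0) := by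
    intro x hx
    obtain ⟨hQ, he⟩ := hPQ x hx
    beta_reduce at he
    rw [o.minor_eq hx, he]
    have : ∏ e : C, K.lengthMap x e ≠ 0 :=
      Finset.prod_ne_zero_iff.2 fun e _ => hx.lengthMap_ne_zero _
    rw [mul_ne_zero_iff, div_ne_zero_iff]
    exact ⟨fun h => h.2.1, fun h => ⟨pow_ne_zero _ this, h, hQ⟩⟩
  have hF := K.analytic_volProd.mul hP
  refine ⟨C, {x | (K.volProd * P) x ≠ 0}, isOpen_ne_zero_of_analytic hF,
    dense_ne_zero_of_analytic hF (x₀ := x₀) ?_, ?_⟩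
  · exact mul_ne_zero ((K.volProd_ne_zero_iff x₀).2 hx₀) ((hminor x₀ hx₀).1 hdet)
  · intro x hx
    obtain ⟨h1, h2⟩ := mul_ne_zero_iff.1 hx
    have hx' := (K.volProd_ne_zero_iff x).1 h1
    have hm := (hminor x hx').2 h2
    -- Maximality bounds the rank from above by |C|; the nonzero minor bounds it from below.
    refine ⟨hx', le_antisymm ?_ (hC ▸ hmax x hx'), hm⟩
    have hr := Matrix.rank_of_isUnit _ ((Matrix.isUnit_iff_isUnit_det _).2 (isUnit_iff_ne_zero.2 hm))
    rw [Fintype.card_coe] at hr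
    rw [← hr]
    exact Matrix.rank_submatrix_le _ _ _

end ClosedTriangulation

end

noncomputable section

/-! ### Vertex and edge stars are strongly connected -/

namespace ClosedTriangulation

section Stars

variable {V : Type*} [DecidableEq V] {K : ClosedTriangulation V}

/-- The link of `v` is strongly connected, so a property which passes through triangles containing
`v` reaches every tetrahedron at `v`. -/
theorem star_vertex_induction {v : V} {P : Finset V → Prop} {S T : Finset V} (hS : S ∈ K.tets)
    (hT : T ∈ K.tets) (hvS : v ∈ S) (hvT : v ∈ T) (h0 : P S)
    (hstep : ∀ b c d e, ({v, b, c, d} : Finset V) ∈ K.tets → ({v, b, c, e} : Finset V) ∈ K.tets →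
      P {v, b, c, d} → P {v, b, c, e}) : P T := by
  have hconn := (K.link_sphere v ⟨S, hS, hvS⟩).connected (S.erase v)
    (mem_facetLink.2 ⟨Finset.notMem_erase _ _, by rwa [Finset.insert_erase hvS]⟩) (T.erase v)
    (mem_facetLink.2 ⟨Finset.notMem_erase _ _, by rwa [Finset.insert_erase hvT]⟩)
  have key : ∀ t, Relation.ReflTransGen (fun p q => q ∈ facetLink K.tets v ∧
      (p ∩ q).card + 1 = p.card) (S.erase v) t → t ∈ facetLink K.tets v ∧ P (insert v t) := by
    intro t ht
    induction ht with
    | refl =>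
      rw [Finset.insert_erase hvS]
      exact ⟨mem_facetLink.2 ⟨Finset.notMem_erase _ _, by rwa [Finset.insert_erase hvS]⟩, h0⟩
    | @tail p q _ hpq ih =>
      obtain ⟨hp, hPp⟩ := ih
      obtain ⟨hq, hc⟩ := hpq
      refine ⟨hq, ?_⟩
      have hp' := mem_facetLink.1 hp
      have hq' := mem_facetLink.1 hq
      have hp3 := (K.link_sphere v ⟨S, hS, hvS⟩).card_eq p hp
      have hq3 := (K.link_sphere v ⟨S, hS, hvS⟩).card_eq q hq
      obtain ⟨b, c, hbc, hpq⟩ := Finset.card_eq_two.1 (show (p ∩ q).card = 2 by omega)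
      have hex : ∀ r : Finset V, r.card = 3 → p ∩ q ⊆ r → ∃ d, r = {b, c, d} := by
        intro r hr hs
        obtain ⟨d, hd⟩ := Finset.card_eq_one.1 (show (r \ (p ∩ q)).card = 1 by
          rw [Finset.card_sdiff_of_subset hs]; omega)
        refine ⟨d, ?_⟩
        rw [← Finset.union_sdiff_of_subset hs, hd, hpq]; ext; simp
      obtain ⟨d, hd⟩ := hex p hp3 Finset.inter_subset_left
      obtain ⟨e, he⟩ := hex q hq3 Finset.inter_subset_right
      rw [he]
      exact hstep b c d e (hd ▸ hp'.2) (he ▸ hq'.2) (hd ▸ hPp)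
  have := (key _ hconn).2
  rwa [Finset.insert_erase hvT] at this

/-- The same principle for the tetrahedra around an edge, since the link of `b` in the link of `a`
is a cycle. -/
theorem star_edge_induction {a b : V} (hab : a ≠ b) {P : Finset V → Prop} {S T : Finset V}
    (hS : S ∈ K.tets) (hT : T ∈ K.tets) (haS : a ∈ S) (hbS : b ∈ S) (haT : a ∈ T) (hbT : b ∈ T)
    (h0 : P S) (hstep : ∀ c d e, ({a, b, c, d} : Finset V) ∈ K.tets →
      ({a, b, c, e} : Finset V) ∈ K.tets → P {a, b, c, d} → P {a, b, c, e}) : P T := by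
  have hmem : ∀ R : Finset V, R ∈ facetLink (facetLink K.tets a) b ↔
      b ∉ R ∧ a ∉ R ∧ insert a (insert b R) ∈ K.tets := by
    intro R
    rw [mem_facetLink, mem_facetLink]
    simp [hab]
  have hins : ∀ {R : Finset V}, a ∈ R → b ∈ R → insert a (insert b ((R.erase a).erase b)) = R := by
    intro R ha hb
    rw [Finset.insert_erase (Finset.mem_erase.2 ⟨hab.symm, hb⟩), Finset.insert_erase ha]
  have hmem' : ∀ R : Finset V, R ∈ K.tets → a ∈ R → b ∈ R →
      (R.erase a).erase b ∈ facetLink (facetLink K.tets a) b := by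
    intro R hR ha hb
    rw [hmem]
    exact ⟨by simp, by simp, by rwa [hins ha hb]⟩
  have hconn := (K.link_sphere a ⟨S, hS, haS⟩).link_connected b _ (hmem' S hS haS hbS) _
    (hmem' T hT haT hbT)
  have key : ∀ t, Relation.ReflTransGen (fun p q => q ∈ facetLink (facetLink K.tets a) b ∧
      (p ∩ q).card + 1 = p.card) ((S.erase a).erase b) t →
      t ∈ facetLink (facetLink K.tets a) b ∧ P (insert a (insert b t)) := by
    intro t ht
    induction ht with
    | refl =>
      rw [hins haS hbS]
      exact ⟨hmem' S hS haS hbS, h0⟩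
    | @tail p q _ hpq ih =>
      obtain ⟨hp, hPp⟩ := ih
      obtain ⟨hq, hc⟩ := hpq
      refine ⟨hq, ?_⟩
      have hp' := (hmem p).1 hp
      have hq' := (hmem q).1 hq
      have hcard : ∀ r : Finset V, b ∉ r → a ∉ r → insert a (insert b r) ∈ K.tets →
          r.card = 2 := by
        intro r hb ha hr
        have := K.card_tet _ hr
        rw [Finset.card_insert_of_notMem (by simp [hab, ha]), Finset.card_insert_of_notMem hb]
          at this
        omega
      have hp2 := hcard p hp'.1 hp'.2.1 hp'.2.2
      have hq2 := hcard q hq'.1 hq'.2.1 hq'.2.2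
      obtain ⟨c, hpq⟩ := Finset.card_eq_one.1 (show (p ∩ q).card = 1 by omega)
      have hex : ∀ r : Finset V, r.card = 2 → p ∩ q ⊆ r → ∃ d, r = {c, d} := by
        intro r hr hs
        obtain ⟨d, hd⟩ := Finset.card_eq_one.1 (show (r \ (p ∩ q)).card = 1 by
          rw [Finset.card_sdiff_of_subset hs]; omega)
        refine ⟨d, ?_⟩
        rw [← Finset.union_sdiff_of_subset hs, hd, hpq]; ext; simp
      obtain ⟨d, hd⟩ := hex p hp2 Finset.inter_subset_left
      obtain ⟨e, he⟩ := hex q hq2 Finset.inter_subset_right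
      rw [he]
      exact hstep c d e (hd ▸ hp'.2.2) (he ▸ hq'.2.2) (hd ▸ hPp)
  have := (key _ hconn).2
  rwa [hins haT hbT] at this

end Stars

/-! ### Dual one-cocycles -/

variable {V : Type*} [Fintype V] [DecidableEq V] {K : ClosedTriangulation V}

/-- A sum over the tetrahedra at a triangle has two terms. -/
theorem Orientation.sum_chain (o : K.Orientation) {a b c d e : V} (hde : d ≠ e)
    (hd : ({a, b, c, d} : Finset V) ∈ K.tets) (he : ({a, b, c, e} : Finset V) ∈ K.tets)
    (F : V → ℝ) : ∑ f, o.chain a b c f * F f = o.chain a b c d * (F d - F e) := by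
  have h2 := card_fourth_vertex hd
  have hsub : ({d, e} : Finset V) = Finset.univ.filter
      fun f => ({a, b, c, f} : Finset V) ∈ K.tets := by
    refine Finset.eq_of_subset_of_card_le ?_ (by rw [h2, Finset.card_pair hde])
    intro f hf
    rcases Finset.mem_insert.1 hf with rfl | hf
    · simpa using hd
    · rw [Finset.mem_singleton.1 hf]; simpa using he
  have hsum : ∀ G : V → ℝ, ∑ f, o.chain a b c f * G f =
      o.chain a b c d * G d + o.chain a b c e * G e := by
    intro G
    rw [← Finset.sum_pair hde (f := fun f => o.chain a b c f * G f)]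
    refine (Finset.sum_subset (Finset.subset_univ _) fun f _ hf => ?_).symm
    have : o.chain a b c f = 0 := by
      by_contra h0
      apply hf
      rw [hsub]
      simpa using o.chain_ne_zero_iff.1 h0
    rw [this, zero_mul]
  have h1 := hsum fun _ => 1
  simp only [mul_one, o.isCycle a b c] at h1
  rw [hsum]
  linear_combination -F e * h1

theorem Orientation.eq_of_sum_chain_eq_zero (o : K.Orientation) {a b c d e : V}
    (hd : ({a, b, c, d} : Finset V) ∈ K.tets) (he : ({a, b, c, e} : Finset V) ∈ K.tets)
    {F : V → ℝ} (h : ∑ f, o.chain a b c f * F f = 0) : F d = F e := by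
  by_cases hde : d = e
  · rw [hde]
  rw [o.sum_chain hde hd he] at h
  exact sub_eq_zero.1 ((mul_eq_zero.1 h).resolve_left (o.chain_ne_zero_iff.2 hd))

/-- A real dual 1-cochain: an alternating function of the triangles. -/
structure IsDualCocycle (K : ClosedTriangulation V) (g : V → V → V → ℝ) : Prop where
  swap01 : ∀ a b c, g b a c = -g a b c
  swap12 : ∀ a b c, g a c b = -g a b c
  support : ∀ a b c, g a b c ≠ 0 → ∃ d, ({a, b, c, d} : Finset V) ∈ K.tets
  closed : ∀ a b, ∑ c, g a b c = 0

/-- In the star of a vertex, dual 1-cocycles are coboundaries. -/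
theorem IsDualCocycle.exists_star (o : K.Orientation) {g : V → V → V → ℝ}
    (hg : K.IsDualCocycle g) (v : V) :
    ∃ h : Finset V → ℝ, ∀ a b, g v a b = ∑ c, o.chain v a b c * h {v, a, b, c} := by
  by_cases hv : ∃ T ∈ K.tets, v ∈ T
  swap
  · refine ⟨0, fun a b => ?_⟩
    simp only [Pi.zero_apply, mul_zero, Finset.sum_const_zero]
    by_contra h0
    obtain ⟨d, hd⟩ := hg.support _ _ _ h0
    exact hv ⟨_, hd, by simp⟩
  set L := facetLink K.tets v with hL
  have hS := K.link_sphere v hv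
  have hLK : ∀ {a b c : V}, ({a, b, c} : Finset V) ∈ L → ({v, a, b, c} : Finset V) ∈ K.tets :=
    fun h => (mem_facetLink.1 h).2
  have hKL : ∀ {a b c : V}, ({v, a, b, c} : Finset V) ∈ K.tets → ({a, b, c} : Finset V) ∈ L := by
    intro a b c h
    obtain ⟨h1, h2, h3, -⟩ := ne_of_mem_tets h
    exact mem_facetLink.2 ⟨by simp [h1, h2, h3], h⟩
  -- antisymmetric functions on the edges of the link
  let C1 : Submodule ℝ (V → V → ℝ) :=
    { carrier := {γ | (∀ a b, γ b a = -γ a b) ∧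
        ∀ a b, γ a b ≠ 0 → ∃ t ∈ L, a ∈ t ∧ b ∈ t}
      zero_mem' := ⟨fun a b => by simp, fun a b h => absurd rfl h⟩
      add_mem' := by
        rintro γ γ' ⟨h1, h2⟩ ⟨h3, h4⟩
        refine ⟨fun a b => by simp only [Pi.add_apply, h1 a b, h3 a b]; ring, fun a b h => ?_⟩
        by_cases h0 : γ a b = 0
        · exact h4 a b fun h' => h (by simp [h0, h'])
        · exact h2 a b h0
      smul_mem' := by
        rintro r γ ⟨h1, h2⟩
        refine ⟨fun a b => by simp [h1 a b], fun a b h => h2 a b fun h' => h (by simp [h'])⟩ }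
  -- An antisymmetric function is determined by one value per edge, for an arbitrary ordering of its
  -- ends. Only this upper bound is needed.
  have hC1 : Module.finrank ℝ C1 ≤ (L.biUnion (Finset.powersetCard 2)).card := by
    have hch : ∀ e : {e // e ∈ L.biUnion (Finset.powersetCard 2)}, ∃ p : V × V,
        e.1 = {p.1, p.2} := by
      rintro ⟨e, he⟩
      obtain ⟨t, -, ht⟩ := Finset.mem_biUnion.1 he
      obtain ⟨a, b, -, h⟩ := Finset.card_eq_two.1 (Finset.mem_powersetCard.1 ht).2
      exact ⟨(a, b), h⟩
    choose p hp using hch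
    let ev : C1 →ₗ[ℝ] ({e // e ∈ L.biUnion (Finset.powersetCard 2)} → ℝ) :=
      { toFun := fun γ e => γ.1 (p e).1 (p e).2
        map_add' := fun _ _ => rfl
        map_smul' := fun _ _ => rfl }
    have hinj : Function.Injective ev := by
      rw [← LinearMap.ker_eq_bot, LinearMap.ker_eq_bot']
      rintro ⟨γ, h1, h2⟩ h0
      ext a b
      change γ a b = 0
      by_contra hne
      obtain ⟨t, ht, ha, hb⟩ := h2 a b hne
      have hab : a ≠ b := by
        rintro rfl
        have := h1 a a
        exact hne (by linarith)
      have he : ({a, b} : Finset V) ∈ L.biUnion (Finset.powersetCard 2) :=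
        Finset.mem_biUnion.2 ⟨t, ht, Finset.mem_powersetCard.2
          ⟨by intro c; simp; rintro (rfl | rfl) <;> assumption, Finset.card_pair hab⟩⟩
      have hpe := hp ⟨_, he⟩
      have hz : γ (p ⟨_, he⟩).1 (p ⟨_, he⟩).2 = 0 := congrFun h0 ⟨_, he⟩
      generalize (p ⟨_, he⟩).1 = c at *
      generalize (p ⟨_, he⟩).2 = d at *
      have hac : a ∈ ({c, d} : Finset V) := by rw [← hpe]; simp
      have hbc : b ∈ ({c, d} : Finset V) := by rw [← hpe]; simp
      simp only [Finset.mem_insert, Finset.mem_singleton] at hac hbc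
      rcases hac with rfl | rfl <;> rcases hbc with rfl | rfl
      · exact hab rfl
      · exact hne hz
      · exact hne (by rw [h1, hz, neg_zero])
      · exact hab rfl
    have := LinearMap.finrank_le_finrank_of_injective hinj
    rwa [Module.finrank_fintype_fun_eq_card, Fintype.card_coe] at this
  let δ1 : C1 →ₗ[ℝ] ({a // a ∈ L.biUnion id} → ℝ) :=
    { toFun := fun γ a => ∑ b, γ.1 a.1 b
      map_add' := fun γ γ' => by ext a; simp [Finset.sum_add_distrib]
      map_smul' := fun r γ => by ext a; simp [Finset.mul_sum] }
  -- As the link is connected, the image of `δ1` contains all differences of vertex indicators; one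
  -- further vector spans everything.
  have hδ1 : (L.biUnion id).card ≤ Module.finrank ℝ (LinearMap.range δ1) + 1 := by
    have hedge : ∀ a b : {a // a ∈ L.biUnion id}, (∃ t ∈ L, a.1 ∈ t ∧ b.1 ∈ t) →
        (Pi.single a 1 - Pi.single b 1 : {a // a ∈ L.biUnion id} → ℝ) ∈ LinearMap.range δ1 := by
      rintro a b ⟨t, ht, ha, hb⟩
      let γ : V → V → ℝ := fun p q => (if p = a.1 ∧ q = b.1 then 1 else 0)
        - (if p = b.1 ∧ q = a.1 then 1 else 0)
      refine ⟨⟨γ, fun p q => ?_, fun p q h => ⟨t, ht, ?_⟩⟩, ?_⟩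
      · simp only [γ, and_comm (a := q = a.1), and_comm (a := q = b.1)]
        ring
      · by_cases h1 : p = a.1 ∧ q = b.1
        · exact ⟨h1.1 ▸ ha, h1.2 ▸ hb⟩
        · by_cases h2 : p = b.1 ∧ q = a.1
          · exact ⟨h2.1 ▸ hb, h2.2 ▸ ha⟩
          · exact absurd (by simp only [γ, if_neg h1, if_neg h2, sub_zero]) h
      · ext c
        change ∑ q, γ c.1 q = _
        have hs : ∀ d, (Pi.single d 1 : {a // a ∈ L.biUnion id} → ℝ) c =
            if c.1 = d.1 then 1 else 0 := by
          intro d; rw [Pi.single_apply]; simp only [Subtype.ext_iff]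
        rw [Pi.sub_apply, hs, hs]
        simp only [γ, Finset.sum_sub_distrib, ite_and]
        by_cases h1 : c.1 = a.1 <;> by_cases h2 : c.1 = b.1 <;> simp [h1, h2]
    obtain ⟨t₀, ht₀⟩ := hS.nonempty
    have hall : ∀ a b : {a // a ∈ L.biUnion id},
        (Pi.single a 1 - Pi.single b 1 : {a // a ∈ L.biUnion id} → ℝ) ∈ LinearMap.range δ1 := by
      intro a b
      obtain ⟨t, ht, hat⟩ := Finset.mem_biUnion.1 a.2
      obtain ⟨t', ht', hbt⟩ := Finset.mem_biUnion.1 b.2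
      have key : ∀ s, Relation.ReflTransGen (fun p q => q ∈ L ∧ (p ∩ q).card + 1 = p.card) t s →
          s ∈ L ∧ ∀ c : {a // a ∈ L.biUnion id}, c.1 ∈ s →
            (Pi.single a 1 - Pi.single c 1 : {a // a ∈ L.biUnion id} → ℝ) ∈
              LinearMap.range δ1 := by
        intro s hs
        induction hs with
        | refl => exact ⟨ht, fun c hc => hedge a c ⟨t, ht, hat, hc⟩⟩
        | @tail p q _ hpq ih =>
          obtain ⟨hp, ih⟩ := ih
          obtain ⟨hq, hc⟩ := hpq
          refine ⟨hq, fun c hcq => ?_⟩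
          have hp3 := hS.card_eq p hp
          obtain ⟨r, hr⟩ := Finset.card_pos.1 (show 0 < (p ∩ q).card by omega)
          have hr' := Finset.mem_inter.1 hr
          have h1 := ih ⟨r, Finset.mem_biUnion.2 ⟨p, hp, hr'.1⟩⟩ hr'.1
          have h2 := hedge ⟨r, Finset.mem_biUnion.2 ⟨p, hp, hr'.1⟩⟩ c ⟨q, hq, hr'.2, hcq⟩
          simpa using Submodule.add_mem _ h1 h2
      exact (key t' (hS.connected t ht t' ht')).2 b hbt
    obtain ⟨a₀, ha₀⟩ := Finset.card_pos.1 (show 0 < t₀.card by rw [hS.card_eq t₀ ht₀]; norm_num)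
    let a : {a // a ∈ L.biUnion id} := ⟨a₀, Finset.mem_biUnion.2 ⟨t₀, ht₀, ha₀⟩⟩
    have htop : LinearMap.range δ1 ⊔ Submodule.span ℝ {Pi.single a (1 : ℝ)} = ⊤ := by
      rw [eq_top_iff, ← (Pi.basisFun ℝ _).span_eq, Submodule.span_le]
      rintro _ ⟨b, rfl⟩
      have := Submodule.add_mem_sup (hall b a)
        (Submodule.mem_span_singleton_self (R := ℝ) (Pi.single a (1 : ℝ)))
      rw [sub_add_cancel] at this
      rwa [Pi.basisFun_apply]
    have h1 := Submodule.finrank_add_le_finrank_add_finrank (LinearMap.range δ1)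
      (Submodule.span ℝ {Pi.single a (1 : ℝ)})
    rw [htop, finrank_top, Module.finrank_fintype_fun_eq_card, Fintype.card_coe] at h1
    have h2 : Module.finrank ℝ (Submodule.span ℝ {(Pi.single a (1 : ℝ) :
        {a // a ∈ L.biUnion id} → ℝ)}) ≤ 1 := by
      simpa using finrank_span_le_card (R := ℝ) ({(Pi.single a (1 : ℝ) :
        {a // a ∈ L.biUnion id} → ℝ)} : Set _)
    omega
  let ext0 : ({t // t ∈ L} → ℝ) → Finset V → ℝ := fun h t => if ht : t ∈ L then h ⟨t, ht⟩ else 0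
  let δ0 : ({t // t ∈ L} → ℝ) →ₗ[ℝ] C1 :=
    { toFun := fun h => ⟨fun a b => ∑ c, o.chain v a b c * ext0 h {a, b, c}, by
        refine ⟨fun a b => ?_, fun a b hne => ?_⟩
        · rw [← Finset.sum_neg_distrib]
          refine Finset.sum_congr rfl fun c _ => ?_
          rw [o.isAltChain.swap12 v a b c, Finset.insert_comm b a]
          ring
        · obtain ⟨c, -, hc⟩ := Finset.exists_ne_zero_of_sum_ne_zero hne
          exact ⟨_, hKL (o.chain_ne_zero_iff.1 (left_ne_zero_of_mul hc)), by simp, by simp⟩⟩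
      map_add' := fun h h' => by
        refine Subtype.ext (funext fun a => funext fun b => ?_)
        change ∑ c, o.chain v a b c * ext0 (h + h') {a, b, c} =
          ∑ c, o.chain v a b c * ext0 h {a, b, c} + ∑ c, o.chain v a b c * ext0 h' {a, b, c}
        rw [← Finset.sum_add_distrib]
        refine Finset.sum_congr rfl fun c _ => ?_
        simp only [ext0]
        split_ifs <;> simp [mul_add]
      map_smul' := fun r h => by
        refine Subtype.ext (funext fun a => funext fun b => ?_)
        change ∑ c, o.chain v a b c * ext0 (r • h) {a, b, c} =
          r * ∑ c, o.chain v a b c * ext0 h {a, b, c}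
        rw [Finset.mul_sum]
        refine Finset.sum_congr rfl fun c _ => ?_
        simp only [ext0]
        split_ifs <;> simp [mul_left_comm] }
  have hδ10 : LinearMap.range δ0 ≤ LinearMap.ker δ1 := by
    rintro _ ⟨h, rfl⟩
    rw [LinearMap.mem_ker]
    ext a
    change ∑ b, ∑ c, o.chain v a b c * ext0 h {a.1, b, c} = 0
    have : ∑ b, ∑ c, o.chain v a b c * ext0 h {a.1, b, c} =
        -∑ b, ∑ c, o.chain v a b c * ext0 h {a.1, b, c} := by
      conv_lhs => rw [Finset.sum_comm]
      rw [← Finset.sum_neg_distrib]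
      refine Finset.sum_congr rfl fun b _ => ?_
      rw [← Finset.sum_neg_distrib]
      refine Finset.sum_congr rfl fun c _ => ?_
      rw [o.isAltChain.swap23 v a b c, Finset.pair_comm c b]
      ring
    linarith
  -- A function in the kernel takes equal values on adjacent triangles, hence is constant on the
  -- connected link.
  have hδ0 : Module.finrank ℝ (LinearMap.ker δ0) ≤ 1 := by
    obtain ⟨t₀, ht₀⟩ := hS.nonempty
    have hle : LinearMap.ker δ0 ≤ Submodule.span ℝ {(fun _ => 1 : {t // t ∈ L} → ℝ)} := by
      intro h hh
      refine Submodule.mem_span_singleton.2 ⟨h ⟨t₀, ht₀⟩, ?_⟩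
      ext t
      have h0 := mem_facetLink.1 ht₀
      have h1 := mem_facetLink.1 t.2
      have key := star_vertex_induction (K := K)
        (P := fun T => ext0 h (T.erase v) = ext0 h t₀) h0.2 h1.2 (Finset.mem_insert_self _ _)
        (Finset.mem_insert_self _ _) (by rw [Finset.erase_insert h0.1]) (by
          intro b c d e hd he hP
          rw [← hP]
          have hz : ∑ f, o.chain v b c f * ext0 h {b, c, f} = 0 :=
            congrFun (congrFun (congrArg Subtype.val hh) b) c
          have h2 := o.eq_of_sum_chain_eq_zero (F := fun f => ext0 h {b, c, f}) hd he hz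
          rw [Finset.erase_insert (mem_facetLink.1 (hKL hd)).1,
            Finset.erase_insert (mem_facetLink.1 (hKL he)).1]
          exact h2.symm)
      rw [Finset.erase_insert h1.1] at key
      change (if ht : t.1 ∈ L then h ⟨t.1, ht⟩ else 0) =
        (if ht : t₀ ∈ L then h ⟨t₀, ht⟩ else 0) at key
      rw [dif_pos t.2, dif_pos (show t₀ ∈ L from ht₀)] at key
      rw [Pi.smul_apply, smul_eq_mul, mul_one, ← key]
    refine (Submodule.finrank_mono hle).trans ?_
    simpa using finrank_span_le_card (R := ℝ) ({(fun _ => 1 : {t // t ∈ L} → ℝ)} : Set _)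
  -- For v vertices, e edges and f triangles, dim ker δ1 ≤ e - v + 1 and dim range δ0 ≥ f - 1; these
  -- agree because v - e + f = 2.
  have heq : LinearMap.range δ0 = LinearMap.ker δ1 := by
    refine Submodule.eq_of_le_of_finrank_le hδ10 ?_
    have e1 := LinearMap.finrank_range_add_finrank_ker δ1
    have e0 := LinearMap.finrank_range_add_finrank_ker δ0
    have hE := hS.euler
    rw [Module.finrank_fintype_fun_eq_card, Fintype.card_coe] at e0
    rw [← hL] at hE
    omega
  have hmem : (⟨g v, fun a b => hg.swap12 v a b, fun a b h => by
      obtain ⟨d, hd⟩ := hg.support _ _ _ h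
      exact ⟨_, hKL hd, by simp, by simp⟩⟩ : C1) ∈ LinearMap.range δ0 := by
    rw [heq, LinearMap.mem_ker]
    ext a
    exact hg.closed v a
  obtain ⟨h, hh⟩ := hmem
  refine ⟨fun T => ext0 h (T.erase v), fun a b => ?_⟩
  have := congrFun (congrFun (congrArg Subtype.val hh) a) b
  rw [← show _ = g v a b from this]
  refine Finset.sum_congr rfl fun c _ => ?_
  by_cases h0 : o.chain v a b c = 0
  · simp [h0]
  · have hT := mem_facetLink.1 (hKL (o.chain_ne_zero_iff.1 h0))
    change _ = _ * ext0 h (Finset.erase _ v)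
    rw [Finset.erase_insert hT.1]

/-- If the first Betti number vanishes, then dual 1-cocycles are coboundaries. -/
theorem IsDualCocycle.exists_potential (o : K.Orientation) (hK : K.FirstBettiZero)
    {g : V → V → V → ℝ} (hg : K.IsDualCocycle g) :
    ∃ h : Finset V → ℝ, ∀ a b c, g a b c = ∑ d, o.chain a b c d * h {a, b, c, d} := by
  choose h hh using hg.exists_star o
  -- On the star of the edge `ab` both `h a` and `h b` are potentials of the same cocycle, so they
  -- differ by a constant there.
  have hdiff : ∀ a b, a ≠ b → ∀ S ∈ K.tets, ∀ T ∈ K.tets, a ∈ S → b ∈ S → a ∈ T → b ∈ T →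
      h b S - h a S = h b T - h a T := by
    intro a b hab S hS T hT haS hbS haT hbT
    refine star_edge_induction (P := fun T => h b S - h a S = h b T - h a T) hab hS hT haS hbS
      haT hbT rfl ?_
    intro c d e hd he hP
    rw [hP]
    refine o.eq_of_sum_chain_eq_zero (F := fun f => h b {a, b, c, f} - h a {a, b, c, f}) hd he ?_
    simp only [mul_sub, Finset.sum_sub_distrib]
    rw [← hh a b c, sub_eq_zero, ← neg_eq_iff_eq_neg.2 (hg.swap01 a b c), hh b a c,
      ← Finset.sum_neg_distrib]
    refine Finset.sum_congr rfl fun f _ => ?_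
    rw [o.isAltChain.swap01 a b c f, insert_swap01]
    ring
  -- The constant differences of star potentials form a simplicial 1-cocycle. This is the only place
  -- where the Betti number enters.
  let z : V → V → ℝ := fun a b => if hab : ∃ T ∈ K.tets, a ∈ T ∧ b ∈ T then
    h b hab.choose - h a hab.choose else 0
  have hz : ∀ T ∈ K.tets, ∀ a ∈ T, ∀ b ∈ T, z a b = h b T - h a T := by
    intro T hT a ha b hb
    have hab : ∃ T ∈ K.tets, a ∈ T ∧ b ∈ T := ⟨T, hT, ha, hb⟩
    obtain ⟨h1, h2, h3⟩ := hab.choose_spec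
    simp only [z, dif_pos hab]
    by_cases hne : a = b
    · subst hne; simp
    · exact hdiff a b hne _ h1 T hT h2 h3 ha hb
  obtain ⟨f, hf⟩ := hK z (by
    intro T hT a ha b hb c hc
    rw [hz T hT a ha b hb, hz T hT b hb c hc, hz T hT a ha c hc]
    ring)
  have hz : ∀ T ∈ K.tets, ∀ a ∈ T, ∀ b ∈ T, h a T - f a = h b T - f b := by
    intro T hT a ha b hb
    have := hf T hT a ha b hb
    rw [hz T hT a ha b hb] at this
    linarith
  obtain ⟨H, hH⟩ : ∃ H : Finset V → ℝ, ∀ T ∈ K.tets, ∀ a ∈ T, H T = h a T - f a := by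
    refine ⟨fun T => if hT : ∃ a, a ∈ T then h hT.choose T - f hT.choose else 0, ?_⟩
    intro T hT a ha
    have hne : ∃ a, a ∈ T := ⟨a, ha⟩
    rw [hz T hT a ha _ hne.choose_spec]
    exact dif_pos hne
  refine ⟨H, fun a b c => ?_⟩
  have hsum := o.isCycle a b c
  -- Replacing `h a` by `h a - f a` is harmless, since a constant is multiplied by the boundary of a
  -- cycle.
  rw [hh a b c, ← sub_zero (∑ d, _ * _), ← mul_zero (f a), ← hsum, Finset.mul_sum,
    ← Finset.sum_sub_distrib]
  refine Finset.sum_congr rfl fun d _ => ?_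
  by_cases h0 : o.chain a b c d = 0
  · simp [h0]
  rw [hH _ (o.chain_ne_zero_iff.1 h0) a (by simp)]
  ring

end ClosedTriangulation

end

noncomputable section

/-! ### Infinitesimally flat deformations are induced by motions of the vertices -/

theorem stretch_sum_smul {ι : Type*} (s : Finset ι) (c : ι → ℝ) (a b : E3) (a' b' : ι → E3) :
    stretch a b (∑ i ∈ s, c i • a' i) (∑ i ∈ s, c i • b' i) =
      ∑ i ∈ s, c i * stretch a b (a' i) (b' i) := by
  simp only [stretch, ← Finset.sum_sub_distrib, ← smul_sub, inner_sum, inner_smul_right]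

/-- `spin` is linear in the velocities. -/
def spinLin (a b c : E3) : (E3 × E3 × E3) →ₗ[ℝ] ℝ where
  toFun y := spin a b c y.1 y.2.1 y.2.2
  map_add' y z := by
    simp only [spin, PiLp.sub_apply, PiLp.add_apply, Prod.fst_add, Prod.snd_add, Matrix.cons_val]
    ring
  map_smul' r y := by
    simp only [spin, PiLp.sub_apply, PiLp.smul_apply, Prod.smul_fst, Prod.smul_snd, smul_eq_mul,
      Matrix.cons_val, RingHom.id_apply]
    ring

theorem spin_sum_smul {ι : Type*} (s : Finset ι) (r : ι → ℝ) (a b c : E3) (a' b' c' : ι → E3) :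
    spin a b c (∑ i ∈ s, r i • a' i) (∑ i ∈ s, r i • b' i) (∑ i ∈ s, r i • c' i) =
      ∑ i ∈ s, r i * spin a b c (a' i) (b' i) (c' i) := by
  have h := map_sum (spinLin a b c) (fun i => r i • (a' i, b' i, c' i)) s
  simp only [map_smul, smul_eq_mul] at h
  have e : ∑ i ∈ s, r i • (a' i, b' i, c' i) =
      (∑ i ∈ s, r i • a' i, ∑ i ∈ s, r i • b' i, ∑ i ∈ s, r i • c' i) := by
    refine Prod.ext ?_ (Prod.ext ?_ ?_) <;> simp [Prod.fst_sum, Prod.snd_sum]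
  rw [e] at h
  exact h

theorem eq_zero_of_rigid_triangle {a b c : E3} (h : areaSq a b c ≠ 0) {g : E3 × E3}
    (ha : rigid a g = 0) (hb : rigid b g = 0) (hc : rigid c g = 0) : g = 0 := by
  have hab : a ≠ b := by
    rintro rfl
    apply h; simp [areaSq, gram]
  refine eq_zero_of_rigid_eq_zero hab ha hb ?_
  rw [← spin_rigid h, ha, hb, hc]
  simp [spin]

namespace ClosedTriangulation

variable {V : Type*} [Fintype V] [DecidableEq V] {K : ClosedTriangulation V}

theorem exists_tet_velocities {x : V → E3} (hx : K.Nondegenerate x) {m : V → V → ℝ}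
    (hm : ∀ a b, m a b = m b a) (hm0 : ∀ a, m a a = 0) {T : Finset V} (hT : T ∈ K.tets) :
    ∃ y : V → E3, ∀ a ∈ T, ∀ b ∈ T, stretch (x a) (x b) (y a) (y b) = m a b := by
  obtain ⟨a, b, c, d, hab, hac, had, hbc, hbd, hcd, rfl⟩ := Finset.card_eq_four.1 (K.card_tet T hT)
  obtain ⟨a', b', c', d', h1, h2, h3, h4, h5, h6⟩ := exists_velocities (hx.vol4_ne_zero hT)
    (m a b) (m a c) (m a d) (m b c) (m b d) (m c d)
  have hs : ∀ p q p' q' : E3, stretch p q p' q' = stretch q p q' p' := by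
    intro p q p' q'; simp only [stretch_eq]; ring
  have h0 : ∀ p p' : E3, stretch p p p' p' = 0 := by intro p p'; simp [stretch]
  refine ⟨fun v => if v = a then a' else if v = b then b' else if v = c then c' else d', ?_⟩
  intro p hp q hq
  simp only [Finset.mem_insert, Finset.mem_singleton] at hp hq
  rcases hp with rfl | rfl | rfl | rfl <;> rcases hq with rfl | rfl | rfl | rfl <;>
    simp only [if_true, hab.symm, hac.symm, had.symm, hbc.symm, hbd.symm, hcd.symm, if_false, h0,
      hm0, h1, h2, h3, h4, h5, h6]
  · rw [hs, h1, hm]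
  · rw [hs, h2, hm]
  · rw [hs, h4, hm]
  · rw [hs, h3, hm]
  · rw [hs, h5, hm]
  · rw [hs, h6, hm]

theorem Nondegenerate.areaSq_ne_zero {x : V → E3} (hx : K.Nondegenerate x) {a b c d : V}
    (h : ({a, b, c, d} : Finset V) ∈ K.tets) : areaSq (x a) (x b) (x c) ≠ 0 :=
  (areaSq_pos (hx.vol4_ne_zero h)).ne'

/-- The jumps of the velocities of the tetrahedra at a triangle form an infinitesimal rigid
motion. -/
theorem Orientation.exists_jump (o : K.Orientation) {x : V → E3} (hx : K.Nondegenerate x)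
    {m : V → V → ℝ} {Y : Finset V → V → E3} (hY : ∀ T ∈ K.tets, ∀ a ∈ T, ∀ b ∈ T,
      stretch (x a) (x b) (Y T a) (Y T b) = m a b) :
    ∃ G : V → V → V → E3 × E3,
      (∀ a b c, (¬ ∃ d, ({a, b, c, d} : Finset V) ∈ K.tets) → G a b c = 0) ∧
      ∀ a b c, ∀ p ∈ ({a, b, c} : Finset V), (∃ d, ({a, b, c, d} : Finset V) ∈ K.tets) →
        rigid (x p) (G a b c) = ∑ d, o.chain a b c d • Y {a, b, c, d} p := by
  have hex : ∀ a b c, ∃ g : E3 × E3, ((¬ ∃ d, ({a, b, c, d} : Finset V) ∈ K.tets) → g = 0) ∧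
      ∀ p ∈ ({a, b, c} : Finset V), (∃ d, ({a, b, c, d} : Finset V) ∈ K.tets) →
        rigid (x p) g = ∑ d, o.chain a b c d • Y {a, b, c, d} p := by
    intro a b c
    by_cases h : ∃ d, ({a, b, c, d} : Finset V) ∈ K.tets
    · obtain ⟨d, hd⟩ := h
      have hst : ∀ p ∈ ({a, b, c} : Finset V), ∀ q ∈ ({a, b, c} : Finset V),
          stretch (x p) (x q) (∑ d, o.chain a b c d • Y {a, b, c, d} p)
            (∑ d, o.chain a b c d • Y {a, b, c, d} q) = 0 := by
        intro p hp q hq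
        have hsub : ∀ f, ({a, b, c} : Finset V) ⊆ {a, b, c, f} := by
          intro f r hr; simp at hr ⊢; tauto
        rw [stretch_sum_smul, ← zero_mul (m p q), ← o.isCycle a b c, Finset.sum_mul]
        refine Finset.sum_congr rfl fun f _ => ?_
        by_cases h0 : o.chain a b c f = 0
        · simp [h0]
        · rw [hY _ (o.chain_ne_zero_iff.1 h0) p (hsub f hp) q (hsub f hq)]
      obtain ⟨g, h1, h2, h3⟩ := exists_rigid (hx.areaSq_ne_zero hd)
        (hst a (by simp) b (by simp)) (hst a (by simp) c (by simp)) (hst b (by simp) c (by simp))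
      refine ⟨g, fun h => absurd ⟨d, hd⟩ h, fun p hp _ => ?_⟩
      simp only [Finset.mem_insert, Finset.mem_singleton] at hp
      rcases hp with rfl | rfl | rfl
      · exact h1
      · exact h2
      · exact h3
    · exact ⟨0, fun _ => rfl, fun p _ h' => absurd h' h⟩
  choose G h1 h2 using hex
  exact ⟨G, h1, h2⟩

/-- Local velocities are glued: their jumps across triangles form a cocycle of infinitesimal rigid
motions by flatness, and a potential of this cocycle supplies the corrections in the separate
tetrahedra. -/
theorem flat_le_tangent (o : K.Orientation) (hK : K.FirstBettiZero) {x : V → E3}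
    (hx : K.Nondegenerate x) : o.flat x ≤ K.tangent x := by
  intro w hw
  rw [o.mem_flat hx] at hw
  rw [mem_tangent hx]
  set m := K.sqRate x w with hmdef
  have hm : ∀ a b, m a b = m b a := sqRate_comm x w
  have hm0 : ∀ a, m a a = 0 := fun a => by
    rw [hmdef, sqRate, len_eq_zero _ (fun h => (K.mem_edges.1 h).1 rfl), zero_mul]
  have hex : ∀ T : Finset V, ∃ y : V → E3, T ∈ K.tets → ∀ a ∈ T, ∀ b ∈ T,
      stretch (x a) (x b) (y a) (y b) = m a b := by
    intro T
    by_cases hT : T ∈ K.tets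
    · obtain ⟨y, hy⟩ := exists_tet_velocities hx hm hm0 hT
      exact ⟨y, fun _ => hy⟩
    · exact ⟨0, fun h => absurd h hT⟩
  choose Y hY using hex
  obtain ⟨G, hG0, hG⟩ := o.exists_jump hx hY
  have hswap01 : ∀ a b c, G b a c = -G a b c := by
    intro a b c
    by_cases h : ∃ d, ({a, b, c, d} : Finset V) ∈ K.tets
    · have h' : ∃ d, ({b, a, c, d} : Finset V) ∈ K.tets := by simpa only [insert_swap01] using h
      obtain ⟨d, hd⟩ := h
      rw [eq_neg_iff_add_eq_zero]
      have key : ∀ p ∈ ({a, b, c} : Finset V), rigid (x p) (G b a c + G a b c) = 0 := by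
        intro p hp
        rw [map_add, hG a b c p hp ⟨d, hd⟩, hG b a c p (by simp at hp ⊢; tauto) h',
          ← Finset.sum_add_distrib]
        refine Finset.sum_eq_zero fun f _ => ?_
        rw [o.isAltChain.swap01 a b, insert_swap01]; simp
      exact eq_zero_of_rigid_triangle (hx.areaSq_ne_zero hd) (key a (by simp)) (key b (by simp))
        (key c (by simp))
    · rw [hG0 a b c h, hG0 b a c (by simpa only [insert_swap01] using h), neg_zero]
  have hswap12 : ∀ a b c, G a c b = -G a b c := by
    intro a b c
    by_cases h : ∃ d, ({a, b, c, d} : Finset V) ∈ K.tets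
    · have h' : ∃ d, ({a, c, b, d} : Finset V) ∈ K.tets := by simpa only [insert_swap12] using h
      obtain ⟨d, hd⟩ := h
      rw [eq_neg_iff_add_eq_zero]
      have key : ∀ p ∈ ({a, b, c} : Finset V), rigid (x p) (G a c b + G a b c) = 0 := by
        intro p hp
        rw [map_add, hG a b c p hp ⟨d, hd⟩, hG a c b p (by simp at hp ⊢; tauto) h',
          ← Finset.sum_add_distrib]
        refine Finset.sum_eq_zero fun f _ => ?_
        rw [o.isAltChain.swap12 a b, insert_swap12]; simp
      exact eq_zero_of_rigid_triangle (hx.areaSq_ne_zero hd) (key a (by simp)) (key b (by simp))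
        (key c (by simp))
    · rw [hG0 a b c h, hG0 a c b (by simpa only [insert_swap12] using h), neg_zero]
  have hGsum : ∀ a b c, ∀ p ∈ ({a, b, c} : Finset V),
      rigid (x p) (G a b c) = ∑ d, o.chain a b c d • Y {a, b, c, d} p := by
    intro a b c p hp
    by_cases h : ∃ d, ({a, b, c, d} : Finset V) ∈ K.tets
    · exact hG a b c p hp h
    · rw [hG0 a b c h, map_zero]
      refine (Finset.sum_eq_zero fun d _ => ?_).symm
      have : o.chain a b c d = 0 := by
        by_contra h0; exact h ⟨d, o.chain_ne_zero_iff.1 h0⟩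
      rw [this, zero_smul]
  -- The total jump around `ab` fixes `a` and `b`, because the velocities of these points cancel in
  -- pairs. What remains is a rotation about `ab`, measured by the spin and equal to a multiple of
  -- the curvature.
  have hclosed : ∀ a b, ∑ c, G a b c = 0 := by
    intro a b
    by_cases h : ∃ c d, ({a, b, c, d} : Finset V) ∈ K.tets
    swap
    · refine Finset.sum_eq_zero fun c _ => hG0 a b c fun h' => h ⟨c, h'⟩
    obtain ⟨c₀, d₀, h₀⟩ := h
    have hedge := (mem_edges_of_tet h₀).1
    have hne := hx.ne_of_edge hedge
    have hr : ∀ p ∈ ({a, b} : Finset V), rigid (x p) (∑ c, G a b c) = 0 := by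
      intro p hp
      rw [map_sum]
      have e : ∀ c, rigid (x p) (G a b c) = ∑ d, o.chain a b c d • Y {a, b, c, d} p :=
        fun c => hGsum a b c p (by simp at hp ⊢; tauto)
      simp only [e]
      -- The velocity of `p` is attached to the unordered tetrahedron, whereas the chain changes
      -- sign under c ↔ d.
      have hs : ∑ c, ∑ d, o.chain a b c d • Y {a, b, c, d} p =
          -∑ c, ∑ d, o.chain a b c d • Y {a, b, c, d} p := by
        conv_lhs => rw [Finset.sum_comm]
        rw [← Finset.sum_neg_distrib]
        refine Finset.sum_congr rfl fun c _ => ?_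
        rw [← Finset.sum_neg_distrib]
        refine Finset.sum_congr rfl fun d _ => ?_
        rw [o.isAltChain.swap23 a b c d, insert_swap23, neg_smul]
      have h2 : (2 : ℝ) • ∑ c, ∑ d, o.chain a b c d • Y {a, b, c, d} p = 0 := by
        rw [two_smul]
        nth_rw 1 [hs]
        exact neg_add_cancel _
      exact (smul_eq_zero.1 h2).resolve_left two_ne_zero
    refine eq_zero_of_rigid_eq_zero hne (hr a (by simp)) (hr b (by simp)) ?_
    have hsp : ∀ c, inner ℝ (G a b c).1 (x b - x a) = ∑ d, o.chain a b c d *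
        spin (x a) (x b) (x c) (Y {a, b, c, d} a) (Y {a, b, c, d} b) (Y {a, b, c, d} c) := by
      intro c
      by_cases h : ∃ d, ({a, b, c, d} : Finset V) ∈ K.tets
      · obtain ⟨d, hd⟩ := h
        rw [← spin_rigid (hx.areaSq_ne_zero hd), hGsum a b c a (by simp), hGsum a b c b (by simp),
          hGsum a b c c (by simp), spin_sum_smul]
      · rw [hG0 a b c h]
        refine Eq.trans (by simp) (Finset.sum_eq_zero fun d _ => ?_).symm
        have : o.chain a b c d = 0 := by
          by_contra h0; exact h ⟨d, o.chain_ne_zero_iff.1 h0⟩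
        rw [this, zero_mul]
    rw [Prod.fst_sum, sum_inner]
    simp only [hsp]
    have hflat := hw a b hedge
    have h1 : ∀ c d, gram (x a) (x b) (x b) * (density o.chain x a b c d * tetForm x m a b c d) =
        o.chain a b c d * spin (x a) (x b) (x d) (Y {a, b, c, d} a) (Y {a, b, c, d} b)
          (Y {a, b, c, d} d) - o.chain a b c d * spin (x a) (x b) (x c) (Y {a, b, c, d} a)
          (Y {a, b, c, d} b) (Y {a, b, c, d} c) := by
      intro c d
      by_cases h0 : o.chain a b c d = 0
      · simp [density, h0]
      · have hT := o.chain_ne_zero_iff.1 h0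
        have hv := hx.vol4_ne_zero hT
        have hy := fun p hp q hq => (hY _ hT p hp q hq).symm
        rw [mul_left_comm, tetForm_of_stretch hv (hy a (by simp) b (by simp))
          (hy a (by simp) c (by simp)) (hy a (by simp) d (by simp)) (hy b (by simp) c (by simp))
          (hy b (by simp) d (by simp)) (hy c (by simp) d (by simp)), density]
        field_simp
    have h2 : ∑ c, ∑ d, o.chain a b c d * spin (x a) (x b) (x d) (Y {a, b, c, d} a)
          (Y {a, b, c, d} b) (Y {a, b, c, d} d) = -∑ c, ∑ d, o.chain a b c d *
          spin (x a) (x b) (x c) (Y {a, b, c, d} a) (Y {a, b, c, d} b) (Y {a, b, c, d} c) := by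
      rw [Finset.sum_comm, ← Finset.sum_neg_distrib]
      refine Finset.sum_congr rfl fun c _ => ?_
      rw [← Finset.sum_neg_distrib]
      refine Finset.sum_congr rfl fun d _ => ?_
      rw [o.isAltChain.swap23 a b c d, insert_swap23, neg_mul]
    have h3 : gram (x a) (x b) (x b) * curv o.chain x m a b = 0 := by rw [hflat, mul_zero]
    rw [curv, Finset.mul_sum] at h3
    simp only [Finset.mul_sum, h1, Finset.sum_sub_distrib] at h3
    rw [h2] at h3
    linarith
  have hcoc : ∀ φ : (E3 × E3) →ₗ[ℝ] ℝ, K.IsDualCocycle fun a b c => φ (G a b c) := fun φ =>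
    { swap01 := fun a b c => by rw [hswap01, map_neg]
      swap12 := fun a b c => by rw [hswap12, map_neg]
      support := fun a b c h => by
        by_contra h'
        exact h (by rw [hG0 a b c h', map_zero])
      closed := fun a b => by rw [← map_sum, hclosed, map_zero] }
  -- The statement on real cocycles is applied to the six coordinates of the rigid motions.
  choose h hh using fun φ => (hcoc φ).exists_potential o hK
  let e1 : Fin 3 → (E3 × E3) →ₗ[ℝ] ℝ := fun i =>
    (EuclideanSpace.proj (𝕜 := ℝ) i : E3 →L[ℝ] ℝ).toLinearMap.comp (LinearMap.fst ℝ E3 E3)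
  let e2 : Fin 3 → (E3 × E3) →ₗ[ℝ] ℝ := fun i =>
    (EuclideanSpace.proj (𝕜 := ℝ) i : E3 →L[ℝ] ℝ).toLinearMap.comp (LinearMap.snd ℝ E3 E3)
  let H : Finset V → E3 × E3 := fun T =>
    (WithLp.toLp 2 fun i => h (e1 i) T, WithLp.toLp 2 fun i => h (e2 i) T)
  have hH : ∀ a b c, G a b c = ∑ d, o.chain a b c d • H {a, b, c, d} := by
    intro a b c
    refine Prod.ext ?_ ?_
    · ext i
      have := hh (e1 i) a b c
      simpa [e1, H, Prod.fst_sum] using this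
    · ext i
      have := hh (e2 i) a b c
      simpa [e2, H, Prod.snd_sum] using this
  -- Subtracting rigid motions keeps the length rates and removes the jumps, so the velocity of a
  -- vertex is the same in all tetrahedra of its star.
  let Z : Finset V → V → E3 := fun T p => Y T p - rigid (x p) (H T)
  have hZsum : ∀ a b c, ∀ p ∈ ({a, b, c} : Finset V),
      ∑ d, o.chain a b c d • Z {a, b, c, d} p = 0 := by
    intro a b c p hp
    simp only [Z, smul_sub, Finset.sum_sub_distrib, ← map_smul]
    rw [← hGsum a b c p hp, ← map_sum, ← hH, sub_self]
  have hZ : ∀ p, ∀ S ∈ K.tets, ∀ T ∈ K.tets, p ∈ S → p ∈ T → Z T p = Z S p := by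
    intro p S hS T hT hpS hpT
    refine star_vertex_induction (P := fun T => Z T p = Z S p) hS hT hpS hpT rfl ?_
    intro b c d e hd he hP
    rw [← hP]
    ext i
    refine (o.eq_of_sum_chain_eq_zero (F := fun f => Z {p, b, c, f} p i) hd he ?_).symm
    have := congrArg (fun v : E3 => v i) (hZsum p b c p (by simp))
    simpa using this
  have hpick : ∀ p, ∃ v : E3, ∀ T ∈ K.tets, p ∈ T → Z T p = v := by
    intro p
    by_cases hp : ∃ S ∈ K.tets, p ∈ S
    · obtain ⟨S, hS, hpS⟩ := hp
      exact ⟨Z S p, fun T hT hpT => hZ p S hS T hT hpS hpT⟩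
    · exact ⟨0, fun T hT hpT => absurd ⟨T, hT, hpT⟩ hp⟩
  choose y hy using hpick
  refine ⟨y, fun a b hab => ?_⟩
  obtain ⟨-, T, hT, ha, hb⟩ := K.mem_edges.1 hab
  rw [← hy a T hT ha, ← hy b T hT hb, stretch_sub, stretch_rigid, sub_zero, hY T hT a ha b hb]

end ClosedTriangulation

end

noncomputable section

/-! ### Orientations and chains -/

section Alternating

variable {V : Type*}

theorem IsAltChain.perm {σ : V → V → V → V → ℝ} (hσ : IsAltChain σ) (v : Fin 4 → V)
    (ρ : Equiv.Perm (Fin 4)) : σ (v (ρ 0)) (v (ρ 1)) (v (ρ 2)) (v (ρ 3)) =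
      ((Equiv.Perm.sign ρ : ℤ) : ℝ) * σ (v 0) (v 1) (v 2) (v 3) := by
  have hρ : ρ ∈ Submonoid.closure (Set.range fun i : Fin 3 =>
      Equiv.swap i.castSucc i.succ) := by
    rw [Equiv.Perm.mclosure_swap_castSucc_succ]; trivial
  induction hρ using Submonoid.closure_induction generalizing v with
  | mem ρ hρ =>
    obtain ⟨i, rfl⟩ := hρ
    fin_cases i
    · have := hσ.swap01 (v 0) (v 1) (v 2) (v 3)
      simpa [Equiv.Perm.sign_swap, Equiv.swap_apply_def] using this
    · have := hσ.swap12 (v 0) (v 1) (v 2) (v 3)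
      simpa [Equiv.Perm.sign_swap, Equiv.swap_apply_def] using this
    · have := hσ.swap23 (v 0) (v 1) (v 2) (v 3)
      simpa [Equiv.Perm.sign_swap, Equiv.swap_apply_def] using this
  | one => simp
  | mul ρ ρ' _ _ h h' =>
    have := h' (v ∘ ρ)
    simp only [Function.comp_apply] at this
    simp only [Equiv.Perm.mul_apply, this, h v, Equiv.Perm.sign_mul]
    push_cast
    ring

theorem exists_perm_of_image_eq [DecidableEq V] {v v' : Fin 4 → V}
    (h : Finset.univ.image v = Finset.univ.image v') (hc : (Finset.univ.image v).card = 4) :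
    ∃ ρ : Equiv.Perm (Fin 4), v' = v ∘ ρ := by
  have hinj : ∀ u : Fin 4 → V, (Finset.univ.image u).card = 4 → Function.Injective u := by
    intro u hu
    exact Set.injOn_univ.1 (by
      have := Finset.injOn_of_card_image_eq (s := Finset.univ) (f := u) (by rw [hu]; rfl)
      simpa using this)
  have hv' := hinj v' (h ▸ hc)
  have hex : ∀ i, ∃ j, v j = v' i := by
    intro i
    have : v' i ∈ Finset.univ.image v := by rw [h]; simp
    simpa using this
  choose f hf using hex
  have hf' : Function.Injective f := by
    intro i j hij
    apply hv'
    rw [← hf i, ← hf j, hij]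
  exact ⟨Equiv.ofBijective f (Finite.injective_iff_bijective.1 hf'), funext fun i => (hf i).symm⟩

/-- The same sign `r` serves all alternating chains, so two orientations, or a chain and the volume,
can be compared under one reordering. -/
theorem IsAltChain.eq_or_eq_neg [DecidableEq V] {a b c d a' b' c' d' : V}
    (h : ({a, b, c, d} : Finset V) = {a', b', c', d'}) (hc : ({a, b, c, d} : Finset V).card = 4) :
    ∃ r : ℝ, (r = 1 ∨ r = -1) ∧ ∀ {σ : V → V → V → V → ℝ}, IsAltChain σ →
      σ a' b' c' d' = r * σ a b c d := by
  rw [← ClosedTriangulation.image_quadruple, ← ClosedTriangulation.image_quadruple] at h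
  rw [← ClosedTriangulation.image_quadruple] at hc
  obtain ⟨ρ, hρ⟩ := exists_perm_of_image_eq h hc
  refine ⟨((Equiv.Perm.sign ρ : ℤ) : ℝ), ?_, fun {σ} hσ => ?_⟩
  · rcases Int.units_eq_one_or (Equiv.Perm.sign ρ) with h | h <;> simp [h]
  · have := hσ.perm ![a, b, c, d] ρ
    have e := fun i => congrFun hρ i
    have e0 := e 0
    have e1 := e 1
    have e2 := e 2
    have e3 := e 3
    simp only [Function.comp_apply, Matrix.cons_val] at e0 e1 e2 e3
    rw [← e0, ← e1, ← e2, ← e3] at this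
    simpa using this

theorem vol4_isAltChain (x : V → E3) : IsAltChain (vol4 x) where
  swap01 _ _ _ _ := signedSixVol_swap01 _ _ _ _
  swap12 _ _ _ _ := signedSixVol_swap12 _ _ _ _
  swap23 _ _ _ _ := signedSixVol_swap23 _ _ _ _

end Alternating

namespace ClosedTriangulation

variable {V : Type*} [Fintype V] [DecidableEq V] {K : ClosedTriangulation V}

open Classical in
/-- The orientation given by a cycle with values `±1` on the tetrahedra. -/
def Orientation.ofChain (σ : V → V → V → V → ℝ) (hσ : IsAltChain σ) (hc : IsCycle σ)
    (hs : ∀ a b c d, σ a b c d ≠ 0 → ({a, b, c, d} : Finset V) ∈ K.tets)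
    (h1 : ∀ a b c d, ({a, b, c, d} : Finset V) ∈ K.tets → σ a b c d = 1 ∨ σ a b c d = -1) :
    K.Orientation where
  sign v := if σ (v 0) (v 1) (v 2) (v 3) = 1 then 1 else -1
  sign_perm v ρ hv := by
    have hT : ({v 0, v 1, v 2, v 3} : Finset V) ∈ K.tets := by
      convert hv using 1
      ext e
      simp [Fin.exists_fin_succ, eq_comm]
    simp only [Function.comp_apply, hσ.perm v ρ]
    rcases h1 _ _ _ _ hT with h | h <;>
      rcases Int.units_eq_one_or (Equiv.Perm.sign ρ) with h' | h' <;> rw [h, h'] <;> norm_num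
  consistent a b c d e hde hd he := by
    have hsum : σ a b c d + σ a b c e = 0 := by
      rw [← hc a b c, ← Finset.sum_pair hde (f := fun f => σ a b c f)]
      refine Finset.sum_subset (Finset.subset_univ _) fun f _ hf => ?_
      by_contra h0
      have h2 := card_fourth_vertex hd
      have h3 : ({f, d, e} : Finset V) ⊆ Finset.univ.filter
          fun f => ({a, b, c, f} : Finset V) ∈ K.tets := by
        intro p hp
        simp only [Finset.mem_insert, Finset.mem_singleton] at hp
        rw [Finset.mem_filter]
        rcases hp with rfl | rfl | rfl
        · exact ⟨Finset.mem_univ _, hs _ _ _ _ h0⟩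
        · exact ⟨Finset.mem_univ _, hd⟩
        · exact ⟨Finset.mem_univ _, he⟩
      have h4 := Finset.card_le_card h3
      rw [h2, Finset.card_insert_of_notMem hf, Finset.card_pair hde] at h4
      omega
    change (if σ a b c e = 1 then (1 : ℤˣ) else -1) = -(if σ a b c d = 1 then (1 : ℤˣ) else -1)
    rcases h1 _ _ _ _ hd with h | h
    · have : σ a b c e = -1 := by linarith
      rw [h, this]; norm_num
    · have : σ a b c e = 1 := by linarith
      rw [h, this]; norm_num

theorem Orientation.chain_ofChain {σ : V → V → V → V → ℝ} (hσ : IsAltChain σ) (hc : IsCycle σ)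
    (hs : ∀ a b c d, σ a b c d ≠ 0 → ({a, b, c, d} : Finset V) ∈ K.tets)
    (h1 : ∀ a b c d, ({a, b, c, d} : Finset V) ∈ K.tets → σ a b c d = 1 ∨ σ a b c d = -1) :
    (Orientation.ofChain σ hσ hc hs h1).chain = σ := by
  ext a b c d
  rw [chain]
  split_ifs with h
  · change (((if σ a b c d = 1 then (1 : ℤˣ) else -1 : ℤˣ) : ℤ) : ℝ) = _
    rcases h1 _ _ _ _ h with h | h <;> rw [h] <;> norm_num
  · by_contra h0
    exact h (hs _ _ _ _ (Ne.symm h0))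

theorem Orientation.chain_eq_one_or (o : K.Orientation) {a b c d : V}
    (h : ({a, b, c, d} : Finset V) ∈ K.tets) : o.chain a b c d = 1 ∨ o.chain a b c d = -1 :=
  mul_self_eq_one_iff.1 (o.chain_mul_self h)

/-- Two orientations differ by signs which are locally constant. -/
theorem Orientation.exists_signs (o o' : K.Orientation) : ∃ τ : V → ℝ,
    (∀ a, τ a = 1 ∨ τ a = -1) ∧ ∀ a b c d, o'.chain a b c d = τ a * o.chain a b c d := by
  have hex : ∀ a, ∃ t : ℝ, (t = 1 ∨ t = -1) ∧ ∀ T ∈ K.tets, a ∈ T →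
      ∀ b c d, T = {a, b, c, d} → o'.chain a b c d = t * o.chain a b c d := by
    intro a
    by_cases ha : ∃ S ∈ K.tets, a ∈ S
    swap
    · exact ⟨1, Or.inl rfl, fun T hT haT => absurd ⟨T, hT, haT⟩ ha⟩
    obtain ⟨S, hS, haS⟩ := ha
    -- a comparison of two orderings of the same tetrahedron
    have hord : ∀ {t : ℝ} {b c d b' c' d' : V}, ({a, b, c, d} : Finset V) ∈ K.tets →
        ({a, b, c, d} : Finset V) = {a, b', c', d'} → o'.chain a b c d = t * o.chain a b c d →
        o'.chain a b' c' d' = t * o.chain a b' c' d' := by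
      intro t b c d b' c' d' hT h ht
      obtain ⟨r, -, hr⟩ := IsAltChain.eq_or_eq_neg h (K.card_tet _ hT)
      rw [hr o.isAltChain, hr o'.isAltChain, ht]; ring
    obtain ⟨b, c, d, hS'⟩ : ∃ b c d, S = {a, b, c, d} := by
      have := K.card_tet S hS
      obtain ⟨b, c, d, -, -, -, h⟩ := Finset.card_eq_three.1
        (show (S.erase a).card = 3 by rw [Finset.card_erase_of_mem haS]; omega)
      exact ⟨b, c, d, by rw [← h, Finset.insert_erase haS]⟩
    have hSabcd := hS' ▸ hS
    -- The ratio of the two values, written as a product because both are ±1. It is carried through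
    -- the star, as both orientations change sign across every triangle.
    refine ⟨o'.chain a b c d * o.chain a b c d, ?_, ?_⟩
    · rcases o.chain_eq_one_or hSabcd with h | h <;>
        rcases o'.chain_eq_one_or hSabcd with h' | h' <;> rw [h, h'] <;> norm_num
    · intro T hT haT
      refine star_vertex_induction (P := fun T => ∀ b' c' d', T = {a, b', c', d'} →
        o'.chain a b' c' d' = o'.chain a b c d * o.chain a b c d * o.chain a b' c' d') hS hT haS
        haT ?_ ?_
      · intro b' c' d' h
        refine hord hSabcd (hS' ▸ h) ?_
        rw [mul_assoc, o.chain_mul_self hSabcd, mul_one]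
      · intro p q r s hr hs hP b' c' d' h
        refine hord hs h ?_
        have h1 := hP p q r rfl
        by_cases hrs : r = s
        · rw [← hrs]; exact h1
        · have k : ∀ o : K.Orientation, o.chain a p q s = -o.chain a p q r := by
            intro o
            have := o.sum_chain (Ne.symm hrs) hs hr fun f => if f = r then 1 else 0
            simp only [mul_ite, mul_one, mul_zero, Finset.sum_ite_eq', Finset.mem_univ, if_true,
              if_neg (Ne.symm hrs)] at this
            linarith
          rw [k o, k o', h1]; ring
  choose τ hτ hτ' using hex
  refine ⟨τ, hτ, fun a b c d => ?_⟩
  by_cases h : ({a, b, c, d} : Finset V) ∈ K.tets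
  · exact hτ' a _ h (by simp) b c d rfl
  · rw [chain, chain, if_neg h, if_neg h, mul_zero]

/-- Row signs affect neither the kernel nor absolute values of minors, so flatness, basic sets and
the form do not depend on the orientation. The sign may vary with the row, as the complex need not
be connected. -/
theorem Orientation.curvMatrix_compare (o o' : K.Orientation) {x : V → E3}
    (hx : K.Nondegenerate x) : ∃ t : K.Edge → ℝ, (∀ e, t e = 1 ∨ t e = -1) ∧
      ∀ j k, o'.curvMatrix x j k = t j * o.curvMatrix x j k := by
  obtain ⟨τ, h1, h2⟩ := o.exists_signs o'
  refine ⟨fun j => τ j.1.out.1, fun e => h1 _, fun j k => ?_⟩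
  rw [o.curvMatrix_apply hx, o'.curvMatrix_apply hx]
  have : ∀ m, curv o'.chain x m j.1.out.1 j.1.out.2 =
      τ j.1.out.1 * curv o.chain x m j.1.out.1 j.1.out.2 := by
    intro m
    simp only [curv, Finset.mul_sum, density, h2]
    refine Finset.sum_congr rfl fun c _ => Finset.sum_congr rfl fun d _ => ?_
    ring
  rw [this]; ring

theorem Orientation.flat_eq (o o' : K.Orientation) {x : V → E3} (hx : K.Nondegenerate x) :
    o'.flat x = o.flat x := by
  obtain ⟨t, ht, h⟩ := o.curvMatrix_compare o' hx
  ext w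
  rw [flat, flat, LinearMap.mem_ker, LinearMap.mem_ker, Matrix.toLin'_apply, Matrix.toLin'_apply]
  have : ∀ j, (o'.curvMatrix x).mulVec w j = t j * (o.curvMatrix x).mulVec w j := by
    intro j
    simp only [Matrix.mulVec, dotProduct, h, Finset.mul_sum, mul_assoc]
  rw [funext_iff, funext_iff]
  refine forall_congr' fun j => ?_
  rw [this]
  have : t j ≠ 0 := by rcases ht j with h | h <;> rw [h] <;> norm_num
  simp [this]

theorem Orientation.abs_minor_eq (o o' : K.Orientation) {x : V → E3} (hx : K.Nondegenerate x)
    (C : Finset K.Edge) : |o'.minor x C| = |o.minor x C| := by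
  obtain ⟨t, ht, h⟩ := o.curvMatrix_compare o' hx
  have e : (o'.curvMatrix x).submatrix (fun i : C => i.1) (fun i : C => i.1) =
      Matrix.of fun i j : C => t i.1 * (o.curvMatrix x).submatrix (fun i : C => i.1)
        (fun i : C => i.1) i j := by
    ext i j
    simp [h]
  rw [minor, minor, e, Matrix.det_mul_column (fun i : C => t i.1), abs_mul, Finset.abs_prod]
  have : ∀ e, |t e| = 1 := by
    intro e
    rcases ht e with h | h <;> rw [h] <;> norm_num
  simp [this]

theorem Orientation.isBasic_iff (o o' : K.Orientation) {x : V → E3} (hx : K.Nondegenerate x)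
    (C : Finset K.Edge) : o'.IsBasic x C ↔ o.IsBasic x C := by
  have hr : (o'.curvMatrix x).rank = (o.curvMatrix x).rank := by
    have h1 := LinearMap.finrank_range_add_finrank_ker (Matrix.toLin' (o.curvMatrix x))
    have h2 := LinearMap.finrank_range_add_finrank_ker (Matrix.toLin' (o'.curvMatrix x))
    have h3 := o.flat_eq o' hx
    rw [flat, flat] at h3
    rw [h3] at h2
    rw [Matrix.rank, Matrix.rank, ← Matrix.toLin'_apply', ← Matrix.toLin'_apply']
    omega
  rw [IsBasic, IsBasic, hr, ← abs_ne_zero, o.abs_minor_eq o' hx, abs_ne_zero]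

theorem Orientation.form_eq (o o' : K.Orientation) {x : V → E3} (hx : K.Nondegenerate x)
    (C : Finset K.Edge) {d : ℕ} (s : Fin d ≃ {e : K.Edge // e ∉ C}) :
    o'.form x C s = o.form x C s := by
  rw [form, form, o.abs_minor_eq o' hx]

end ClosedTriangulation

end

noncomputable section

/-! ### The boundary of a 4-simplex -/

section Simplex

variable {V : Type*} [DecidableEq V]

/-- The vertices of a 4-simplex, as vectors whose sum vanishes. -/
def simplexCoord (a b c d e v : V) : Fin 4 → ℝ :=
  ![(if v = a then 1 else 0) - (if v = e then 1 else 0),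
    (if v = b then 1 else 0) - (if v = e then 1 else 0),
    (if v = c then 1 else 0) - (if v = e then 1 else 0),
    (if v = d then 1 else 0) - (if v = e then 1 else 0)]

/-- The boundary of the 4-simplex `abcde`. -/
def simplexBoundary (a b c d e p q r s : V) : ℝ :=
  Matrix.det (Matrix.of ![simplexCoord a b c d e p, simplexCoord a b c d e q,
    simplexCoord a b c d e r, simplexCoord a b c d e s])

theorem simplexBoundary_isAltChain (a b c d e : V) : IsAltChain (simplexBoundary a b c d e) := by
  have key : ∀ (f : Fin 4 → Fin 4 → ℝ) (i j : Fin 4), i ≠ j →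
      Matrix.det (Matrix.of (f ∘ Equiv.swap i j)) = -Matrix.det (Matrix.of f) :=
    fun f i j h => Matrix.detRowAlternating.map_swap f h
  refine ⟨fun p q r s => ?_, fun p q r s => ?_, fun p q r s => ?_⟩
  · rw [simplexBoundary, simplexBoundary, ← key _ 0 1 (by decide)]
    congr 2; ext i; fin_cases i <;> rfl
  · rw [simplexBoundary, simplexBoundary, ← key _ 1 2 (by decide)]
    congr 2; ext i; fin_cases i <;> rfl
  · rw [simplexBoundary, simplexBoundary, ← key _ 2 3 (by decide)]
    congr 2; ext i; fin_cases i <;> rfl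

/-- The vectors attached to the vertices add up to zero, and the determinant is linear in its last
row. -/
theorem simplexBoundary_isCycle [Fintype V] (a b c d e : V) :
    IsCycle (simplexBoundary a b c d e) := by
  intro p q r
  have h0 : ∑ v, simplexCoord a b c d e v = 0 := by
    ext i
    simp only [simplexCoord, Finset.sum_apply, Pi.zero_apply]
    fin_cases i <;> simp [Finset.sum_sub_distrib]
  have h := (Matrix.detRowAlternating (n := Fin 4) (R := ℝ)).toMultilinearMap.map_update_sum
    (t := (Finset.univ : Finset V)) (i := 3) (g := fun v => simplexCoord a b c d e v)
    (m := ![simplexCoord a b c d e p, simplexCoord a b c d e q, simplexCoord a b c d e r, 0])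
  rw [h0] at h
  have h1 := (Matrix.detRowAlternating (n := Fin 4) (R := ℝ)).toMultilinearMap.map_update_zero
    ![simplexCoord a b c d e p, simplexCoord a b c d e q, simplexCoord a b c d e r, 0] 3
  rw [h1] at h
  rw [h]
  refine Finset.sum_congr rfl fun v _ => ?_
  change Matrix.det _ = Matrix.det _
  congr 1; ext i; fin_cases i <;> rfl

theorem simplexCoord_eq_zero {a b c d e v : V} (h : v ∉ ({a, b, c, d, e} : Finset V)) :
    simplexCoord a b c d e v = 0 := by
  simp only [Finset.mem_insert, Finset.mem_singleton, not_or] at h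
  obtain ⟨h1, h2, h3, h4, h5⟩ := h
  ext i
  fin_cases i <;> simp [simplexCoord, h1, h2, h3, h4, h5]

theorem mem_of_simplexBoundary_ne_zero {a b c d e p q r s : V}
    (h : simplexBoundary a b c d e p q r s ≠ 0) : ({p, q, r, s} : Finset V) ⊆ {a, b, c, d, e} := by
  intro v hv
  by_contra hv'
  apply h
  have h0 := simplexCoord_eq_zero hv'
  have key : ∀ i : Fin 4, ![p, q, r, s] i = v → simplexBoundary a b c d e p q r s = 0 := by
    rintro i rfl
    refine Matrix.det_eq_zero_of_row_eq_zero i fun j => ?_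
    have := congrFun h0 j
    fin_cases i <;> exact this
  simp only [Finset.mem_insert, Finset.mem_singleton] at hv
  rcases hv with rfl | rfl | rfl | rfl
  exacts [key 0 rfl, key 1 rfl, key 2 rfl, key 3 rfl]

theorem IsAltChain.card_eq_four {σ : V → V → V → V → ℝ} (hσ : IsAltChain σ) {p q r s : V}
    (h : σ p q r s ≠ 0) : ({p, q, r, s} : Finset V).card = 4 := by
  have h01 : p ≠ q := by rintro rfl; have := hσ.swap01 p p r s; apply h; linarith
  have h12 : q ≠ r := by rintro rfl; have := hσ.swap12 p q q s; apply h; linarith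
  have h23 : r ≠ s := by rintro rfl; have := hσ.swap23 p q r r; apply h; linarith
  have h02 : p ≠ r := by
    rintro rfl
    have := hσ.swap12 p p q s; have := hσ.swap01 p p q s; apply h; linarith
  have h13 : q ≠ s := by
    rintro rfl
    have := hσ.swap23 p q q r; have := hσ.swap12 p q q r; apply h; linarith
  have h03 : p ≠ s := by
    rintro rfl
    have := hσ.swap01 p q r p; have := hσ.swap12 q p r p; have := hσ.swap23 q r p p
    apply h; linarith
  rw [Finset.card_insert_of_notMem, Finset.card_insert_of_notMem, Finset.card_pair h23] <;>
    simp [*]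

theorem simplexBoundary_values {a b c d e : V} (h : [a, b, c, d, e].Nodup) :
    simplexBoundary a b c d e a b c d = 1 ∧ simplexBoundary a b c d e a b c e = -1 ∧
    simplexBoundary a b c d e a b d e = 1 ∧ simplexBoundary a b c d e b c d e = 1 ∧
    simplexBoundary a b c d e a c d e = -1 := by
  simp only [List.nodup_cons, List.mem_cons, List.not_mem_nil, or_false, not_or,
    List.nodup_nil, not_false_eq_true, and_true] at h
  obtain ⟨⟨hab, hac, had, hae⟩, ⟨hbc, hbd, hbe⟩, ⟨hcd, hce⟩, hde⟩ := h
  refine ⟨?_, ?_, ?_, ?_, ?_⟩ <;>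
  simp [simplexBoundary, simplexCoord, Matrix.det_succ_row_zero, Fin.sum_univ_succ, hab, hac, had,
    hae, hbc, hbd, hbe, hcd, hce, hde, Ne.symm hab, Ne.symm hac, Ne.symm had, Ne.symm hae,
    Ne.symm hbc, Ne.symm hbd, Ne.symm hbe, Ne.symm hcd, Ne.symm hce, Ne.symm hde, Fin.succAbove]

theorem simplexBoundary_cases {a b c d e p q r s : V} (h : [a, b, c, d, e].Nodup)
    (h0 : simplexBoundary a b c d e p q r s ≠ 0) :
    ({p, q, r, s} : Finset V) ∈ ({{a, b, c, d}, {a, b, c, e}, {a, b, d, e}, {b, c, d, e},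
      {a, c, d, e}} : Finset (Finset V)) := by
  have h1 := mem_of_simplexBoundary_ne_zero h0
  have h4 := (simplexBoundary_isAltChain a b c d e).card_eq_four h0
  have h5 : ({a, b, c, d, e} : Finset V).card = 5 := by
    have := List.toFinset_card_of_nodup h
    simpa using this
  have h6 : (({a, b, c, d, e} : Finset V) \ {p, q, r, s}).card = 1 := by
    rw [Finset.card_sdiff_of_subset h1]; omega
  obtain ⟨v, hv⟩ := Finset.card_eq_one.1 h6
  have h7 : ({p, q, r, s} : Finset V) = ({a, b, c, d, e} : Finset V).erase v := by
    rw [← Finset.sdiff_sdiff_eq_self h1, hv, Finset.sdiff_singleton_eq_erase]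
  have hv' : v ∈ ({a, b, c, d, e} : Finset V) := by
    have : v ∈ ({v} : Finset V) := by simp
    rw [← hv] at this
    exact (Finset.mem_sdiff.1 this).1
  simp only [List.nodup_cons, List.mem_cons, List.not_mem_nil, or_false, not_or,
    List.nodup_nil, not_false_eq_true, and_true] at h
  obtain ⟨⟨hab, hac, had, hae⟩, ⟨hbc, hbd, hbe⟩, ⟨hcd, hce⟩, hde⟩ := h
  rw [h7]
  simp only [Finset.mem_insert, Finset.mem_singleton] at hv' ⊢
  rcases hv' with rfl | rfl | rfl | rfl | rfl
  · right; right; right; left; ext; grind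
  · right; right; right; right; ext; grind
  · right; right; left; ext; grind
  · right; left; ext; grind
  · left; ext; grind

end Simplex

/-! ### Chains supported by a 4-simplex -/

section RankOne

variable {V : Type*} [Fintype V] [DecidableEq V] {σ : V → V → V → V → ℝ} {x : V → E3}

/-- The indicator function of a pair of vertices. -/
def pairInd (a b p q : V) : ℝ := if s(p, q) = s(a, b) then 1 else 0

theorem pairInd_comm (a b p q : V) : pairInd a b p q = pairInd a b q p := by
  rw [pairInd, pairInd, Sym2.eq_swap]

/-- Since `rs` is disjoint from `pq`, only the opposite-edge term of `tetForm`, with coefficient 1,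
survives; it occurs for both orderings of `r`, `s`. -/
theorem curv_pairInd_opposite (hσ : IsAltChain σ) {p q r s : V} (hpr : p ≠ r) (hps : p ≠ s)
    (hqr : q ≠ r) (hqs : q ≠ s) (hrs : r ≠ s) :
    curv σ x (pairInd r s) p q = 2 * density σ x p q r s := by
  have h1 : ∀ c, pairInd r s p c = 0 := fun c => if_neg fun h => by
    rcases Sym2.eq_iff.1 h with ⟨h, -⟩ | ⟨h, -⟩ <;> contradiction
  have h2 : ∀ c, pairInd r s q c = 0 := fun c => if_neg fun h => by
    rcases Sym2.eq_iff.1 h with ⟨h, -⟩ | ⟨h, -⟩ <;> contradiction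
  have h3 : ∀ c d, density σ x p q c d * tetForm x (pairInd r s) p q c d =
      (if c = r then if d = s then density σ x p q c d else 0 else 0) +
      (if c = s then if d = r then density σ x p q c d else 0 else 0) := by
    intro c d
    rw [tetForm, h1, h1, h1, h2, h2, pairInd]
    by_cases hc : c = r
    · subst hc
      by_cases hd : d = s <;> simp [hd, hrs]
    · by_cases hc' : c = s
      · subst hc'
        by_cases hd : d = r <;> simp [hd, hrs, Ne.symm hrs]
      · simp [hc, hc']
  simp only [curv, h3, Finset.sum_add_distrib]
  simp [hσ.density_swap23 p q r s]
  ring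

theorem curvForm_pairInd (hσ : IsAltChain σ) {m : V → V → ℝ} (hm : ∀ a b, m a b = m b a) {p q : V}
    (hpq : p ≠ q) : curvForm σ x (pairInd p q) m = 2 * curv σ x m p q := by
  have h3 : ∀ c d, pairInd p q c d * curv σ x m c d =
      (if c = p then if d = q then curv σ x m c d else 0 else 0) +
      (if c = q then if d = p then curv σ x m c d else 0 else 0) := by
    intro c d
    rw [pairInd]
    by_cases hc : c = p
    · subst hc
      by_cases hd : d = q <;> simp [hd, hpq]
    · by_cases hc' : c = q
      · subst hc'
        by_cases hd : d = p <;> simp [hd, hpq, Ne.symm hpq]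
      · simp [hc, hc']
  simp only [curvForm, h3, Finset.sum_add_distrib]
  simp [hσ.curv_comm hm q p]
  ring

theorem curv_pairInd_comm (hσ : IsAltChain σ) {p q r s : V} (hpq : p ≠ q) (hrs : r ≠ s) :
    curv σ x (pairInd r s) p q = curv σ x (pairInd p q) r s := by
  have h1 := curvForm_pairInd (x := x) hσ (pairInd_comm r s) hpq
  have h2 := curvForm_pairInd (x := x) hσ (pairInd_comm p q) hrs
  rw [hσ.curvForm_comm (pairInd_comm p q) (pairInd_comm r s)] at h1
  linarith

theorem stretch_self (a a' : E3) : stretch a a a' a' = 0 := by simp [stretch]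

theorem stretch_comm (a b a' b' : E3) : stretch a b a' b' = stretch b a b' a' := by
  simp only [stretch_eq]; ring

/-- The variations of the defect angles of a cycle supported by a 4-simplex are all proportional
to each other. -/
theorem IsCycle.exists_curv_eq_mul (hσ : IsAltChain σ) (hc : IsCycle σ) (hp : IsPlaced σ x)
    {a b c d e : V} (h : [a, b, c, d, e].Nodup)
    (hs : ∀ p q r s, σ p q r s ≠ 0 → ({p, q, r, s} : Finset V) ⊆ {a, b, c, d, e})
    (hd : vol4 x a b c d ≠ 0) (he : vol4 x a b c e ≠ 0)
    {m : V → V → ℝ} (hm : ∀ p q, m p q = m q p) (hm0 : ∀ p, m p p = 0) :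
    ∃ t, ∀ p q, x p ≠ x q → curv σ x m p q = t * curv σ x (pairInd d e) p q := by
  simp only [List.nodup_cons, List.mem_cons, List.not_mem_nil, or_false, not_or,
    List.nodup_nil, not_false_eq_true, and_true] at h
  obtain ⟨⟨hab, hac, had, hae⟩, ⟨hbc, hbd, hbe⟩, ⟨hcd, hce⟩, hde⟩ := h
  -- Velocities of the five vertices realize the nine rates other than that of `de`: six through
  -- `abcd`, then three by placing `e` over `abc`. The difference from `m` is supported on `de`, and
  -- motions have no curvature.
  obtain ⟨a', b', c', d', h1, h2, h3, h4, h5, h6⟩ := exists_velocities hd (m a b) (m a c) (m a d)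
    (m b c) (m b d) (m c d)
  obtain ⟨e', h7, h8, h9⟩ := exists_velocity_fourth he a' b' c' (m a e) (m b e) (m c e)
  obtain ⟨y, ya, yb, yc, yd, ye⟩ : ∃ y : V → E3, y a = a' ∧ y b = b' ∧ y c = c' ∧ y d = d' ∧
      y e = e' := by
    refine ⟨fun v => if v = a then a' else if v = b then b' else if v = c then c' else
      if v = d then d' else e', ?_, ?_, ?_, ?_, ?_⟩ <;>
    simp [Ne.symm hab, Ne.symm hac, Ne.symm had, Ne.symm hae, Ne.symm hbc, Ne.symm hbd,
      Ne.symm hbe, Ne.symm hcd, Ne.symm hce, Ne.symm hde]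
  obtain ⟨n, hn⟩ : ∃ n : V → V → ℝ, n = fun p q => m p q - stretch (x p) (x q) (y p) (y q) :=
    ⟨_, rfl⟩
  have hnc : ∀ p q, n p q = n q p := by
    intro p q; rw [hn]; simp only; rw [hm, stretch_comm]
  have hn0 : ∀ p, n p p = 0 := by
    intro p; rw [hn]; simp only; rw [hm0, stretch_self, sub_zero]
  have n1 : n a b = 0 := by rw [hn]; simp only; rw [ya, yb, h1, sub_self]
  have n2 : n a c = 0 := by rw [hn]; simp only; rw [ya, yc, h2, sub_self]
  have n3 : n a d = 0 := by rw [hn]; simp only; rw [ya, yd, h3, sub_self]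
  have n4 : n b c = 0 := by rw [hn]; simp only; rw [yb, yc, h4, sub_self]
  have n5 : n b d = 0 := by rw [hn]; simp only; rw [yb, yd, h5, sub_self]
  have n6 : n c d = 0 := by rw [hn]; simp only; rw [yc, yd, h6, sub_self]
  have n7 : n a e = 0 := by rw [hn]; simp only; rw [ya, ye, h7, sub_self]
  have n8 : n b e = 0 := by rw [hn]; simp only; rw [yb, ye, h8, sub_self]
  have n9 : n c e = 0 := by rw [hn]; simp only; rw [yc, ye, h9, sub_self]
  have hS : ∀ p ∈ ({a, b, c, d, e} : Finset V), ∀ q ∈ ({a, b, c, d, e} : Finset V),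
      n p q = n d e * pairInd d e p q := by
    intro p hp q hq
    simp only [Finset.mem_insert, Finset.mem_singleton] at hp hq
    have h0 : p = d ∧ q = e ∨ p = e ∧ q = d → n p q = n d e := by
      rintro (⟨rfl, rfl⟩ | ⟨rfl, rfl⟩)
      exacts [rfl, hnc _ _]
    by_cases hpq : p = d ∧ q = e ∨ p = e ∧ q = d
    · rw [h0 hpq, pairInd, if_pos (Sym2.eq_iff.2 hpq), mul_one]
    · rw [pairInd, if_neg (fun h => hpq (Sym2.eq_iff.1 h)), mul_zero]
      rcases hp with hp | hp | hp | hp | hp <;> rcases hq with hq | hq | hq | hq | hq <;>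
      rw [hp, hq] <;> first
        | exact hn0 _
        | assumption
        | (rw [hnc]; assumption)
        | exact (hpq (Or.inl ⟨hp, hq⟩)).elim
        | exact (hpq (Or.inr ⟨hp, hq⟩)).elim
  refine ⟨n d e, fun p q hpq => ?_⟩
  have h10 := hc.curv_stretch hσ hp y p q hpq
  have h11 := curv_add σ x n (fun p q => stretch (x p) (x q) (y p) (y q)) p q
  rw [h10, add_zero] at h11
  have h12 : (fun p q => n p q + stretch (x p) (x q) (y p) (y q)) = m := by
    rw [hn]; ext; simp
  rw [h12] at h11
  rw [h11, ← curv_smul]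
  refine curv_congr fun r s h0 => ?_
  have hsub := hs _ _ _ _ h0
  have hp' := hsub (show p ∈ ({p, q, r, s} : Finset V) by simp)
  have hq' := hsub (show q ∈ ({p, q, r, s} : Finset V) by simp)
  have hr' := hsub (show r ∈ ({p, q, r, s} : Finset V) by simp)
  have hs' := hsub (show s ∈ ({p, q, r, s} : Finset V) by simp)
  exact ⟨hS _ hp' _ hq', hS _ hp' _ hr', hS _ hp' _ hs', hS _ hq' _ hr', hS _ hq' _ hs',
    hS _ hr' _ hs'⟩

/-- The variation of the defect angle at the edge `de` of a cycle supported by the 4-simplex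
`abcde`, when only the length of this edge changes. -/
theorem IsCycle.curv_pairInd_self (hσ : IsAltChain σ) (hc : IsCycle σ) (hp : IsPlaced σ x)
    {a b c d e : V} (h : [a, b, c, d, e].Nodup)
    (hs : ∀ p q r s, σ p q r s ≠ 0 → ({p, q, r, s} : Finset V) ⊆ {a, b, c, d, e})
    (hd : vol4 x a b c d ≠ 0) (he : vol4 x a b c e ≠ 0) (hde : x d ≠ x e) :
    curv σ x (pairInd d e) d e * (density σ x a b c d * density σ x a b c e) =
      2 * (density σ x a b d e * density σ x b c d e * density σ x a c d e) := by
  have key : ∀ r s, r ≠ s → ∃ t, ∀ p q, x p ≠ x q →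
      curv σ x (pairInd r s) p q = t * curv σ x (pairInd d e) p q := fun r s hrs =>
    hc.exists_curv_eq_mul hσ hp h hs hd he (pairInd_comm r s) fun p => if_neg fun h => by
      rcases Sym2.eq_iff.1 h with ⟨h1, h2⟩ | ⟨h1, h2⟩
      · exact hrs (h1.symm.trans h2)
      · exact hrs (h2.symm.trans h1)
  simp only [List.nodup_cons, List.mem_cons, List.not_mem_nil, or_false, not_or,
    List.nodup_nil, not_false_eq_true, and_true] at h
  obtain ⟨⟨nab, nac, nad, nae⟩, ⟨nbc, nbd, nbe⟩, ⟨ncd, nce⟩, nde⟩ := h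
  have xab : x a ≠ x b := by
    intro h; apply hd; rw [vol4, h, signedSixVol_eq]; ring
  have xbc : x b ≠ x c := by
    intro h; apply hd; rw [vol4, h, signedSixVol_eq]; ring
  have xce : x c ≠ x e := by
    intro h; apply he; rw [vol4, h, signedSixVol_eq]; ring
  -- If a symmetric matrix Q of rank one is indexed by edges, then Q(de,de) Q(ad,bc) Q(ce,ab) =
  -- Q(ab,de) Q(bc,de) Q(ad,ce). All entries except the first are at opposite edges, so they equal
  -- twice the densities of the five tetrahedra.
  obtain ⟨tab, hab⟩ := key a b nab
  obtain ⟨tbc, hbc⟩ := key b c nbc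
  obtain ⟨tad, had⟩ := key a d nad
  obtain ⟨tce, hce⟩ := key c e nce
  obtain ⟨R, hR⟩ : ∃ R, R = curv σ x (pairInd d e) d e := ⟨_, rfl⟩
  have sab := curv_pairInd_comm (x := x) hσ nab nde
  have sbc := curv_pairInd_comm (x := x) hσ nbc nde
  have sce := curv_pairInd_comm (x := x) hσ nce nde
  rw [hab d e hde, ← hR] at sab
  rw [hbc d e hde, ← hR] at sbc
  rw [hce d e hde, ← hR] at sce
  have o1 := curv_pairInd_opposite (x := x) hσ nad nae nbd nbe nde
  have o2 := curv_pairInd_opposite (x := x) hσ nbd nbe ncd nce nde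
  have o3 := curv_pairInd_opposite (x := x) hσ (Ne.symm nac) ncd (Ne.symm nae) (Ne.symm nde) nad
  have o4 := curv_pairInd_opposite (x := x) hσ nac nae nbc nbe nce
  have o5 := curv_pairInd_opposite (x := x) hσ (Ne.symm nab) nbd (Ne.symm nac) ncd nad
  rw [sab] at o1
  rw [sbc] at o2
  rw [had c e xce, sce] at o3
  rw [hce a b xab, sab] at o4
  rw [had b c xbc, sbc] at o5
  have d3 : density σ x c e a d = density σ x a c d e := by
    rw [hσ.density_swap12 c a, hσ.density_swap01 a c, hσ.density_swap23]
  have d5 : density σ x b c a d = density σ x a b c d := by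
    rw [hσ.density_swap12 b a, hσ.density_swap01 a b]
  rw [d3] at o3
  rw [d5] at o5
  rw [← hR]
  have e1 : density σ x a b d e = tab * R / 2 := by linarith
  have e2 : density σ x b c d e = tbc * R / 2 := by linarith
  have e3 : density σ x a c d e = tad * (tce * R) / 2 := by linarith
  have e4 : density σ x a b c e = tce * (tab * R) / 2 := by linarith
  have e5 : density σ x a b c d = tad * (tbc * R) / 2 := by linarith
  rw [e1, e2, e3, e4, e5]; ring

end RankOne

end

noncomputable section

/-! ### Pachner moves -/

section Chains

variable {V : Type*} [Fintype V]

theorem curv_chain_add (σ τ : V → V → V → V → ℝ) (x : V → E3) (m : V → V → ℝ) (a b : V) :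
    curv (fun p q r s => σ p q r s + τ p q r s) x m a b = curv σ x m a b + curv τ x m a b := by
  simp only [curv, density, ← Finset.sum_add_distrib, add_div, add_mul]

theorem curv_chain_smul (t : ℝ) (σ : V → V → V → V → ℝ) (x : V → E3) (m : V → V → ℝ) (a b : V) :
    curv (fun p q r s => t * σ p q r s) x m a b = t * curv σ x m a b := by
  simp only [curv, density, Finset.mul_sum, mul_div_assoc, mul_assoc]

theorem IsCycle.add {σ τ : V → V → V → V → ℝ} (hσ : IsCycle σ) (hτ : IsCycle τ) :
    IsCycle (fun a b c d => σ a b c d + τ a b c d) := by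
  intro a b c
  rw [Finset.sum_add_distrib, hσ, hτ, add_zero]

theorem IsCycle.smul {σ : V → V → V → V → ℝ} (hσ : IsCycle σ) (t : ℝ) :
    IsCycle (fun a b c d => t * σ a b c d) := by
  intro a b c
  rw [← Finset.mul_sum, hσ, mul_zero]

end Chains

namespace ClosedTriangulation

variable {V : Type*} [Fintype V] [DecidableEq V] {K K' : ClosedTriangulation V}

/-- The `2 → 3` Pachner move which introduces the edge `de` across the triangle `abc`. -/
def IsPachnerAt (K K' : ClosedTriangulation V) (a b c d e : V) : Prop :=
  d ≠ e ∧ ({a, b, c, d} : Finset V) ∈ K.tets ∧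
    ({a, b, c, e} : Finset V) ∈ K.tets ∧ s(d, e) ∉ K.edges ∧
    K'.tets = (K.tets \ {{a, b, c, d}, {a, b, c, e}}) ∪
      {{a, b, d, e}, {b, c, d, e}, {a, c, d, e}}

namespace IsPachnerAt

variable {a b c d e : V} (h : K.IsPachnerAt K' a b c d e)
include h

theorem nodup : [a, b, c, d, e].Nodup := by
  obtain ⟨hde, h1, h2, -⟩ := h
  obtain ⟨hab, hac, had, hbc, hbd, hcd⟩ := ne_of_mem_tets h1
  obtain ⟨-, -, hae, -, hbe, hce⟩ := ne_of_mem_tets h2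
  simp [*]

theorem new_mem : ({a, b, d, e} : Finset V) ∈ K'.tets ∧ ({b, c, d, e} : Finset V) ∈ K'.tets ∧
    ({a, c, d, e} : Finset V) ∈ K'.tets := by
  rw [h.2.2.2.2]; simp

theorem notMem_of_mem {T : Finset V} (hd : d ∈ T) (he : e ∈ T) : T ∉ K.tets := fun hT =>
  h.2.2.2.1 (K.mem_edges.2 ⟨h.1, T, hT, hd, he⟩)

theorem mem_edges_iff {f : Sym2 V} : f ∈ K'.edges ↔ f ∈ K.edges ∨ f = s(d, e) := by
  obtain ⟨n1, n2, n3⟩ := h.new_mem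
  obtain ⟨ab, ad, ae, bd, be, de⟩ := mem_edges_of_tet n1
  obtain ⟨bc, -, -, cd, ce, -⟩ := mem_edges_of_tet n2
  obtain ⟨ac, -, -, -, -, -⟩ := mem_edges_of_tet n3
  obtain ⟨ab', ac', ad', bc', bd', cd'⟩ := mem_edges_of_tet h.2.1
  obtain ⟨-, -, ae', -, be', ce'⟩ := mem_edges_of_tet h.2.2.1
  induction f using Sym2.ind with
  | _ p q =>
  constructor
  · intro hf
    obtain ⟨hpq, T, hT, hp, hq⟩ := K'.mem_edges.1 hf
    by_cases hT' : T ∈ K.tets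
    · exact Or.inl (K.mem_edges.2 ⟨hpq, T, hT', hp, hq⟩)
    · rw [h.2.2.2.2] at hT
      simp only [Finset.mem_union, Finset.mem_sdiff, hT', false_and, false_or,
        Finset.mem_insert, Finset.mem_singleton] at hT
      have hs : ∀ {r t : V}, s(r, t) ∈ K.edges → s(t, r) ∈ K.edges := fun h => Sym2.eq_swap ▸ h
      rcases hT with rfl | rfl | rfl <;>
      simp only [Finset.mem_insert, Finset.mem_singleton] at hp hq <;>
      rcases hp with rfl | rfl | rfl | rfl <;> rcases hq with rfl | rfl | rfl | rfl <;>
      first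
        | exact absurd rfl hpq
        | exact Or.inr rfl
        | exact Or.inr Sym2.eq_swap
        | exact Or.inl (by assumption)
        | exact Or.inl (hs (by assumption))
  · rintro (hf | hf)
    · obtain ⟨hpq, T, hT, hp, hq⟩ := K.mem_edges.1 hf
      by_cases hT' : T ∈ K'.tets
      · exact K'.mem_edges.2 ⟨hpq, T, hT', hp, hq⟩
      · rw [h.2.2.2.2] at hT'
        simp only [Finset.mem_union, Finset.mem_sdiff, hT, true_and, not_or, not_not] at hT'
        have hT'' := hT'.1
        simp only [Finset.mem_insert, Finset.mem_singleton] at hT''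
        have hs : ∀ {r t : V}, s(r, t) ∈ K'.edges → s(t, r) ∈ K'.edges := fun h => Sym2.eq_swap ▸ h
        clear hT' ab' ac' ad' bc' bd' cd' ae' be' ce'
        rcases hT'' with rfl | rfl <;>
        simp only [Finset.mem_insert, Finset.mem_singleton] at hp hq <;>
        rcases hp with rfl | rfl | rfl | rfl <;> rcases hq with rfl | rfl | rfl | rfl <;>
        first
          | exact absurd rfl hpq
          | assumption
          | exact hs (by assumption)
    · rw [hf]; exact de

theorem edges_subset : K.edges ⊆ K'.edges := fun _ hf => h.mem_edges_iff.2 (Or.inl hf)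

theorem new_edge : s(d, e) ∈ K'.edges := h.mem_edges_iff.2 (Or.inr rfl)

theorem simplexBoundary_placed {x : V → E3} (hx : K.Nondegenerate x) (hx' : K'.Nondegenerate x) :
    IsPlaced (simplexBoundary a b c d e) x := by
  intro p q r s h0
  have h1 := simplexBoundary_cases h.nodup h0
  obtain ⟨n1, n2, n3⟩ := h.new_mem
  simp only [Finset.mem_insert, Finset.mem_singleton] at h1
  rcases h1 with h1 | h1 | h1 | h1 | h1
  · exact hx.vol4_ne_zero (h1 ▸ h.2.1)
  · exact hx.vol4_ne_zero (h1 ▸ h.2.2.1)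
  · exact hx'.vol4_ne_zero (h1 ▸ n1)
  · exact hx'.vol4_ne_zero (h1 ▸ n2)
  · exact hx'.vol4_ne_zero (h1 ▸ n3)

theorem chain_eq_zero (o : K.Orientation) {p q r s : V} (hd : d ∈ ({p, q, r, s} : Finset V))
    (he : e ∈ ({p, q, r, s} : Finset V)) : o.chain p q r s = 0 := by
  by_contra h0
  exact h.notMem_of_mem hd he (o.chain_ne_zero_iff.1 h0)

omit h in
/-- The chain which results from a Pachner move. -/
def movedChain (o : K.Orientation) (a b c d e p q r s : V) : ℝ :=
  o.chain p q r s + -o.chain a b c d * simplexBoundary a b c d e p q r s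

omit h in
theorem movedChain_isAltChain (o : K.Orientation) (a b c d e : V) :
    IsAltChain (movedChain o a b c d e) :=
  o.isAltChain.add ((simplexBoundary_isAltChain a b c d e).smul _)

omit h in
theorem movedChain_isCycle (o : K.Orientation) (a b c d e : V) :
    IsCycle (movedChain o a b c d e) :=
  o.isCycle.add ((simplexBoundary_isCycle a b c d e).smul _)

/-- Subtracting the boundary of `abcde` with the coefficient `o.chain a b c d` cancels both old
tetrahedra and gives the three new ones values ±1, because none of these contained `de` before. -/
theorem movedChain_spec (o : K.Orientation) (p q r s : V) :
    (({p, q, r, s} : Finset V) ∈ K'.tets →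
      movedChain o a b c d e p q r s = 1 ∨ movedChain o a b c d e p q r s = -1) ∧
    (({p, q, r, s} : Finset V) ∉ K'.tets → movedChain o a b c d e p q r s = 0) := by
  obtain ⟨v1, v2, v3, v4, v5⟩ := simplexBoundary_values h.nodup
  have m1 : movedChain o a b c d e a b c d = 0 := by rw [movedChain, v1]; ring
  have m2 : movedChain o a b c d e a b c e = 0 := by
    have := o.consistent a b c d e h.1 h.2.1 h.2.2.1
    rw [movedChain, v2, Orientation.chain, Orientation.chain, if_pos h.2.1, if_pos h.2.2.1, this]
    simp
  have m3 : movedChain o a b c d e a b d e = -o.chain a b c d := by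
    rw [movedChain, v3, h.chain_eq_zero o (by simp) (by simp)]; ring
  have m4 : movedChain o a b c d e b c d e = -o.chain a b c d := by
    rw [movedChain, v4, h.chain_eq_zero o (by simp) (by simp)]; ring
  have m5 : movedChain o a b c d e a c d e = o.chain a b c d := by
    rw [movedChain, v5, h.chain_eq_zero o (by simp) (by simp)]; ring
  have h1 := o.chain_eq_one_or h.2.1
  have hold : ∀ T, T ∈ ({{a, b, c, d}, {a, b, c, e}} : Finset (Finset V)) → T ∉ K'.tets := by
    intro T hT hT'
    rw [h.2.2.2.2] at hT'
    simp only [Finset.mem_union, Finset.mem_sdiff, hT, not_true_eq_false, and_false, false_or] at hT'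
    have hTK : T ∈ K.tets := by
      simp only [Finset.mem_insert, Finset.mem_singleton] at hT
      rcases hT with rfl | rfl
      exacts [h.2.1, h.2.2.1]
    simp only [Finset.mem_insert, Finset.mem_singleton] at hT'
    rcases hT' with rfl | rfl | rfl <;> exact h.notMem_of_mem (by simp) (by simp) hTK
  have hsame : ∀ {i j k l : V}, ({i, j, k, l} : Finset V) ∈ K.tets ∨
      ({i, j, k, l} : Finset V) ∈ K'.tets → ({i, j, k, l} : Finset V) = {p, q, r, s} →
      ∃ t : ℝ, (t = 1 ∨ t = -1) ∧
        movedChain o a b c d e p q r s = t * movedChain o a b c d e i j k l := by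
    intro i j k l hT hT'
    obtain ⟨t, ht, h2⟩ := IsAltChain.eq_or_eq_neg hT' (hT.elim (K.card_tet _) (K'.card_tet _))
    exact ⟨t, ht, h2 (movedChain_isAltChain o a b c d e)⟩
  obtain ⟨n1, n2, n3⟩ := h.new_mem
  by_cases hT : ({p, q, r, s} : Finset V) ∈ ({{a, b, c, d}, {a, b, c, e}, {a, b, d, e},
      {b, c, d, e}, {a, c, d, e}} : Finset (Finset V))
  · simp only [Finset.mem_insert, Finset.mem_singleton] at hT
    rcases hT with hT | hT | hT | hT | hT
    · refine ⟨fun h' => absurd h' (hold _ (by rw [hT]; simp)), fun _ => ?_⟩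
      obtain ⟨t, -, h2⟩ := hsame (Or.inl h.2.1) hT.symm
      rw [h2, m1, mul_zero]
    · refine ⟨fun h' => absurd h' (hold _ (by rw [hT]; simp)), fun _ => ?_⟩
      obtain ⟨t, -, h2⟩ := hsame (Or.inl h.2.2.1) hT.symm
      rw [h2, m2, mul_zero]
    · refine ⟨fun _ => ?_, fun h' => absurd (hT ▸ n1) h'⟩
      obtain ⟨t, ht, h2⟩ := hsame (Or.inr n1) hT.symm
      rw [h2, m3]
      rcases h1 with h1 | h1 <;> rcases ht with ht | ht <;> rw [h1, ht] <;> norm_num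
    · refine ⟨fun _ => ?_, fun h' => absurd (hT ▸ n2) h'⟩
      obtain ⟨t, ht, h2⟩ := hsame (Or.inr n2) hT.symm
      rw [h2, m4]
      rcases h1 with h1 | h1 <;> rcases ht with ht | ht <;> rw [h1, ht] <;> norm_num
    · refine ⟨fun _ => ?_, fun h' => absurd (hT ▸ n3) h'⟩
      obtain ⟨t, ht, h2⟩ := hsame (Or.inr n3) hT.symm
      rw [h2, m5]
      rcases h1 with h1 | h1 <;> rcases ht with ht | ht <;> rw [h1, ht] <;> norm_num
  · have h0 : simplexBoundary a b c d e p q r s = 0 := by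
      by_contra h0; exact hT (simplexBoundary_cases h.nodup h0)
    have hiff : ({p, q, r, s} : Finset V) ∈ K'.tets ↔ ({p, q, r, s} : Finset V) ∈ K.tets := by
      rw [h.2.2.2.2]
      simp only [Finset.mem_union, Finset.mem_sdiff, Finset.mem_insert, Finset.mem_singleton] at hT ⊢
      tauto
    rw [movedChain, h0, mul_zero, add_zero, hiff]
    refine ⟨o.chain_eq_one_or, fun h' => ?_⟩
    by_contra h2
    exact h' (o.chain_ne_zero_iff.1 h2)

/-- The orientation which results from a Pachner move. -/
def orientation (o : K.Orientation) : K'.Orientation :=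
  Orientation.ofChain (movedChain o a b c d e) (movedChain_isAltChain o a b c d e)
    (movedChain_isCycle o a b c d e)
    (fun p q r s h0 => by_contra fun h1 => h0 ((h.movedChain_spec o p q r s).2 h1))
    (fun p q r s => (h.movedChain_spec o p q r s).1)

theorem chain_orientation (o : K.Orientation) :
    (h.orientation o).chain = movedChain o a b c d e :=
  Orientation.chain_ofChain _ _ _ _

omit h in
theorem curv_movedChain (o : K.Orientation) (x : V → E3) (m : V → V → ℝ) (a b c d e p q : V) :
    curv (movedChain o a b c d e) x m p q = curv o.chain x m p q +
      -o.chain a b c d * curv (simplexBoundary a b c d e) x m p q := by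
  rw [← curv_chain_smul, ← curv_chain_add]; rfl

theorem curv_chain_new (o : K.Orientation) (x : V → E3) (m : V → V → ℝ) :
    curv o.chain x m d e = 0 := by
  refine Finset.sum_eq_zero fun p _ => Finset.sum_eq_zero fun q _ => ?_
  rw [density, h.chain_eq_zero o (by simp) (by simp), zero_div, zero_mul]

theorem exists_curv_eq_mul {x : V → E3} (hx : K.Nondegenerate x) (hx' : K'.Nondegenerate x)
    {m : V → V → ℝ} (hm : ∀ p q, m p q = m q p) (hm0 : ∀ p, m p p = 0) :
    ∃ t, ∀ p q, x p ≠ x q → curv (simplexBoundary a b c d e) x m p q =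
      t * curv (simplexBoundary a b c d e) x (pairInd d e) p q :=
  (simplexBoundary_isCycle a b c d e).exists_curv_eq_mul (simplexBoundary_isAltChain a b c d e)
    (h.simplexBoundary_placed hx hx') h.nodup (fun _ _ _ _ => mem_of_simplexBoundary_ne_zero)
    (hx.vol4_ne_zero h.2.1) (hx.vol4_ne_zero h.2.2.1) hm hm0

/-- The densities are ±1 over the signed volumes, so the general relation becomes the ratio of old
to new volumes that the form needs. -/
theorem curv_pairInd_self {x : V → E3} (hx : K.Nondegenerate x) (hx' : K'.Nondegenerate x) :
    |curv (simplexBoundary a b c d e) x (pairInd d e) d e| *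
      (|vol4 x a b d e| * |vol4 x b c d e| * |vol4 x a c d e|) =
        2 * (|vol4 x a b c d| * |vol4 x a b c e|) := by
  have key := (simplexBoundary_isCycle a b c d e).curv_pairInd_self
    (simplexBoundary_isAltChain a b c d e)
    (h.simplexBoundary_placed hx hx') h.nodup (fun _ _ _ _ => mem_of_simplexBoundary_ne_zero)
    (hx.vol4_ne_zero h.2.1) (hx.vol4_ne_zero h.2.2.1) (hx'.ne_of_edge h.new_edge)
  obtain ⟨v1, v2, v3, v4, v5⟩ := simplexBoundary_values h.nodup
  obtain ⟨n1, n2, n3⟩ := h.new_mem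
  have k1 := hx.vol4_ne_zero h.2.1
  have k2 := hx.vol4_ne_zero h.2.2.1
  have k3 := hx'.vol4_ne_zero n1
  have k4 := hx'.vol4_ne_zero n2
  have k5 := hx'.vol4_ne_zero n3
  simp only [density, v1, v2, v3, v4, v5] at key
  rw [← abs_mul, ← abs_mul, ← abs_mul, ← abs_mul, ← abs_two, ← abs_mul]
  congr 1
  field_simp at key
  linarith

theorem curv_pairInd_self_ne_zero {x : V → E3} (hx : K.Nondegenerate x)
    (hx' : K'.Nondegenerate x) :
    curv (simplexBoundary a b c d e) x (pairInd d e) d e ≠ 0 := by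
  intro h0
  have := h.curv_pairInd_self hx hx'
  rw [h0, abs_zero, zero_mul] at this
  have k1 := abs_pos.2 (hx.vol4_ne_zero h.2.1)
  have k2 := abs_pos.2 (hx.vol4_ne_zero h.2.2.1)
  have := mul_pos k1 k2
  linarith

theorem agree_sqRate {w : K.Edge → ℝ} {w' : K'.Edge → ℝ} (ha : K.Agree K' w w') (x : V → E3)
    {p q : V} (hpq : s(p, q) ∈ K.edges) : K.sqRate x w p q = K'.sqRate x w' p q := by
  have h' := h.edges_subset hpq
  rw [sqRate, sqRate, len_lengthMap hpq, len_lengthMap h', len, len, dif_pos hpq, dif_pos h',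
    ha _ hpq h']

theorem agree_curv {w : K.Edge → ℝ} {w' : K'.Edge → ℝ} (ha : K.Agree K' w w') (o : K.Orientation)
    (x : V → E3) (p q : V) :
    curv o.chain x (K.sqRate x w) p q = curv o.chain x (K'.sqRate x w') p q := by
  refine curv_congr fun r s h0 => ?_
  obtain ⟨h1, h2, h3, h4, h5, h6⟩ := mem_edges_of_tet (o.chain_ne_zero_iff.1 h0)
  exact ⟨h.agree_sqRate ha x h1, h.agree_sqRate ha x h2, h.agree_sqRate ha x h3,
    h.agree_sqRate ha x h4, h.agree_sqRate ha x h5, h.agree_sqRate ha x h6⟩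

omit h in
theorem sqRate_self (x : V → E3) (w : K.Edge → ℝ) (p : V) : K.sqRate x w p p = 0 := by
  rw [sqRate, len_eq_zero _ (fun h => (K.mem_edges.1 h).1 rfl), zero_mul]

/-- Flatness after a Pachner move. -/
theorem mem_flat_iff (o : K.Orientation) {x : V → E3} (hx : K.Nondegenerate x)
    (hx' : K'.Nondegenerate x) {w : K.Edge → ℝ} {w' : K'.Edge → ℝ} (ha : K.Agree K' w w') :
    w' ∈ (h.orientation o).flat x ↔ w ∈ o.flat x ∧
      curv (simplexBoundary a b c d e) x (K'.sqRate x w') d e = 0 := by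
  rw [Orientation.mem_flat _ hx', Orientation.mem_flat _ hx, h.chain_orientation]
  simp only [curv_movedChain]
  -- By the rank-one property the contribution of the 4-simplex vanishes at all edges as soon as it
  -- vanishes at `de`; and at `de` it is the only contribution.
  obtain ⟨t, ht⟩ := h.exists_curv_eq_mul hx hx' (sqRate_comm x w') (sqRate_self x w')
  have h0 := h.curv_pairInd_self_ne_zero hx hx'
  have hs : o.chain a b c d ≠ 0 := o.chain_ne_zero_iff.2 h.2.1
  have hde := hx'.ne_of_edge h.new_edge
  constructor
  · intro h1
    have h2 := h1 d e h.new_edge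
    rw [h.curv_chain_new, zero_add, neg_mul, neg_eq_zero] at h2
    have h3 := (mul_eq_zero.1 h2).resolve_left hs
    refine ⟨fun p q hpq => ?_, h3⟩
    rw [ht d e hde] at h3
    have h4 := (mul_eq_zero.1 h3).resolve_right h0
    have h5 := h1 p q (h.edges_subset hpq)
    rw [ht p q (hx.ne_of_edge hpq), h4, zero_mul, mul_zero, add_zero] at h5
    rw [h.agree_curv ha, h5]
  · rintro ⟨h1, h3⟩ p q hpq
    have h3' := h3
    rw [ht d e hde] at h3
    have h4 := (mul_eq_zero.1 h3).resolve_right h0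
    rw [ht p q (hx'.ne_of_edge hpq), h4, zero_mul, mul_zero, add_zero]
    rcases h.mem_edges_iff.1 hpq with hpq | hpq
    · rw [← h.agree_curv ha, h1 p q hpq]
    · rcases Sym2.eq_iff.1 hpq with ⟨rfl, rfl⟩ | ⟨rfl, rfl⟩
      · exact h.curv_chain_new o x _
      · rw [o.isAltChain.curv_comm (sqRate_comm x w')]
        exact h.curv_chain_new o x _

end IsPachnerAt

end ClosedTriangulation

end

noncomputable section

/-! ### Values of the forms -/

section Determinants

/-- In the Schur complement of the corner entry, the rank-one part of the remaining block cancels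
exactly and `M` is left. -/
theorem det_rank_one_extension {E E' : Type*} [Fintype E] [DecidableEq E] [Fintype E']
    [DecidableEq E'] (φ : E ⊕ Unit ≃ E') (M : Matrix E E ℝ) (B N : Matrix E' E' ℝ)
    (hB : ∀ j k, B j k * B (φ (.inr ())) (φ (.inr ())) = B j (φ (.inr ())) * B (φ (.inr ())) k)
    (hB0 : B (φ (.inr ())) (φ (.inr ())) ≠ 0)
    (hN : ∀ i j, N (φ (.inl i)) (φ (.inl j)) = M i j + B (φ (.inl i)) (φ (.inl j)))
    (hl : ∀ j, N (φ (.inr ())) j = B (φ (.inr ())) j)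
    (hr : ∀ j, N j (φ (.inr ())) = B j (φ (.inr ()))) :
    N.det = B (φ (.inr ())) (φ (.inr ())) * M.det := by
  rw [← Matrix.det_submatrix_equiv_self φ N]
  generalize hz : φ (.inr ()) = z at *
  let D : Matrix Unit Unit ℝ := Matrix.of fun _ _ => B z z
  let _ : Invertible D := ⟨Matrix.of fun _ _ => (B z z)⁻¹, by ext i j; simp [D, Matrix.mul_apply, hB0],
    by ext i j; simp [D, Matrix.mul_apply, hB0]⟩
  have e1 : N.submatrix φ φ = Matrix.fromBlocks
      (Matrix.of fun i j => M i j + B (φ (.inl i)) (φ (.inl j)))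
      (Matrix.of fun i _ => B (φ (.inl i)) z) (Matrix.of fun _ j => B z (φ (.inl j))) D := by
    ext i j
    rcases i with i | ⟨⟩ <;> rcases j with j | ⟨⟩ <;> simp [D, hN, hl, hr, hz]
  rw [e1, Matrix.det_fromBlocks₂₂]
  congr 1
  · simp [D]
  · congr 1
    ext i j
    have : (⅟D : Matrix Unit Unit ℝ) = Matrix.of fun _ _ => (B z z)⁻¹ := rfl
    rw [this, Matrix.sub_apply, Matrix.mul_apply]
    simp only [Matrix.mul_apply, Matrix.of_apply, Finset.univ_unique, Finset.sum_singleton]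
    have := hB (φ (.inl i)) (φ (.inl j))
    field_simp
    linarith

open Matrix in
theorem exists_left_inverse_of_linearIndependent {E : Type*} [Fintype E] {d : ℕ}
    {w : Fin d → E → ℝ} (hw : LinearIndependent ℝ w) :
    ∃ L : Matrix (Fin d) E ℝ, L * (Matrix.of fun e i => w i e) = 1 := by
  classical
  have h1 : Function.Injective (Matrix.of fun e i => w i e : Matrix E (Fin d) ℝ).mulVec :=
    Matrix.mulVec_injective_iff.2 hw
  obtain ⟨g, hg⟩ := LinearMap.exists_leftInverse_of_injective
    (Matrix.toLin' (Matrix.of fun e i => w i e : Matrix E (Fin d) ℝ)) (LinearMap.ker_eq_bot.2 h1)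
  refine ⟨LinearMap.toMatrix' g, ?_⟩
  have := congrArg LinearMap.toMatrix' hg
  rwa [LinearMap.toMatrix'_comp, LinearMap.toMatrix'_toLin', LinearMap.toMatrix'_id] at this

end Determinants

namespace ClosedTriangulation

variable {V : Type*} [Fintype V] [DecidableEq V] {K K' : ClosedTriangulation V}

theorem Nondegenerate.sixVol_pos {x : V → E3} (hx : K.Nondegenerate x) (T : {T // T ∈ K.tets}) :
    0 < K.sixVol x T := by
  rw [sixVol, abs_pos, ← affineIndependent_iff_signedSixVol_ne_zero]
  exact (hx T.1 T.2).comp_embedding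
    (T.1.equivFinOfCardEq (K.card_tet T.1 T.2)).symm.toEmbedding

/-- Six times the volume of the tetrahedron with the given set of vertices. -/
def absVol (x : V → E3) (T : Finset V) : ℝ :=
  if h : T.card = 4 then |signedSixVol fun i => x ((T.equivFinOfCardEq h).symm i).1| else 0

theorem prod_sixVol (x : V → E3) : ∏ T, K.sixVol x T = ∏ T ∈ K.tets, absVol x T := by
  rw [← Finset.prod_coe_sort K.tets (fun T => absVol x T)]
  exact Finset.prod_congr rfl fun T _ => by rw [sixVol, absVol, dif_pos (K.card_tet _ T.2)]

theorem absVol_eq (x : V → E3) {a b c d : V} (h : ({a, b, c, d} : Finset V) ∈ K.tets) :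
    absVol x {a, b, c, d} = |vol4 x a b c d| := by
  have hc := K.card_tet _ h
  rw [absVol, dif_pos hc]
  let f := (({a, b, c, d} : Finset V).equivFinOfCardEq hc).symm
  have hf : ({a, b, c, d} : Finset V) = {(f 0).1, (f 1).1, (f 2).1, (f 3).1} := by
    ext v
    constructor
    · intro hv
      obtain ⟨i, hi⟩ := f.surjective ⟨v, hv⟩
      have : v = (f i).1 := by rw [hi]
      rw [this]
      fin_cases i <;> simp
    · intro hv
      simp only [Finset.mem_insert, Finset.mem_singleton] at hv
      rcases hv with rfl | rfl | rfl | rfl <;> exact Subtype.property _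
  obtain ⟨r, hr, h2⟩ := IsAltChain.eq_or_eq_neg hf hc
  have h3 : (fun i => x (f i).1) = ![x (f 0).1, x (f 1).1, x (f 2).1, x (f 3).1] := by
    ext i : 1; fin_cases i <;> rfl
  change |signedSixVol fun i => x (f i).1| = _
  rw [h3]
  change |vol4 x _ _ _ _| = _
  rw [h2 (vol4_isAltChain x), abs_mul]
  rcases hr with hr | hr <;> rw [hr] <;> simp

theorem Orientation.form_apply (o : K.Orientation) (x : V → E3) (C : Finset K.Edge) {d : ℕ}
    (s : Fin d ≃ {e : K.Edge // e ∉ C}) (w : Fin d → K.Edge → ℝ) :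
    o.form x C s w = (∏ e : K.Edge, K.lengthMap x e) /
      √(|o.minor x C| * ∏ T : {T // T ∈ K.tets}, K.sixVol x T) *
        Matrix.det (Matrix.of fun i j => w i (s j).1) := rfl

theorem prod_lengthMap_nonneg (x : V → E3) : 0 ≤ ∏ e : K.Edge, K.lengthMap x e := by
  refine Finset.prod_nonneg fun e _ => ?_
  rcases e with ⟨e, he⟩
  induction e using Sym2.ind with
  | _ p q => exact dist_nonneg (x := x p) (y := x q)

open Matrix in
/-- The value of the form on a basis of the space of flat length differentials, by means of dual
coordinates. -/
theorem Orientation.abs_form (o : K.Orientation) {x : V → E3} (hx : K.Nondegenerate x)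
    {C : Finset K.Edge} (hC : o.IsBasic x C) {d : ℕ} (s : Fin d ≃ {e : K.Edge // e ∉ C})
    {w : Fin d → K.Edge → ℝ} (hw : ∀ i, w i ∈ o.flat x) {L : Matrix (Fin d) K.Edge ℝ}
    (hL : L * (Matrix.of fun e i => w i e) = 1) :
    |o.form x C s w| = (∏ e : K.Edge, K.lengthMap x e) /
      √(|(o.curvMatrix x + Lᵀ * L).det| * ∏ T : {T // T ∈ K.tets}, K.sixVol x T) := by
  have hsymm : (o.curvMatrix x).IsSymm := by
    rw [o.curvMatrix_eq hx]; exact chainMatrix_isSymm o.isAltChain x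
  have hAW : o.curvMatrix x * (Matrix.of fun e i => w i e) = 0 := by
    ext j i
    have := hw i
    rw [flat, LinearMap.mem_ker, Matrix.toLin'_apply] at this
    exact congrFun this j
  have hdet := det_principal_eq _ hsymm _ L hAW hL C s
  have hT : ((Matrix.of fun e i => w i e : Matrix K.Edge (Fin d) ℝ).submatrix
      (fun i => (s i).1) id).det = Matrix.det (Matrix.of fun i j => w i (s j).1) := by
    rw [← Matrix.det_transpose]; rfl
  rw [hT] at hdet
  change o.minor x C = _ at hdet
  have h0 := hC.2
  -- The square root of the minor contributes the absolute value of the determinant of `w` on the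
  -- complement of `C`, which cancels the value of the wedge product.
  rw [o.form_apply, hdet, abs_mul, abs_mul, abs_pow, abs_div, abs_of_nonneg (prod_lengthMap_nonneg x),
    abs_of_nonneg (Real.sqrt_nonneg _), mul_assoc, Real.sqrt_mul (by positivity),
    Real.sqrt_sq (abs_nonneg _)]
  have h1 : |Matrix.det (Matrix.of fun i j => w i (s j).1)| ≠ 0 := by
    intro h
    rw [abs_eq_zero] at h
    rw [hdet, h] at h0
    apply h0; ring
  rw [div_mul_eq_mul_div, mul_comm, mul_div_mul_left _ _ h1]

/-- The right-hand side of `abs_form` does not contain `C`. On dependent vectors both forms vanish.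
-/
theorem Orientation.abs_form_eq (o : K.Orientation) {x : V → E3} (hx : K.Nondegenerate x)
    {C C' : Finset K.Edge} (hC : o.IsBasic x C) (hC' : o.IsBasic x C') {d : ℕ}
    (s : Fin d ≃ {e : K.Edge // e ∉ C}) (s' : Fin d ≃ {e : K.Edge // e ∉ C'})
    {w : Fin d → K.Edge → ℝ} (hw : ∀ i, w i ∈ o.flat x) :
    |o.form x C s w| = |o.form x C' s' w| := by
  by_cases hli : LinearIndependent ℝ w
  · obtain ⟨L, hL⟩ := exists_left_inverse_of_linearIndependent hli
    rw [o.abs_form hx hC s hw hL, o.abs_form hx hC' s' hw hL]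
  · rw [AlternatingMap.map_linearDependent _ _ hli, AlternatingMap.map_linearDependent _ _ hli]

/-- The coordinates outside `C` are coordinates on the kernel; on the dual basis the wedge product
takes the value 1. -/
theorem Orientation.exists_form_ne_zero (o : K.Orientation) {x : V → E3}
    (hx : K.Nondegenerate x) {C : Finset K.Edge} (hC : o.IsBasic x C) {d : ℕ}
    (s : Fin d ≃ {e : K.Edge // e ∉ C}) : d = Module.finrank ℝ (o.flat x) ∧
      ∃ w : Fin d → K.Edge → ℝ, (∀ i, w i ∈ o.flat x) ∧ o.form x C s w ≠ 0 := by
  obtain ⟨h1, w, hw, hws⟩ := kernel_of_principal_minor (o.curvMatrix x) C hC.1 hC.2 s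
  refine ⟨h1, w, hw, ?_⟩
  have h2 : (Matrix.of fun i j => w i (s j).1 : Matrix (Fin d) (Fin d) ℝ) = 1 := by
    ext i j
    rw [Matrix.of_apply, hws, Matrix.one_apply]
  rw [o.form_apply, h2, Matrix.det_one, mul_one]
  refine div_ne_zero (Finset.prod_ne_zero_iff.2 fun e _ => hx.lengthMap_ne_zero e) ?_
  exact (Real.sqrt_pos.2 (mul_pos (abs_pos.2 hC.2)
    (Finset.prod_pos fun T _ => hx.sixVol_pos T))).ne'

end ClosedTriangulation

end

noncomputable section

/-! ### Invariance under Pachner moves -/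

namespace ClosedTriangulation

variable {V : Type*} [Fintype V] [DecidableEq V] {K K' : ClosedTriangulation V}

theorem chainMatrix_mk {σ : V → V → V → V → ℝ} (hσ : IsAltChain σ) (x : V → E3) {a b : V}
    (hab : s(a, b) ∈ K.edges) (k : K.Edge) : K.chainMatrix σ x ⟨s(a, b), hab⟩ k =
      -(1 / 2) * (dist (x a) (x b) * curv σ x (K.sqRate x (Pi.single k 1)) a b) := by
  rw [chainMatrix, Matrix.of_apply, lengthMap, Sym2.lift_mk]
  have h4 : s(s(a, b).out.1, s(a, b).out.2) = s(a, b) := s(a, b).out_eq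
  rcases Sym2.eq_iff.1 h4 with ⟨h5, h6⟩ | ⟨h5, h6⟩
  · rw [h5, h6]
  · rw [h5, h6, hσ.curv_comm (sqRate_comm x _)]

theorem Agree.linearCombination {d : ℕ} {w : Fin d → K.Edge → ℝ} {w' : Fin d → K'.Edge → ℝ}
    (h : ∀ i, K.Agree K' (w i) (w' i)) (c : Fin d → ℝ) :
    K.Agree K' (∑ i, c i • w i) (∑ i, c i • w' i) := by
  intro f hf hf'
  simp only [Finset.sum_apply, Pi.smul_apply]
  exact Finset.sum_congr rfl fun i _ => by rw [h i f hf hf']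

namespace IsPachnerAt

variable {a b c d e : V} (h : K.IsPachnerAt K' a b c d e)
include h

theorem sqRate_new (x : V → E3) {w' : K'.Edge → ℝ} (hw : ∀ f : K'.Edge, f.1 ∈ K.edges → w' f = 0) :
    K'.sqRate x w' = fun p q =>
      (dist (x d) (x e) * w' ⟨s(d, e), h.new_edge⟩) * pairInd d e p q := by
  ext p q
  by_cases hpq : s(p, q) = s(d, e)
  · have hlen : ∀ l : K'.Edge → ℝ, K'.len l p q = K'.len l d e := by
      intro l; simp only [len, hpq]
    rw [sqRate, hlen, hlen, len_lengthMap h.new_edge, len, dif_pos h.new_edge, pairInd,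
      if_pos hpq, mul_one]
  · rw [pairInd, if_neg hpq, mul_zero, sqRate, len.eq_def _ w']
    split_ifs with h1
    · rw [hw, mul_zero]
      exact (h.mem_edges_iff.1 h1).resolve_right hpq
    · rw [mul_zero]

/-- The difference of two flat extensions is supported on `de`, and changing only this length gives
a nonzero curvature at `de`. -/
theorem flat_unique (o : K.Orientation) {x : V → E3} (hx : K.Nondegenerate x)
    (hx' : K'.Nondegenerate x) {w : K.Edge → ℝ} {v' w' : K'.Edge → ℝ}
    (hv : v' ∈ (h.orientation o).flat x) (hw : w' ∈ (h.orientation o).flat x)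
    (hav : K.Agree K' w v') (haw : K.Agree K' w w') : v' = w' := by
  have h0 : ∀ f : K'.Edge, f.1 ∈ K.edges → (v' - w') f = 0 := by
    intro f hf
    rw [Pi.sub_apply, sub_eq_zero]
    exact (hav f.1 hf f.2).symm.trans (haw f.1 hf f.2)
  have ha : K.Agree K' 0 (v' - w') := fun f hf hf' => (h0 ⟨f, hf'⟩ hf).symm
  have h1 := ((h.mem_flat_iff o hx hx' ha).1 (sub_mem hv hw)).2
  rw [h.sqRate_new x h0, curv_smul] at h1
  have h2 := (mul_eq_zero.1 h1).resolve_right (h.curv_pairInd_self_ne_zero hx hx')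
  have h3 := (mul_eq_zero.1 h2).resolve_left (dist_ne_zero.2 (hx'.ne_of_edge h.new_edge))
  rw [← sub_eq_zero]
  ext f
  rcases h.mem_edges_iff.1 f.2 with hf | hf
  · exact h0 f hf
  · rw [show f = ⟨s(d, e), h.new_edge⟩ from Subtype.ext hf, h3, Pi.zero_apply]

theorem exists_flat_extension (o : K.Orientation) {x : V → E3} (hx : K.Nondegenerate x)
    (hx' : K'.Nondegenerate x) {w : K.Edge → ℝ} (hw : w ∈ o.flat x) :
    ∃ w' ∈ (h.orientation o).flat x, K.Agree K' w w' := by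
  let u : K'.Edge → ℝ := fun f => if hf : f.1 ∈ K.edges then w ⟨f.1, hf⟩ else 0
  -- The rate of `de` is the solution of the single linear equation that makes the curvature of the
  -- 4-simplex at `de` vanish.
  obtain ⟨t, ht⟩ : ∃ t, t = -curv (simplexBoundary a b c d e) x (K'.sqRate x u) d e /
    (dist (x d) (x e) * curv (simplexBoundary a b c d e) x (pairInd d e) d e) := ⟨_, rfl⟩
  let v : K'.Edge → ℝ := Pi.single ⟨s(d, e), h.new_edge⟩ t
  have hv0 : ∀ f : K'.Edge, f.1 ∈ K.edges → v f = 0 := by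
    intro f hf
    refine Pi.single_eq_of_ne ?_ _
    rintro rfl
    exact h.2.2.2.1 hf
  have ha : K.Agree K' w (u + v) := by
    intro f hf hf'
    rw [Pi.add_apply, hv0 _ hf, add_zero]
    simp only [u, dif_pos hf]
  refine ⟨u + v, (h.mem_flat_iff o hx hx' ha).2 ⟨hw, ?_⟩, ha⟩
  have h1 : K'.sqRate x (u + v) = fun p q => K'.sqRate x u p q + K'.sqRate x v p q := by
    ext p q; rw [sqRate, sqRate, sqRate, len_add]; ring
  have h2 : v ⟨s(d, e), h.new_edge⟩ = t := Pi.single_eq_same _ _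
  rw [h1, curv_add, h.sqRate_new x hv0, curv_smul, h2, ht]
  have := h.curv_pairInd_self_ne_zero hx hx'
  have := dist_ne_zero.2 (hx'.ne_of_edge h.new_edge)
  field_simp
  ring

theorem agree_iff {w : K.Edge → ℝ} {w' : K'.Edge → ℝ} :
    K.Agree K' w w' ↔ w = fun f => w' ⟨f.1, h.edges_subset f.2⟩ :=
  ⟨fun ha => funext fun f => ha f.1 f.2 _, fun ha f hf hf' => by rw [ha]⟩

theorem flat_bijection (o : K.Orientation) {x : V → E3} (hx : K.Nondegenerate x)
    (hx' : K'.Nondegenerate x) :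
    (∀ w ∈ o.flat x, ∃! w', w' ∈ (h.orientation o).flat x ∧ K.Agree K' w w') ∧
    (∀ w' ∈ (h.orientation o).flat x, ∃! w, w ∈ o.flat x ∧ K.Agree K' w w') := by
  constructor
  · intro w hw
    obtain ⟨w', hw', ha⟩ := h.exists_flat_extension o hx hx' hw
    exact ⟨w', ⟨hw', ha⟩, fun v' hv' => h.flat_unique o hx hx' hv'.1 hw' hv'.2 ha⟩
  · intro w' hw'
    have ha : K.Agree K' (fun f => w' ⟨f.1, h.edges_subset f.2⟩) w' := h.agree_iff.2 rfl
    exact ⟨_, ⟨((h.mem_flat_iff o hx hx' ha).1 hw').1, ha⟩, fun v hv => h.agree_iff.1 hv.2⟩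

theorem tangent_bijection (o : K.Orientation) {x : V → E3} (hx : K.Nondegenerate x)
    (hx' : K'.Nondegenerate x) :
    (∀ w ∈ K.tangent x, ∃! w', w' ∈ K'.tangent x ∧ K.Agree K' w w') ∧
    (∀ w' ∈ K'.tangent x, ∃! w, w ∈ K.tangent x ∧ K.Agree K' w w') := by
  constructor
  · intro w hw
    obtain ⟨y, hy⟩ := (mem_tangent hx w).1 hw
    have ht : fderiv ℝ K'.lengthMap x y ∈ K'.tangent x := ⟨y, rfl⟩
    have ha : K.Agree K' w (fderiv ℝ K'.lengthMap x y) := by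
      intro f hf hf'
      induction f using Sym2.ind with
      | _ p q =>
        have h1 := sqRate_fderiv hx' y hf'
        rw [← hy p q hf, sqRate, sqRate, len_lengthMap hf', len_lengthMap hf, len, len,
          dif_pos hf, dif_pos hf'] at h1
        exact (mul_left_cancel₀ (dist_ne_zero.2 (hx.ne_of_edge hf)) h1).symm
    refine ⟨_, ⟨ht, ha⟩, fun v' hv' => ?_⟩
    exact h.flat_unique o hx hx' (tangent_le_flat _ hx' hv'.1) (tangent_le_flat _ hx' ht) hv'.2 ha
  · intro w' hw'
    obtain ⟨y, hy⟩ := (mem_tangent hx' w').1 hw'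
    have ha : K.Agree K' (fun f => w' ⟨f.1, h.edges_subset f.2⟩) w' := h.agree_iff.2 rfl
    refine ⟨_, ⟨(mem_tangent hx _).2 ⟨y, fun p q hpq => ?_⟩, ha⟩, fun v hv => h.agree_iff.1 hv.2⟩
    rw [h.agree_sqRate ha x hpq, hy p q (h.edges_subset hpq)]

/-- The edges after a Pachner move. -/
def edgeEquiv : K.Edge ⊕ Unit ≃ K'.Edge :=
  Equiv.ofBijective (Sum.elim (fun f => ⟨f.1, h.edges_subset f.2⟩)
    fun _ => ⟨s(d, e), h.new_edge⟩) (by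
    constructor
    · rintro (f | ⟨⟩) (g | ⟨⟩) hfg
      · have hf : f.1 = g.1 := congrArg (fun i : K'.Edge => i.1) hfg
        rw [Subtype.ext hf]
      · have hf : f.1 = s(d, e) := congrArg (fun i : K'.Edge => i.1) hfg
        exact absurd (hf ▸ f.2) h.2.2.2.1
      · have hg : s(d, e) = g.1 := congrArg (fun i : K'.Edge => i.1) hfg
        exact absurd (hg ▸ g.2) h.2.2.2.1
      · rfl
    · intro f
      rcases h.mem_edges_iff.1 f.2 with hf | hf
      · exact ⟨.inl ⟨f.1, hf⟩, rfl⟩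
      · exact ⟨.inr (), Subtype.ext hf.symm⟩)

theorem prod_lengthMap (x : V → E3) : ∏ f : K'.Edge, K'.lengthMap x f =
    (∏ f : K.Edge, K.lengthMap x f) * dist (x d) (x e) := by
  rw [← Fintype.prod_equiv h.edgeEquiv (fun f => K'.lengthMap x (h.edgeEquiv f)) _ fun _ => rfl,
    Fintype.prod_sum_type]
  simp only [Finset.univ_unique, Finset.prod_singleton]
  rfl

theorem prod_sixVol {x : V → E3} : (∏ T, K'.sixVol x T) *
      (|vol4 x a b c d| * |vol4 x a b c e|) = (∏ T, K.sixVol x T) *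
      (|vol4 x a b d e| * |vol4 x b c d e| * |vol4 x a c d e|) := by
  obtain ⟨n1, n2, n3⟩ := h.new_mem
  have hnd := h.nodup
  simp only [List.nodup_cons, List.mem_cons, List.not_mem_nil, or_false, not_or,
    List.nodup_nil, not_false_eq_true, and_true] at hnd
  obtain ⟨⟨hab, hac, had, hae⟩, ⟨hbc, hbd, hbe⟩, ⟨hcd, hce⟩, hde⟩ := hnd
  have ne : ∀ {S T : Finset V} {v : V}, v ∈ S → v ∉ T → S ≠ T := fun h1 h2 h3 => h2 (h3 ▸ h1)
  have e1 : ({a, b, c, d} : Finset V) ≠ {a, b, c, e} := ne (v := d) (by simp)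
    (by simp [Ne.symm had, Ne.symm hbd, Ne.symm hcd, hde])
  have e2 : ({a, b, d, e} : Finset V) ≠ {b, c, d, e} := ne (v := a) (by simp)
    (by simp [hab, hac, had, hae])
  have e3 : ({a, b, d, e} : Finset V) ≠ {a, c, d, e} := ne (v := b) (by simp)
    (by simp [Ne.symm hab, hbc, hbd, hbe])
  have e4 : ({b, c, d, e} : Finset V) ≠ {a, c, d, e} := ne (v := b) (by simp)
    (by simp [Ne.symm hab, hbc, hbd, hbe])
  have hold : ({{a, b, c, d}, {a, b, c, e}} : Finset (Finset V)) ⊆ K.tets := by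
    intro T hT
    simp only [Finset.mem_insert, Finset.mem_singleton] at hT
    rcases hT with rfl | rfl
    exacts [h.2.1, h.2.2.1]
  have hdisj : Disjoint (K.tets \ {{a, b, c, d}, {a, b, c, e}})
      ({{a, b, d, e}, {b, c, d, e}, {a, c, d, e}} : Finset (Finset V)) := by
    rw [Finset.disjoint_right]
    intro T hT hT'
    simp only [Finset.mem_insert, Finset.mem_singleton] at hT
    rcases hT with rfl | rfl | rfl <;>
      exact h.notMem_of_mem (by simp) (by simp) (Finset.mem_sdiff.1 hT').1
  have p1 : ∏ T ∈ ({{a, b, c, d}, {a, b, c, e}} : Finset (Finset V)), absVol x T =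
      |vol4 x a b c d| * |vol4 x a b c e| := by
    rw [Finset.prod_pair e1, absVol_eq x h.2.1, absVol_eq x h.2.2.1]
  have p2 : ∏ T ∈ ({{a, b, d, e}, {b, c, d, e}, {a, c, d, e}} : Finset (Finset V)), absVol x T =
      |vol4 x a b d e| * |vol4 x b c d e| * |vol4 x a c d e| := by
    rw [Finset.prod_insert (by simp [e2, e3]), Finset.prod_pair e4, absVol_eq x n1,
      absVol_eq x n2, absVol_eq x n3, mul_assoc]
  rw [ClosedTriangulation.prod_sixVol, ClosedTriangulation.prod_sixVol, ← p1, ← p2, h.2.2.2.2,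
    Finset.prod_union hdisj, ← Finset.prod_sdiff hold]
  ring

open Matrix in
/-- The change of the determinant under a Pachner move. -/
theorem det_eq (o : K.Orientation) {x : V → E3} (hx : K.Nondegenerate x)
    (hx' : K'.Nondegenerate x) {n : ℕ} (L : Matrix (Fin n) K.Edge ℝ)
    (L' : Matrix (Fin n) K'.Edge ℝ) (hL : ∀ i f, L' i (h.edgeEquiv (.inl f)) = L i f)
    (hL0 : ∀ i, L' i (h.edgeEquiv (.inr ())) = 0) :
    |((h.orientation o).curvMatrix x + L'ᵀ * L').det| =
      |curv (simplexBoundary a b c d e) x (pairInd d e) d e| / 2 * dist (x d) (x e) ^ 2 *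
        |(o.curvMatrix x + Lᵀ * L).det| := by
  rw [Orientation.curvMatrix_eq _ hx', Orientation.curvMatrix_eq _ hx, h.chain_orientation]
  obtain ⟨β, hβ⟩ : ∃ β, β = simplexBoundary a b c d e := ⟨_, rfl⟩
  have hβalt : IsAltChain β := hβ ▸ simplexBoundary_isAltChain a b c d e
  have key : ∀ m : V → V → ℝ, (∀ p q, m p q = m q p) → (∀ p, m p p = 0) → ∃ t, ∀ p q, x p ≠ x q →
      curv β x m p q = t * curv β x (pairInd d e) p q := by
    intro m hm hm0; rw [hβ]; exact h.exists_curv_eq_mul hx hx' hm hm0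
  have h0 := h.curv_pairInd_self_ne_zero hx hx'
  rw [← hβ] at h0 ⊢
  let z : K'.Edge := ⟨s(d, e), h.new_edge⟩
  have hz : h.edgeEquiv (.inr ()) = z := rfl
  have hdist := dist_ne_zero.2 (hx'.ne_of_edge h.new_edge)
  -- `B` is the contribution of the 4-simplex, the rank-one part of the new curvature matrix.
  obtain ⟨B, hB⟩ : ∃ B : Matrix K'.Edge K'.Edge ℝ,
      B = (-o.chain a b c d) • K'.chainMatrix β x := ⟨_, rfl⟩
  have hBsymm : ∀ j k, B j k = B k j := by
    intro j k
    rw [hB, Matrix.smul_apply, Matrix.smul_apply, (chainMatrix_isSymm hβalt x).apply]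
  have hadd : K'.chainMatrix (movedChain o a b c d e) x = K'.chainMatrix o.chain x + B := by
    ext j k
    rw [hB, Matrix.add_apply, Matrix.smul_apply]
    simp only [chainMatrix, Matrix.of_apply, curv_movedChain, ← hβ, smul_eq_mul]
    ring
  have hzz : B z z = o.chain a b c d * (1 / 2 * dist (x d) (x e) ^ 2 *
      curv β x (pairInd d e) d e) := by
    rw [hB, Matrix.smul_apply, chainMatrix_mk hβalt, h.sqRate_new x, curv_smul, smul_eq_mul,
      Pi.single_eq_same]
    · ring
    · intro f hf
      refine Pi.single_eq_of_ne ?_ _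
      rintro rfl
      exact h.2.2.2.1 hf
  have hs : o.chain a b c d ≠ 0 := o.chain_ne_zero_iff.2 h.2.1
  have hzz0 : B z z ≠ 0 := by rw [hzz]; positivity
  have hrank : ∀ j k, B j k * B z z = B j z * B z k := by
    intro j k
    obtain ⟨t, ht⟩ := key _ (sqRate_comm x (Pi.single k 1 : K'.Edge → ℝ)) (sqRate_self x _)
    obtain ⟨u, hu⟩ := key _ (sqRate_comm x (Pi.single z 1 : K'.Edge → ℝ)) (sqRate_self x _)
    have hform : ∀ i : K'.Edge, ∃ r, B i k = t * r ∧ B i z = u * r := by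
      rintro ⟨i, hi⟩
      induction i using Sym2.ind with
      | _ p q =>
        have hpq := hx'.ne_of_edge hi
        refine ⟨-o.chain a b c d * (-(1 / 2) * (dist (x p) (x q) *
          curv β x (pairInd d e) p q)), ?_, ?_⟩
        · rw [hB, Matrix.smul_apply, chainMatrix_mk hβalt, ht p q hpq, smul_eq_mul]; ring
        · rw [hB, Matrix.smul_apply, chainMatrix_mk hβalt, hu p q hpq, smul_eq_mul]; ring
    obtain ⟨r1, h1, h2⟩ := hform j
    obtain ⟨r2, h3, h4⟩ := hform z
    rw [h1, h2, h3, h4]; ring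
  -- No tetrahedron of `K` contains `de`, so the old chain gives a matrix bordered by zeros on the
  -- edges of `K'`.
  have hrow : ∀ k, K'.chainMatrix o.chain x z k = 0 := by
    intro k
    rw [chainMatrix_mk o.isAltChain, h.curv_chain_new]; ring
  have hdet := det_rank_one_extension h.edgeEquiv (K.chainMatrix o.chain x + Lᵀ * L) B
    (K'.chainMatrix (movedChain o a b c d e) x + L'ᵀ * L') hrank hzz0 (fun i j => ?_)
    (fun j => ?_) (fun j => ?_)
  · rw [hdet, hz, hzz, abs_mul, abs_mul, abs_mul, abs_mul]
    have : |o.chain a b c d| = 1 := by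
      rcases o.chain_eq_one_or h.2.1 with h | h <;> rw [h] <;> norm_num
    rw [this, abs_of_pos (by norm_num : (0 : ℝ) < 1 / 2), abs_of_nonneg (by positivity :
      0 ≤ dist (x d) (x e) ^ 2)]
    ring
  · rw [hadd, Matrix.add_apply, Matrix.add_apply, Matrix.add_apply, Matrix.mul_apply,
      Matrix.mul_apply]
    simp only [Matrix.transpose_apply, hL]
    have ha : K.Agree K' (Pi.single j 1) (Pi.single (h.edgeEquiv (.inl j)) 1) := by
      rw [h.agree_iff]
      ext f
      have : (h.edgeEquiv (.inl f)) = ⟨f.1, h.edges_subset f.2⟩ := rfl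
      rw [← this, Pi.single_apply, Pi.single_apply]
      simp
    have : K'.chainMatrix o.chain x (h.edgeEquiv (.inl i)) (h.edgeEquiv (.inl j)) =
        K.chainMatrix o.chain x i j := by
      rw [chainMatrix, chainMatrix, Matrix.of_apply, Matrix.of_apply, h.agree_curv ha]
      rfl
    rw [this]; ring
  · rw [hadd, Matrix.add_apply, Matrix.add_apply, Matrix.mul_apply]
    simp only [Matrix.transpose_apply, hL0]
    rw [hz, hrow]; simp
  · rw [hadd, Matrix.add_apply, Matrix.add_apply, Matrix.mul_apply]
    simp only [hL0]
    rw [hz, (chainMatrix_isSymm o.isAltChain x).apply, hrow]; simp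

open Matrix in
-- By `det_eq` and the two volume relations, the expression under the root is multiplied by exactly
-- l_de², which matches the additional length in the numerator.
theorem abs_form_eq (o : K.Orientation) {x : V → E3} (hx : K.Nondegenerate x)
    (hx' : K'.Nondegenerate x) {C : Finset K.Edge} {C' : Finset K'.Edge} (hC : o.IsBasic x C)
    (hC' : (h.orientation o).IsBasic x C') {n : ℕ} (s : Fin n ≃ {e : K.Edge // e ∉ C})
    (s' : Fin n ≃ {e : K'.Edge // e ∉ C'}) {w : Fin n → K.Edge → ℝ} {w' : Fin n → K'.Edge → ℝ}
    (hw : ∀ i, w i ∈ o.flat x) (hw' : ∀ i, w' i ∈ (h.orientation o).flat x)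
    (ha : ∀ i, K.Agree K' (w i) (w' i)) :
    |o.form x C s w| = |(h.orientation o).form x C' s' w'| := by
  by_cases hli : LinearIndependent ℝ w
  · obtain ⟨L, hL⟩ := exists_left_inverse_of_linearIndependent hli
    -- Extended by zero at `de`, the left inverse for `w` is one for `w'` too, because the two
    -- families agree on the old edges.
    let L' : Matrix (Fin n) K'.Edge ℝ := Matrix.of fun i f =>
      Sum.elim (fun g => L i g) (fun _ => 0) (h.edgeEquiv.symm f)
    have hL1 : ∀ i f, L' i (h.edgeEquiv (.inl f)) = L i f := by intro i f; simp [L']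
    have hL0 : ∀ i, L' i (h.edgeEquiv (.inr ())) = 0 := by intro i; simp [L']
    have hL' : L' * (Matrix.of fun e i => w' i e) = 1 := by
      rw [← hL]
      ext i j
      rw [Matrix.mul_apply, Matrix.mul_apply,
        ← Fintype.sum_equiv h.edgeEquiv (fun f => L' i (h.edgeEquiv f) *
          (Matrix.of fun e i => w' i e) (h.edgeEquiv f) j) _ fun _ => rfl, Fintype.sum_sum_type]
      simp only [hL1, hL0, zero_mul, Finset.sum_const_zero, add_zero, Matrix.of_apply]
      refine Finset.sum_congr rfl fun f _ => ?_
      congr 1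
      exact (ha j f.1 f.2 _).symm
    rw [o.abs_form hx hC s hw hL, Orientation.abs_form _ hx' hC' s' hw' hL',
      h.det_eq o hx hx' L L' hL1 hL0, h.prod_lengthMap]
    have k1 := abs_pos.2 (hx.vol4_ne_zero h.2.1)
    have k2 := abs_pos.2 (hx.vol4_ne_zero h.2.2.1)
    have hdist := dist_pos.2 (hx'.ne_of_edge h.new_edge)
    have e1 := h.curv_pairInd_self hx hx'
    have e2 := h.prod_sixVol (x := x)
    obtain ⟨R, hR⟩ : ∃ R, R = |curv (simplexBoundary a b c d e) x (pairInd d e) d e| := ⟨_, rfl⟩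
    have e3 : R / 2 * dist (x d) (x e) ^ 2 * |(o.curvMatrix x + Lᵀ * L).det| *
        (∏ T, K'.sixVol x T) = dist (x d) (x e) ^ 2 *
          (|(o.curvMatrix x + Lᵀ * L).det| * ∏ T, K.sixVol x T) := by
      rw [← hR] at e1
      apply mul_right_cancel₀ (mul_pos k1 k2).ne'
      calc _ = R / 2 * dist (x d) (x e) ^ 2 * |(o.curvMatrix x + Lᵀ * L).det| *
            ((∏ T, K'.sixVol x T) * (|vol4 x a b c d| * |vol4 x a b c e|)) := by ring
        _ = dist (x d) (x e) ^ 2 * |(o.curvMatrix x + Lᵀ * L).det| * (∏ T, K.sixVol x T) *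
            (R * (|vol4 x a b d e| * |vol4 x b c d e| * |vol4 x a c d e|)) / 2 := by
          rw [e2]; ring
        _ = _ := by rw [e1]; ring
    rw [← hR, e3, Real.sqrt_mul (sq_nonneg (dist (x d) (x e))), Real.sqrt_sq hdist.le,
      mul_comm _ (dist (x d) (x e)), mul_div_mul_left _ _ hdist.ne']
  -- A relation among the `w i` passes to the `w' i`, because the zero differential has only one
  -- flat extension.
  · have hli' : ¬ LinearIndependent ℝ w' := by
      intro hli'
      apply hli
      rw [Fintype.linearIndependent_iff] at hli' ⊢
      intro g hg
      apply hli' g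
      refine h.flat_unique o hx hx' (w := 0) ?_ (zero_mem _) ?_ fun _ _ _ => rfl
      · exact sum_mem fun i _ => Submodule.smul_mem _ _ (hw' i)
      · rw [← hg]; exact Agree.linearCombination ha g
    rw [AlternatingMap.map_linearDependent _ _ hli, AlternatingMap.map_linearDependent _ _ hli']

end IsPachnerAt

end ClosedTriangulation

end

theorem theorem4 {V : Type*} [Fintype V] [DecidableEq V]
    (K : ClosedTriangulation V) (o : K.Orientation) :
    -- a subset `C` which works in the general position exists
    (∃ C : Finset K.Edge, ∃ U : Set (V → E3), IsOpen U ∧ Dense U ∧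
      ∀ x ∈ U, K.Nondegenerate x ∧ o.IsBasic x C) ∧
    -- defect angles vanish to first order along the variety of permitted configurations, and
    -- nothing else is infinitesimally flat if the first Betti number is zero
    (∀ x : V → E3, K.Nondegenerate x →
      K.tangent x ≤ o.flat x ∧ (K.FirstBettiZero → K.tangent x = o.flat x)) ∧
    -- the form is a nonzero form of the top degree
    (∀ x : V → E3, K.Nondegenerate x → ∀ C : Finset K.Edge, o.IsBasic x C →
      ∀ (d : ℕ) (s : Fin d ≃ {e : K.Edge // e ∉ C}),
        d = Module.finrank ℝ (o.flat x) ∧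
        (∃ w : Fin d → K.Edge → ℝ, (∀ i, w i ∈ o.flat x) ∧ o.form x C s w ≠ 0) ∧
        (K.FirstBettiZero → d = Module.finrank ℝ (K.tangent x) ∧
          ∃ w : Fin d → K.Edge → ℝ, (∀ i, w i ∈ K.tangent x) ∧ o.form x C s w ≠ 0)) ∧
    -- it does not depend, up to sign, on the choice of `C` (for all vectors of `flat`, hence in
    -- particular for all tangent vectors to the variety)
    (∀ x : V → E3, K.Nondegenerate x →
      ∀ C C' : Finset K.Edge, o.IsBasic x C → o.IsBasic x C' →
      ∀ (d : ℕ) (s : Fin d ≃ {e : K.Edge // e ∉ C}) (s' : Fin d ≃ {e : K.Edge // e ∉ C'})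
        (w : Fin d → K.Edge → ℝ), (∀ i, w i ∈ o.flat x) →
        |o.form x C s w| = |o.form x C' s' w|) ∧
    -- it is unchanged, up to sign, under Pachner moves, when the length differentials of the two
    -- complexes are identified by means of their common edges
    (∀ (K' : ClosedTriangulation V) (o' : K'.Orientation), K.PachnerMove K' →
      ∀ x : V → E3, K.Nondegenerate x → K'.Nondegenerate x →
        (∀ w ∈ o.flat x, ∃! w', w' ∈ o'.flat x ∧ K.Agree K' w w') ∧
        (∀ w' ∈ o'.flat x, ∃! w, w ∈ o.flat x ∧ K.Agree K' w w') ∧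
        (∀ w ∈ K.tangent x, ∃! w', w' ∈ K'.tangent x ∧ K.Agree K' w w') ∧
        (∀ w' ∈ K'.tangent x, ∃! w, w ∈ K.tangent x ∧ K.Agree K' w w') ∧
        ∀ (C : Finset K.Edge) (C' : Finset K'.Edge), o.IsBasic x C → o'.IsBasic x C' →
        ∀ (d : ℕ) (s : Fin d ≃ {e : K.Edge // e ∉ C}) (s' : Fin d ≃ {e : K'.Edge // e ∉ C'})
          (w : Fin d → K.Edge → ℝ) (w' : Fin d → K'.Edge → ℝ),
          (∀ i, w i ∈ o.flat x) → (∀ i, w' i ∈ o'.flat x) → (∀ i, K.Agree K' (w i) (w' i)) →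
          |o.form x C s w| = |o'.form x C' s' w'|) := by
  refine ⟨o.exists_generic_basic, fun x hx => ?_, fun x hx C hC d s => ?_,
    fun x hx C C' hC hC' d s s' w hw => o.abs_form_eq hx hC hC' s s' hw, fun K' o' hK x hx hx' => ?_⟩
  · exact ⟨ClosedTriangulation.tangent_le_flat o hx, fun hK =>
      le_antisymm (ClosedTriangulation.tangent_le_flat o hx)
        (ClosedTriangulation.flat_le_tangent o hK hx)⟩
  · obtain ⟨h1, h2⟩ := o.exists_form_ne_zero hx hC s
    refine ⟨h1, h2, fun hK => ?_⟩
    rw [le_antisymm (ClosedTriangulation.tangent_le_flat o hx)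
      (ClosedTriangulation.flat_le_tangent o hK hx)]
    exact ⟨h1, h2⟩
  · obtain ⟨a, b, c, d, e, h⟩ := hK
    have h : K.IsPachnerAt K' a b c d e := h
    -- The given orientation of `K'` may be replaced with the one carried over from `o` by the move.
    rw [(h.orientation o).flat_eq o' hx']
    obtain ⟨h1, h2⟩ := h.flat_bijection o hx hx'
    obtain ⟨h3, h4⟩ := h.tangent_bijection o hx hx'
    refine ⟨h1, h2, h3, h4, fun C C' hC hC' d s s' w w' hw hw' ha => ?_⟩
    rw [(h.orientation o).form_eq o' hx']
    exact h.abs_form_eq o hx hx' hC (((h.orientation o).isBasic_iff o' hx' C').1 hC') s s' hw hw' ha
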